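/- A robot moves in the plane according to $\dot x=v\cos\theta,\ \dot y=v\sin\theta,\ \dot\theta=u,\ |u|\le\bar u$ ($\bar u>0$), with initial position $r_{\rm in}$ and arbitrary initial orientation. The field is radial, $D(t,r)=c\,f(\|r-r^0(t)\|)$ for $r\neq r^0(t)$, where $f:(0,\infty)\to\mathbb R$ is $C^2$ with $f'<0$ and is known, while the intensity $c$ and the $C^2$ centre $r^0(\cdot)$ are unknown but satisfy, for all $t\ge 0$, $$(*)\qquad 0<R_{\rm in}^-\le\|r_{\rm in}-r^0(0)\|\le R_{\rm in}^+,\quad \|\dot r^0(t)\|\le v_0,\quad \|\ddot r^0(t)\|\le a_0,\quad 0<c_-\le c\le c_+ .$$ Let $d_0/c_-$ and $d_0/c_+$ lie in the range of $f$. With $d(t)=D(t,r(t))$, the control law is $u=-\operatorname{sgn}\{\dot d+\chi[d-d_0]\}\,\bar u$, where $\chi(p)=\gamma p$ for $|p|\le\delta$ and $\chi(p)=\operatorname{sgn}(p)\gamma\delta$ otherwise, $\gamma,\delta>0$. Motions of the closed loop are Filippov solutions: for almost all $t$, $u$ is given by the law where $S:=\dot d+\chi[d-d_0]\ne0$, and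 $u\in[-\bar u,\bar u]$ is arbitrary where $S=0$. Motions that slide for a positive time along the repelling part of the surface $S=0$, that is, where $\langle\nabla D,(-\sin\theta,\cos\theta)\rangle<0$, are excluded. Put $R'_\pm:=R_{\rm in}^\pm\pm(2v+4\pi v_0)/\bar u$, $R_-:=\min\{R'_-,f^{-1}(d_0/c_-),f^{-1}(d_0/c_+)\}$ and $R_+:=\max\{R'_+,f^{-1}(d_0/c_-),f^{-1}(d_0/c_+)\}$. Suppose that $v>v_0$, that $R_{\rm in}^->(2v+4\pi v_0)/\bar u$, and that for some $\Delta_u>0$ and all $v_n\in[0,v_0]$ $$\frac{a_0}{\sqrt{v^2-v_n^2}}+\frac{\left(\sqrt{v^2-v_n^2}+\sqrt{v_0^2-v_n^2}\right)^2}{R_-\sqrt{v^2-v_n^2}}\le\bar u-\Delta_u .$$ Then there exist $\gamma,\delta>0$ such that whenever $(*)$ holds, the controller brings the robot to the desired isoline: the closed loop has a motion defined for all $t\ge0$, and along every such motion the robot never meets the centre $r^0(t)$ and $d(t)\to d_0$ as $t\to\infty$. Specifically, this is true for all $\gamma,\delta>0$ such that $$0<\mu_*:=\frac{\gamma\delta}{c_-\min_{R\in[R_-,R_+]}|f'(R)|}<\sqrt{v^2+(v-v_0)^2}-v,$$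 $$\left(\frac{\frac{v}{R_-}+\gamma+b_n\mu_*}{\sigma(\mu_*)}+\frac{v\left(a_0+\frac{v_0^2}{R_-}\right)}{\sigma(\mu_*)^3}\right)\mu_*<\Delta_u,$$ where $\sigma(\mu_*):=\sqrt{(v-v_0)^2-2v\mu_*-\mu_*^2}$ and $b_n:=\max_{R\in[R_-,R_+]}|f''(R)|/|f'(R)|$; and such $\gamma,\delta$ exist. -/

import Mathlib

open Set Filter Topology MeasureTheory

noncomputable section

namespace RadialTracking

/-- The plane with its Euclidean norm. -/
abbrev Plane : Type := EuclideanSpace ℝ (Fin 2)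

/-- The unit vector with orientation angle `θ`. -/
def heading (θ : ℝ) : Plane := !₂[Real.cos θ, Real.sin θ]

/-- The heading rotated counter-clockwise through a right angle. -/
def leftNormal (θ : ℝ) : Plane := !₂[-Real.sin θ, Real.cos θ]

/-- The radial field `D(t, r) = c f(‖r - r⁰(t)‖)`; it is meaningful only for `r ≠ r⁰(t)`, since the
profile `f` lives on `(0, ∞)`. -/
def field (c : ℝ) (f : ℝ → ℝ) (r₀ : ℝ → Plane) (t : ℝ) (r : Plane) : ℝ := c * f ‖r - r₀ t‖

/-- The linear function with saturation. -/
def chi (γ δ p : ℝ) : ℝ := if |p| ≤ δ then γ * p else Real.sign p * (γ * δ)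

/-- The argument `ḋ(t) + χ[d(t) - d₀]` of the sign in the control law, where `d(t) = D(t, r(t))` is the
measurement along the path `r`. -/
def switching (D : ℝ → Plane → ℝ) (d₀ γ δ : ℝ) (r : ℝ → Plane) (t : ℝ) : ℝ :=
  deriv (fun s => D s (r s)) t + chi γ δ (D t (r t) - d₀)

/-- A motion `(r, θ)` with angular velocity `u`, on the time axis `[0, ∞)`, of the robot
`ẋ = v cos θ`, `ẏ = v sin θ`, `θ̇ = u`, `|u| ≤ ubar` driven by `u = -sgn {ḋ + χ[d - d₀]} ubar`.
The right-hand side is discontinuous and solutions are meant in the sense of Filippov: at almost every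
time, `u` equals `-ubar` or `ubar` according to the sign of the switching function, and it may take any
value in `[-ubar, ubar]` where the switching function vanishes. The law is imposed only where the
measurement exists, i.e. while the robot is not at the field centre; that the robot avoids the centre
is not part of the definition. -/
structure IsClosedLoopMotion (v ubar d₀ γ δ : ℝ) (r₀ : ℝ → Plane) (D : ℝ → Plane → ℝ)
    (rin : Plane) (θin : ℝ) (r : ℝ → Plane) (θ u : ℝ → ℝ) : Prop where
  measurable_control : Measurable u
  abs_control_le : ∀ t, 0 ≤ t → |u t| ≤ ubar
  position_zero : r 0 = rin
  position_deriv : ∀ t, 0 ≤ t → HasDerivWithinAt r (v • heading (θ t)) (Ici 0) t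
  angle_eq : ∀ t, 0 ≤ t → θ t = θin + ∫ s in (0 : ℝ)..t, u s
  law : ∀ᵐ t ∂(volume.restrict (Ioi (0 : ℝ))), r t ≠ r₀ t → switching D d₀ γ δ r t ≠ 0 →
    u t = -(Real.sign (switching D d₀ γ δ r t)) * ubar

/-- The motion does not slide along the repelling part of the switching surface. Since
`ḋ = D'_t + v ⟨∇D, e(θ)⟩`, the turns commanded by the law near the surface drive the robot away from
the surface where `⟨∇D, leftNormal θ⟩ < 0` and back to it where this product is positive. (For a decaying radial
field, the product is positive when the field centre is to the left of the robot.) -/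
def NoUnstableSliding (d₀ γ δ : ℝ) (r₀ : ℝ → Plane) (D : ℝ → Plane → ℝ)
    (r : ℝ → Plane) (θ : ℝ → ℝ) : Prop :=
  ∀ᵐ t ∂(volume.restrict (Ioi (0 : ℝ))), r t ≠ r₀ t → switching D d₀ γ δ r t = 0 →
    0 ≤ inner ℝ (gradient (D t) (r t)) (leftNormal (θ t))

/-- The numerical data and the profile of the field: speed `v` of the robot, bound `ubar` on its
angular velocity, bounds `v₀` and `a₀` on the speed and acceleration of the field centre, bounds
`Rinm ≤ Rinp` on the initial distance to the centre, bounds `cm ≤ cp` on the intensity, the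
profile `f` and the desired field value `d₀`. -/
structure Data where
  v : ℝ
  ubar : ℝ
  v₀ : ℝ
  a₀ : ℝ
  Rinm : ℝ
  Rinp : ℝ
  cm : ℝ
  cp : ℝ
  f : ℝ → ℝ
  d₀ : ℝ

namespace Data

variable (P : Data)

/-- The inverse of the profile `f : (0, ∞) → ℝ`. -/
def finv (y : ℝ) : ℝ := Function.invFunOn P.f (Ioi 0) y

/-- The lower radius `R₋`. -/
def Rm : ℝ :=
  min (P.Rinm - (2 * P.v + 4 * Real.pi * P.v₀) / P.ubar)
    (min (P.finv (P.d₀ / P.cm)) (P.finv (P.d₀ / P.cp)))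

/-- The upper radius `R₊`. -/
def Rp : ℝ :=
  max (P.Rinp + (2 * P.v + 4 * Real.pi * P.v₀) / P.ubar)
    (max (P.finv (P.d₀ / P.cm)) (P.finv (P.d₀ / P.cp)))

/-- The minimum of `|f'|` over `[R₋, R₊]`. -/
def minSlope : ℝ := sInf ((fun R => |deriv P.f R|) '' Icc P.Rm P.Rp)

/-- The maximum of `|f''| / |f'|` over `[R₋, R₊]`. -/
def bn : ℝ := sSup ((fun R => |deriv (deriv P.f) R| / |deriv P.f R|) '' Icc P.Rm P.Rp)

/-- `μ_* = γ δ / (c₋ min |f'|)`. -/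
def muStar (γ δ : ℝ) : ℝ := γ * δ / (P.cm * P.minSlope)

/-- `σ(μ) = √((v - v₀)² - 2 v μ - μ²)`. -/
def sigma (μ : ℝ) : ℝ := Real.sqrt ((P.v - P.v₀) ^ 2 - 2 * P.v * μ - μ ^ 2)

/-- The maneuverability requirement with margin `Δu`, at the radius `R₋`. -/
def Maneuverable (Δu : ℝ) : Prop :=
  ∀ vn ∈ Icc 0 P.v₀,
    P.a₀ / Real.sqrt (P.v ^ 2 - vn ^ 2)
      + (Real.sqrt (P.v ^ 2 - vn ^ 2) + Real.sqrt (P.v₀ ^ 2 - vn ^ 2)) ^ 2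
          / (P.Rm * Real.sqrt (P.v ^ 2 - vn ^ 2))
      ≤ P.ubar - Δu

/-- The inequalities on the controller parameters. -/
def Tuned (Δu γ δ : ℝ) : Prop :=
  0 < P.muStar γ δ ∧
  P.muStar γ δ < Real.sqrt (P.v ^ 2 + (P.v - P.v₀) ^ 2) - P.v ∧
  ((P.v / P.Rm + γ + P.bn * P.muStar γ δ) / P.sigma (P.muStar γ δ)
      + P.v * (P.a₀ + P.v₀ ^ 2 / P.Rm) / P.sigma (P.muStar γ δ) ^ 3) * P.muStar γ δ < Δu

/-- The known bounds on the uncertain intensity `c`, centre `r⁰(·)` (twice continuously differentiable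
on `[0, ∞)`) and initial position. -/
structure Known (c : ℝ) (r₀ : ℝ → Plane) (rin : Plane) : Prop where
  contDiffOn : ContDiffOn ℝ 2 r₀ (Ici 0)
  dist_lower : P.Rinm ≤ ‖rin - r₀ 0‖
  dist_upper : ‖rin - r₀ 0‖ ≤ P.Rinp
  speed_le : ∀ t, 0 < t → ‖deriv r₀ t‖ ≤ P.v₀
  accel_le : ∀ t, 0 < t → ‖deriv (deriv r₀) t‖ ≤ P.a₀
  intensity_lower : P.cm ≤ c
  intensity_upper : c ≤ P.cp

/-- The controller with parameters `γ, δ` brings the robot to the desired isoline whenever the known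
bounds hold, whatever the initial orientation: the closed loop has a motion, and along each of its
motions the robot never meets the field centre (so that `d(t)` is always defined) and
`d(t) → d₀` as `t → ∞`. -/
def Achieves (γ δ : ℝ) : Prop :=
  ∀ (c : ℝ) (r₀ : ℝ → Plane) (rin : Plane) (θin : ℝ), P.Known c r₀ rin →
    (∃ (r : ℝ → Plane) (θ u : ℝ → ℝ),
      IsClosedLoopMotion P.v P.ubar P.d₀ γ δ r₀ (field c P.f r₀) rin θin r θ u ∧
      NoUnstableSliding P.d₀ γ δ r₀ (field c P.f r₀) r θ) ∧
    ∀ (r : ℝ → Plane) (θ u : ℝ → ℝ),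
      IsClosedLoopMotion P.v P.ubar P.d₀ γ δ r₀ (field c P.f r₀) rin θin r θ u →
      NoUnstableSliding P.d₀ γ δ r₀ (field c P.f r₀) r θ →
      (∀ t, 0 ≤ t → r t ≠ r₀ t) ∧
      Tendsto (fun t => field c P.f r₀ t (r t)) atTop (𝓝 P.d₀)

end Data

end RadialTracking

end

noncomputable section

namespace RadialTracking

/-! ### Plane geometry -/

/-! Let `ρ` be the distance from the robot to the centre, `G = ρ'` and `x` the component of the
robot's velocity orthogonal to the line of sight (`tangVel`). Then `G' = drift - u x`, so the
control enters `d̈ = c (f'' G² + f' (drift - u x))` with coefficient `c |f'| x`. On the surface `S =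
ḋ + χ[d - d₀] = 0` one has `|G| ≤ μ_*`. The maneuverability condition, perturbed by `μ_*`, gives
`|drift| + γ |G| + |f''|/|f'| G² < ubar |x|` there (`turn_estimate`). Hence near the surface an
extremal control fixes the sign of the change of `S` (`Env.Bounds.exists_strict_mono`): the law
drives `S` towards zero where `x > 0` and away from zero where `x < 0`.

Off the surface the robot runs on a circle. During two full turns the relative position changes by
at most `(2v + 4π v₀)/ubar`, which is less than the initial distance, so the line of sight stays in
an open half-plane. The robot must therefore at some moment head along it in the sense opposite to
the command. There `|G| ≥ v - v₀ > μ_*` outweighs `χ`, and `S` has the wrong sign for that command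
(`Env.Bounds.exists_surf_pos`). So the surface is met within two turns, and it can be met only where
`x > 0` (`Env.Bounds.reach_surface`). From then on the motion slides
(`Env.Bounds.stays_on_surface`), because `x` cannot vanish on the surface. The deviation `z = d -
d₀` obeys `z' = -χ(z)`: it moves monotonically to zero, which keeps `ρ` in `[R₋, R₊]` and gives
convergence (`tendsto_zero_of_decay`). A start on the repelling part is left at once, since sliding
there is excluded.

For existence, a circular arc is followed by a sliding path built by hand. The scalar equation gives
`z`, the inverse profile gives `ρ`, a Lipschitz scalar equation gives the bearing, and the heading
is recovered by an arccosine (`Env.Bounds.exists_sliding_path`). The strict inequality above makes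
its turning rate admissible (`Env.Bounds.abs_turn_lt`). -/

/-- The oriented area `x₁ y₂ - x₂ y₁` of two plane vectors. -/
def cross (x y : Plane) : ℝ := x 0 * y 1 - x 1 * y 0

lemma inner_eq (x y : Plane) : inner ℝ x y = x 0 * y 0 + x 1 * y 1 := by
  simp [PiLp.inner_apply, Fin.sum_univ_two, mul_comm]

lemma norm_sq_eq (x : Plane) : ‖x‖ ^ 2 = x 0 ^ 2 + x 1 ^ 2 := by
  rw [← real_inner_self_eq_norm_sq, inner_eq]; ring

lemma inner_sq_add_cross_sq (x y : Plane) :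
    inner ℝ x y ^ 2 + cross x y ^ 2 = ‖x‖ ^ 2 * ‖y‖ ^ 2 := by
  rw [inner_eq, norm_sq_eq, norm_sq_eq, cross]; ring

@[simp] lemma heading_zero (θ : ℝ) : heading θ 0 = Real.cos θ := by simp [heading]
@[simp] lemma heading_one (θ : ℝ) : heading θ 1 = Real.sin θ := by simp [heading]
@[simp] lemma leftNormal_zero (θ : ℝ) : leftNormal θ 0 = -Real.sin θ := by simp [leftNormal]
@[simp] lemma leftNormal_one (θ : ℝ) : leftNormal θ 1 = Real.cos θ := by simp [leftNormal]

lemma norm_heading (θ : ℝ) : ‖heading θ‖ = 1 := by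
  have h : ‖heading θ‖ ^ 2 = 1 := by rw [norm_sq_eq]; simp
  nlinarith [norm_nonneg (heading θ)]

lemma inner_leftNormal (x : Plane) (θ : ℝ) : inner ℝ x (leftNormal θ) = -cross x (heading θ) := by
  rw [inner_eq, cross]; simp; ring

lemma cross_leftNormal (x : Plane) (θ : ℝ) : cross x (leftNormal θ) = inner ℝ x (heading θ) := by
  rw [inner_eq, cross]; simp

lemma norm_leftNormal (θ : ℝ) : ‖leftNormal θ‖ = 1 := by
  have h : ‖leftNormal θ‖ ^ 2 = 1 := by rw [norm_sq_eq]; simp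
  nlinarith [norm_nonneg (leftNormal θ)]

lemma heading_eq (θ : ℝ) : heading θ = Real.cos θ • heading 0 + Real.sin θ • leftNormal 0 := by
  ext i; fin_cases i <;> simp [heading, leftNormal]

lemma leftNormal_eq (θ : ℝ) :
    leftNormal θ = Real.cos θ • leftNormal 0 - Real.sin θ • heading 0 := by
  ext i; fin_cases i <;> simp [heading, leftNormal]

lemma hasDerivAt_heading (θ : ℝ) : HasDerivAt heading (leftNormal θ) θ := by
  have h := ((Real.hasDerivAt_cos θ).smul_const (heading 0)).add
    ((Real.hasDerivAt_sin θ).smul_const (leftNormal 0))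
  refine (h.congr_of_eventuallyEq (.of_forall heading_eq)).congr_deriv ?_
  rw [leftNormal_eq θ]; module

lemma hasDerivAt_leftNormal (θ : ℝ) : HasDerivAt leftNormal (-heading θ) θ := by
  have h := ((Real.hasDerivAt_cos θ).smul_const (leftNormal 0)).sub
    ((Real.hasDerivAt_sin θ).smul_const (heading 0))
  refine (h.congr_of_eventuallyEq (.of_forall leftNormal_eq)).congr_deriv ?_
  rw [heading_eq θ]; module

lemma continuous_heading : Continuous heading :=
  continuous_iff_continuousAt.2 fun θ => (hasDerivAt_heading θ).continuousAt

lemma continuous_cross : Continuous fun p : Plane × Plane => cross p.1 p.2 := by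
  unfold cross; fun_prop

lemma _root_.ContinuousOn.cross {g h : ℝ → Plane} {s : Set ℝ} (hg : ContinuousOn g s)
    (hh : ContinuousOn h s) : ContinuousOn (fun t => RadialTracking.cross (g t) (h t)) s :=
  continuous_cross.comp_continuousOn (hg.prodMk hh)

/-! ### The saturated linear function -/

/-- The clamp form makes continuity, the bound `γ δ` and the Lipschitz constant `γ` immediate. -/
lemma chi_eq_clamp {γ δ : ℝ} (hδ : 0 ≤ δ) (p : ℝ) :
    chi γ δ p = γ * max (-δ) (min p δ) := by
  unfold chi
  split_ifs with h
  · rw [abs_le] at h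
    rw [min_eq_left h.2, max_eq_right h.1]
  · rw [not_le, lt_abs] at h
    rcases h with h | h
    · rw [Real.sign_of_pos (by linarith), min_eq_right h.le, max_eq_right (by linarith)]; ring
    · rw [Real.sign_of_neg (by linarith), min_eq_left (by linarith), max_eq_left (by linarith)]; ring

/-- Clamping is nonexpansive. This bound takes the place of the derivative of `χ`, which does not
exist at the kinks. -/
lemma abs_chi_sub_le {γ δ : ℝ} (hγ : 0 ≤ γ) (hδ : 0 ≤ δ) (p q : ℝ) :
    |chi γ δ p - chi γ δ q| ≤ γ * |p - q| := by
  rw [chi_eq_clamp hδ, chi_eq_clamp hδ, ← mul_sub, abs_mul, abs_of_nonneg hγ]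
  refine mul_le_mul_of_nonneg_left ?_ hγ
  exact (abs_max_sub_max_le_max _ _ _ _).trans
    (max_le (by simp) ((abs_min_sub_min_le_max _ _ _ _).trans (max_le le_rfl (by simp))))

lemma continuous_chi {γ δ : ℝ} (hδ : 0 ≤ δ) : Continuous (chi γ δ) := by
  have : chi γ δ = fun p => γ * max (-δ) (min p δ) := funext (chi_eq_clamp hδ)
  rw [this]; fun_prop

lemma abs_chi_le {γ δ : ℝ} (hγ : 0 ≤ γ) (hδ : 0 ≤ δ) (p : ℝ) : |chi γ δ p| ≤ γ * δ := by
  rw [chi_eq_clamp hδ, abs_mul, abs_of_nonneg hγ]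
  refine mul_le_mul_of_nonneg_left (abs_le.2 ⟨le_max_left _ _, max_le (by linarith)
    (min_le_right _ _)⟩) hγ

/-- `p χ(p)` dominates `p²` on bounded sets. -/
lemma mul_chi_ge {γ δ Z p : ℝ} (hγ : 0 ≤ γ) (hδ : 0 < δ) (hδZ : δ ≤ Z) (hp : |p| ≤ Z) :
    γ * δ / Z * p ^ 2 ≤ p * chi γ δ p := by
  have hZ : 0 < Z := hδ.trans_le hδZ
  have h0 : γ * δ / Z * p ^ 2 = (γ * p ^ 2) * (δ / Z) := by ring
  have h1 : δ / Z ≤ 1 := (div_le_one hZ).2 hδZ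
  unfold chi
  split_ifs with h
  · rw [h0]
    calc (γ * p ^ 2) * (δ / Z) ≤ (γ * p ^ 2) * 1 := mul_le_mul_of_nonneg_left h1 (by positivity)
      _ = p * (γ * p) := by ring
  · have h2 : p * (Real.sign p * (γ * δ)) = γ * δ * |p| := by
      rcases lt_trichotomy p 0 with hp | hp | hp
      · rw [Real.sign_of_neg hp, abs_of_neg hp]; ring
      · simp [hp]
      · rw [Real.sign_of_pos hp, abs_of_pos hp]; ring
    rw [h2, div_mul_eq_mul_div, div_le_iff₀ hZ, ← sq_abs p]
    nlinarith [mul_le_mul_of_nonneg_left hp (by positivity : 0 ≤ γ * δ * |p|)]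

lemma mul_chi_nonneg {γ δ : ℝ} (hγ : 0 ≤ γ) (hδ : 0 < δ) (p : ℝ) : 0 ≤ p * chi γ δ p :=
  le_trans (by positivity) (mul_chi_ge hγ hδ (le_max_left δ |p|) (le_max_right δ |p|))

lemma differentiableAt_chi {γ δ p : ℝ} (hδ : 0 < δ) (hp : |p| ≠ δ) :
    DifferentiableAt ℝ (chi γ δ) p := by
  rcases lt_or_gt_of_ne hp with h | h
  · have : chi γ δ =ᶠ[𝓝 p] fun x => γ * x := by
      filter_upwards [(continuous_abs.tendsto p).eventually (gt_mem_nhds h)] with x hx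
      simp [chi, le_of_lt hx]
    exact this.differentiableAt_iff.2 (by fun_prop)
  · have hx : ∀ᶠ x in 𝓝 p, δ < |x| := (continuous_abs.tendsto p).eventually (lt_mem_nhds h)
    have hp0 : p ≠ 0 := abs_pos.1 (hδ.trans h)
    rcases lt_or_gt_of_ne hp0 with h0 | h0
    · have : chi γ δ =ᶠ[𝓝 p] fun x => -1 * (γ * δ) := by
        filter_upwards [hx, gt_mem_nhds h0] with x hx hx0
        simp [chi, not_le.2 hx, Real.sign_of_neg hx0]
      exact this.differentiableAt_iff.2 (by fun_prop)
    · have : chi γ δ =ᶠ[𝓝 p] fun x => 1 * (γ * δ) := by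
        filter_upwards [hx, lt_mem_nhds h0] with x hx hx0
        simp [chi, not_le.2 hx, Real.sign_of_pos hx0]
      exact this.differentiableAt_iff.2 (by fun_prop)

/-! ### Kinematics of a path relative to the field centre -/

/-- Speed of the robot, intensity, set-point, controller parameters, profile and centre of the field. -/
structure Env where
  v : ℝ
  c : ℝ
  d₀ : ℝ
  γ : ℝ
  δ : ℝ
  f : ℝ → ℝ
  r₀ : ℝ → Plane

namespace Env

variable (E : Env) (r : ℝ → Plane) (θ : ℝ → ℝ)

/-- Velocity of the centre. -/
def centreVel : ℝ → Plane := derivWithin E.r₀ (Ici 0)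

/-- Acceleration of the centre. -/
def centreAcc : ℝ → Plane := derivWithin E.centreVel (Ici 0)

/-- Position of the robot relative to the centre. -/
def sep (t : ℝ) : Plane := r t - E.r₀ t

/-- Velocity of the robot relative to the centre. -/
def relVel (t : ℝ) : Plane := E.v • heading (θ t) - E.centreVel t

/-- Rate of change of the distance to the centre. -/
def rangeRate (t : ℝ) : ℝ := inner ℝ (E.sep r t) (E.relVel θ t) / ‖E.sep r t‖

/-- Component of the robot's velocity orthogonal to the direction to the centre. -/
def tangVel (t : ℝ) : ℝ := E.v * cross (E.sep r t) (heading (θ t)) / ‖E.sep r t‖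

/-- The part of the second derivative of the distance that does not depend on the control. -/
def drift (t : ℝ) : ℝ :=
  cross (E.sep r t) (E.relVel θ t) ^ 2 / ‖E.sep r t‖ ^ 3
    - inner ℝ (E.sep r t) (E.centreAcc t) / ‖E.sep r t‖

/-- The measurement. -/
def meas (t : ℝ) : ℝ := E.c * E.f ‖E.sep r t‖

/-- The derivative of the measurement. -/
def measRate (t : ℝ) : ℝ := E.c * deriv E.f ‖E.sep r t‖ * E.rangeRate r θ t

/-- The second derivative of the measurement under the angular velocity `u`. -/
def measAcc (u t : ℝ) : ℝ :=
  E.c * (deriv (deriv E.f) ‖E.sep r t‖ * E.rangeRate r θ t ^ 2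
    + deriv E.f ‖E.sep r t‖ * (E.drift r θ t - u * E.tangVel r θ t))

/-- The switching function, with one-sided derivative at `t = 0`. -/
def surf (t : ℝ) : ℝ := E.measRate r θ t + chi E.γ E.δ (E.meas r t - E.d₀)

/-- Standing assumptions on the environment. -/
structure Regular : Prop where
  v_pos : 0 < E.v
  c_pos : 0 < E.c
  γ_pos : 0 < E.γ
  δ_pos : 0 < E.δ
  f_contDiffOn : ContDiffOn ℝ 2 E.f (Ioi 0)
  f_deriv_neg : ∀ z, 0 < z → deriv E.f z < 0
  r₀_contDiffOn : ContDiffOn ℝ 2 E.r₀ (Ici 0)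

/-- A path of a robot with speed `v` and orientation `θ`. -/
structure IsPath : Prop where
  position_deriv : ∀ t, 0 ≤ t → HasDerivWithinAt r (E.v • heading (θ t)) (Ici 0) t
  angle_continuousOn : ContinuousOn θ (Ici 0)

variable {E r θ}

namespace Regular

variable (h : E.Regular)
include h

lemma hasDerivAt_f {x : ℝ} (hx : 0 < x) : HasDerivAt E.f (deriv E.f x) x :=
  ((h.f_contDiffOn.differentiableOn (by norm_num)).differentiableAt (Ioi_mem_nhds hx)).hasDerivAt

lemma contDiffOn_deriv_f : ContDiffOn ℝ 1 (deriv E.f) (Ioi 0) :=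
  h.f_contDiffOn.deriv_of_isOpen isOpen_Ioi (by norm_num)

lemma hasDerivAt_deriv_f {x : ℝ} (hx : 0 < x) :
    HasDerivAt (deriv E.f) (deriv (deriv E.f) x) x :=
  ((h.contDiffOn_deriv_f.differentiableOn (by norm_num)).differentiableAt
    (Ioi_mem_nhds hx)).hasDerivAt

lemma continuousAt_deriv_deriv_f {x : ℝ} (hx : 0 < x) : ContinuousAt (deriv (deriv E.f)) x :=
  (h.contDiffOn_deriv_f.continuousOn_deriv_of_isOpen isOpen_Ioi le_rfl).continuousAt
    (Ioi_mem_nhds hx)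

lemma hasDerivWithinAt_centre {t : ℝ} (ht : 0 ≤ t) :
    HasDerivWithinAt E.r₀ (E.centreVel t) (Ici 0) t :=
  ((h.r₀_contDiffOn.differentiableOn (by norm_num)) t ht).hasDerivWithinAt

lemma contDiffOn_centreVel : ContDiffOn ℝ 1 E.centreVel (Ici 0) :=
  h.r₀_contDiffOn.derivWithin (uniqueDiffOn_Ici 0) (by norm_num)

lemma hasDerivWithinAt_centreVel {t : ℝ} (ht : 0 ≤ t) :
    HasDerivWithinAt E.centreVel (E.centreAcc t) (Ici 0) t :=
  ((h.contDiffOn_centreVel.differentiableOn (by norm_num)) t ht).hasDerivWithinAt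

lemma continuousOn_centreAcc : ContinuousOn E.centreAcc (Ici 0) :=
  h.contDiffOn_centreVel.continuousOn_derivWithin (uniqueDiffOn_Ici 0) le_rfl

end Regular

/-- Differentiability properties of a path. -/
structure RegPath (E : Env) (r : ℝ → Plane) (θ : ℝ → ℝ) : Prop extends E.Regular, E.IsPath r θ

namespace RegPath

variable (h : E.RegPath r θ) {t : ℝ}
include h

lemma hasDerivWithinAt_sep (ht : 0 ≤ t) :
    HasDerivWithinAt (E.sep r) (E.relVel θ t) (Ici 0) t :=
  (h.position_deriv t ht).sub (h.hasDerivWithinAt_centre ht)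

lemma continuousOn_sep : ContinuousOn (E.sep r) (Ici 0) :=
  fun _ ht => (h.hasDerivWithinAt_sep ht).continuousWithinAt

lemma continuousOn_relVel : ContinuousOn (E.relVel θ) (Ici 0) :=
  ((continuous_heading.comp_continuousOn h.angle_continuousOn).const_smul E.v).sub
    h.contDiffOn_centreVel.continuousOn

lemma hasDerivWithinAt_norm_sep (ht : 0 ≤ t) (h0 : E.sep r t ≠ 0) :
    HasDerivWithinAt (fun s => ‖E.sep r s‖) (E.rangeRate r θ t) (Ici 0) t := by
  have h1 := (h.hasDerivWithinAt_sep ht).norm_sq.sqrt (by positivity)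
  simp only [Real.sqrt_sq (norm_nonneg _)] at h1
  refine h1.congr_deriv ?_
  rw [rangeRate]; field_simp

lemma hasDerivWithinAt_meas (ht : 0 ≤ t) (h0 : E.sep r t ≠ 0) :
    HasDerivWithinAt (E.meas r) (E.measRate r θ t) (Ici 0) t := by
  have h1 := ((h.hasDerivAt_f (norm_pos_iff.2 h0)).comp_hasDerivWithinAt t
    (h.hasDerivWithinAt_norm_sep ht h0)).const_mul E.c
  exact h1.congr_deriv (by rw [measRate]; ring)

lemma hasDerivWithinAt_relVel {I : Set ℝ} (hI : I ⊆ Ici 0) {u : ℝ} (ht : 0 ≤ t)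
    (hθ : HasDerivWithinAt θ u I t) :
    HasDerivWithinAt (E.relVel θ) ((E.v * u) • leftNormal (θ t) - E.centreAcc t) I t := by
  have h1 := (((hasDerivAt_heading (θ t)).scomp_hasDerivWithinAt t hθ).const_smul E.v).sub
    ((h.hasDerivWithinAt_centreVel ht).mono hI)
  rw [smul_smul] at h1
  exact h1

/-- The quotient rule yields `(‖V‖² - G²)/ρ` for the relative velocity `V`, which is the centrifugal
term of `drift`. The set `I` allows one-sided derivatives at the ends of an interval of constant
turning. -/
lemma hasDerivWithinAt_rangeRate {I : Set ℝ} (hI : I ⊆ Ici 0) {u : ℝ} (ht : 0 ≤ t)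
    (h0 : E.sep r t ≠ 0) (hθ : HasDerivWithinAt θ u I t) :
    HasDerivWithinAt (E.rangeRate r θ) (E.drift r θ t - u * E.tangVel r θ t) I t := by
  have hn : ‖E.sep r t‖ ≠ 0 := norm_ne_zero_iff.2 h0
  have h1 := (((h.hasDerivWithinAt_sep ht).mono hI).inner ℝ
    (h.hasDerivWithinAt_relVel hI ht hθ)).div ((h.hasDerivWithinAt_norm_sep ht h0).mono hI) hn
  refine h1.congr_deriv ?_
  rw [inner_sub_right, inner_smul_right, inner_leftNormal, real_inner_self_eq_norm_sq]
  -- Lagrange's identity turns `‖V‖² - G²` into the square of the transversal component.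
  have h2 := inner_sq_add_cross_sq (E.sep r t) (E.relVel θ t)
  rw [rangeRate, drift, tangVel]
  field_simp
  linear_combination -h2

lemma hasDerivWithinAt_measRate {I : Set ℝ} (hI : I ⊆ Ici 0) {u : ℝ} (ht : 0 ≤ t)
    (h0 : E.sep r t ≠ 0) (hθ : HasDerivWithinAt θ u I t) :
    HasDerivWithinAt (E.measRate r θ) (E.measAcc r θ u t) I t := by
  have h1 := (((h.hasDerivAt_deriv_f (norm_pos_iff.2 h0)).comp_hasDerivWithinAt t
    ((h.hasDerivWithinAt_norm_sep ht h0).mono hI)).const_mul E.c).mul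
      (h.hasDerivWithinAt_rangeRate hI ht h0 hθ)
  refine h1.congr_deriv ?_
  rw [measAcc]; simp only [Function.comp_apply]; ring

lemma continuousWithinAt_rangeRate (ht : 0 ≤ t) (h0 : E.sep r t ≠ 0) :
    ContinuousWithinAt (E.rangeRate r θ) (Ici 0) t :=
  ((h.continuousOn_sep.inner (𝕜 := ℝ) h.continuousOn_relVel) t ht).div
    (h.continuousOn_sep.norm t ht) (norm_ne_zero_iff.2 h0)

lemma continuousWithinAt_tangVel (ht : 0 ≤ t) (h0 : E.sep r t ≠ 0) :
    ContinuousWithinAt (E.tangVel r θ) (Ici 0) t :=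
  ((continuousOn_const.mul (h.continuousOn_sep.cross
    (continuous_heading.comp_continuousOn h.angle_continuousOn))) t ht).div
    (h.continuousOn_sep.norm t ht) (norm_ne_zero_iff.2 h0)

lemma continuousWithinAt_drift (ht : 0 ≤ t) (h0 : E.sep r t ≠ 0) :
    ContinuousWithinAt (E.drift r θ) (Ici 0) t := by
  have hn : ‖E.sep r t‖ ≠ 0 := norm_ne_zero_iff.2 h0
  refine (((h.continuousOn_sep.cross h.continuousOn_relVel).pow 2 t ht).div
    ((h.continuousOn_sep.norm.pow 3) t ht) (pow_ne_zero 3 hn)).sub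
    (((h.continuousOn_sep.inner (𝕜 := ℝ) h.continuousOn_centreAcc) t ht).div
    (h.continuousOn_sep.norm t ht) hn)

lemma continuousWithinAt_comp_norm {g : ℝ → ℝ} (ht : 0 ≤ t) (hg : ContinuousAt g ‖E.sep r t‖) :
    ContinuousWithinAt (fun s => g ‖E.sep r s‖) (Ici 0) t :=
  ContinuousAt.comp_continuousWithinAt (f := fun s => ‖E.sep r s‖) hg (h.continuousOn_sep.norm t ht)

lemma continuousWithinAt_meas (ht : 0 ≤ t) (h0 : E.sep r t ≠ 0) :
    ContinuousWithinAt (E.meas r) (Ici 0) t :=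
  (h.hasDerivWithinAt_meas ht h0).continuousWithinAt

lemma continuousWithinAt_measRate (ht : 0 ≤ t) (h0 : E.sep r t ≠ 0) :
    ContinuousWithinAt (E.measRate r θ) (Ici 0) t :=
  ((h.continuousWithinAt_comp_norm ht
    (h.hasDerivAt_deriv_f (norm_pos_iff.2 h0)).continuousAt).const_mul E.c).mul (h.continuousWithinAt_rangeRate ht h0)

lemma continuousWithinAt_measAcc (u : ℝ) (ht : 0 ≤ t) (h0 : E.sep r t ≠ 0) :
    ContinuousWithinAt (E.measAcc r θ u) (Ici 0) t := by
  have hn := norm_pos_iff.2 h0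
  exact (((h.continuousWithinAt_comp_norm ht (h.continuousAt_deriv_deriv_f hn)).mul
    ((h.continuousWithinAt_rangeRate ht h0).pow 2)).add
    ((h.continuousWithinAt_comp_norm ht (h.hasDerivAt_deriv_f hn).continuousAt).mul ((h.continuousWithinAt_drift ht h0).sub
      ((h.continuousWithinAt_tangVel ht h0).const_mul u)))).const_mul E.c

lemma continuousWithinAt_surf (ht : 0 ≤ t) (h0 : E.sep r t ≠ 0) :
    ContinuousWithinAt (E.surf r θ) (Ici 0) t :=
  (h.continuousWithinAt_measRate ht h0).add
    ((continuous_chi h.δ_pos.le).continuousAt.comp_continuousWithinAt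
      ((h.continuousWithinAt_meas ht h0).sub continuousWithinAt_const))

lemma eventually_sep_ne_zero (ht : 0 ≤ t) (h0 : E.sep r t ≠ 0) :
    ∀ᶠ s in 𝓝[Ici 0] t, E.sep r s ≠ 0 :=
  (h.continuousOn_sep t ht).eventually_ne h0

/-- At positive times the switching function of the control law is `surf`. -/
lemma switching_eq (ht : 0 < t) (h0 : E.sep r t ≠ 0) :
    switching (field E.c E.f E.r₀) E.d₀ E.γ E.δ r t = E.surf r θ t := by
  have h1 : HasDerivAt (fun s => field E.c E.f E.r₀ s (r s)) (E.measRate r θ t) t :=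
    (h.hasDerivWithinAt_meas ht.le h0).hasDerivAt (Ici_mem_nhds ht)
  rw [switching, h1.deriv]; rfl

/-- The sign of `tangVel` distinguishes the attractive and repelling parts of the surface. -/
lemma inner_gradient (h0 : E.sep r t ≠ 0) :
    inner ℝ (gradient (field E.c E.f E.r₀ t) (r t)) (leftNormal (θ t))
      = -(E.c * deriv E.f ‖E.sep r t‖ / E.v) * E.tangVel r θ t := by
  have hn := norm_pos_iff.2 h0
  have h1 : HasGradientAt (fun x : Plane => ‖x - E.r₀ t‖) ((1 / ‖E.sep r t‖) • E.sep r t) (r t) := by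
    have h2 : HasFDerivAt (fun x : Plane => ‖x - E.r₀ t‖ ^ 2)
        (2 • (innerSL ℝ (r t - E.r₀ t)).comp (ContinuousLinearMap.id ℝ Plane)) (r t) :=
      ((hasFDerivAt_id (r t)).sub_const (E.r₀ t)).norm_sq
    have h3 := h2.sqrt (by have : r t - E.r₀ t ≠ 0 := h0; positivity)
    simp only [Real.sqrt_sq (norm_nonneg _)] at h3
    rw [hasGradientAt_iff_hasFDerivAt]
    refine h3.congr_fderiv ?_
    ext x
    simp [sep]
    field_simp
  have h4 : HasGradientAt (field E.c E.f E.r₀ t)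
      ((E.c * deriv E.f ‖E.sep r t‖ * (1 / ‖E.sep r t‖)) • E.sep r t) (r t) := by
    rw [hasGradientAt_iff_hasFDerivAt] at h1 ⊢
    have h5 := ((h.hasDerivAt_f hn).const_mul E.c).comp_hasFDerivAt (r t) h1
    refine h5.congr_fderiv ?_
    ext x
    simp
    ring
  rw [h4.gradient, inner_smul_left, inner_leftNormal, tangVel]
  have := h.v_pos.ne'
  simp
  field_simp

end RegPath

end Env

/-! ### Real-variable tools -/

/-- Look at the infimum of the failure times: `hclosed` gives the property there, and `hopen`
carries it past that point. -/
lemma forall_Icc_of_continuation {p : ℝ → Prop} {a b : ℝ} (h0 : p a)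
    (hclosed : ∀ t, a < t → t ≤ b → (∀ s ∈ Ico a t, p s) → p t)
    (hopen : ∀ t, a ≤ t → t < b → (∀ s ∈ Icc a t, p s) → ∃ ε > 0, ∀ s ∈ Ioo t (t + ε), p s) :
    ∀ t ∈ Icc a b, p t := by
  by_contra! hcon
  obtain ⟨t₀, ht₀, hpt₀⟩ := hcon
  let B : Set ℝ := {t | a ≤ t ∧ ¬ p t}
  have hB0 : t₀ ∈ B := ⟨ht₀.1, hpt₀⟩
  have hBb : BddBelow B := ⟨a, fun t ht => ht.1⟩
  have ha : a ≤ sInf B := le_csInf ⟨_, hB0⟩ fun t ht => ht.1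
  have hle : sInf B ≤ t₀ := csInf_le hBb hB0
  have hlt : ∀ s ∈ Ico a (sInf B), p s := fun s hs => by
    by_contra hps
    exact not_le.2 hs.2 (csInf_le hBb ⟨hs.1, hps⟩)
  have hp : p (sInf B) := by
    rcases ha.eq_or_lt with h | h
    · rwa [← h]
    · exact hclosed _ h (hle.trans ht₀.2) hlt
  have hne : sInf B ≠ t₀ := fun h => hpt₀ (h ▸ hp)
  obtain ⟨ε, hε, hgo⟩ := hopen (sInf B) ha ((lt_of_le_of_ne hle hne).trans_le ht₀.2) fun s hs => by
    rcases hs.2.eq_or_lt with h | h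
    · rwa [h]
    · exact hlt s ⟨hs.1, h⟩
  obtain ⟨t, ht, htε⟩ := exists_lt_of_csInf_lt ⟨_, hB0⟩ (lt_add_of_pos_right (sInf B) hε)
  rcases (csInf_le hBb ht).eq_or_lt with h | h
  · exact ht.2 (h ▸ hp)
  · exact ht.2 (hgo t ⟨h, htε⟩)

lemma mem_of_continuousWithinAt_right_end {X : Type*} [TopologicalSpace X] {g : ℝ → X} {K : Set X}
    {a b : ℝ} (hK : IsClosed K) (ha : 0 ≤ a) (hab : a < b) (hg : ContinuousWithinAt g (Ici 0) b)
    (hmem : ∀ t ∈ Ioo a b, g t ∈ K) : g b ∈ K := by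
  have h1 : Tendsto g (𝓝[Ioo a b] b) (𝓝 (g b)) :=
    hg.mono fun t ht => ha.trans ht.1.le
  have : (𝓝[Ioo a b] b).NeBot := by
    rw [nhdsWithin_Ioo_eq_nhdsLT hab]; infer_instance
  exact hK.mem_of_tendsto h1 (eventually_nhdsWithin_of_forall hmem)

/-- The left endpoint is left out because `g` may vanish there, as when `a` is the last zero before
`b`. -/
lemma neg_of_ne_zero_of_neg_right {g : ℝ → ℝ} {a b : ℝ} (hg : ContinuousOn g (Icc a b))
    (h0 : ∀ t ∈ Ioc a b, g t ≠ 0) (hb : g b < 0) : ∀ t ∈ Ioc a b, g t < 0 := by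
  intro t ht
  by_contra! hcon
  obtain ⟨x, hx, hgx⟩ := intermediate_value_Icc' ht.2 (hg.mono (Icc_subset_Icc_left ht.1.le))
    ⟨hb.le, hcon⟩
  exact h0 x ⟨ht.1.trans_le hx.1, hx.2⟩ hgx

/-! ### The scalar equation `z' = -χ(z)` -/

section Decay

variable {γ δ : ℝ} {z : ℝ → ℝ} {a b : ℝ}

/-- The derivative of `z²` is `-2 z χ(z) ≤ 0`. -/
lemma antitoneOn_sq_of_decay (hγ : 0 < γ) (hδ : 0 < δ)
    (hz : ∀ t ∈ Icc a b, HasDerivWithinAt z (-chi γ δ (z t)) (Icc a b) t) :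
    AntitoneOn (fun t => z t ^ 2) (Icc a b) := by
  refine antitoneOn_of_hasDerivWithinAt_nonpos (convex_Icc a b)
    (f' := fun t => -(2 * (z t * chi γ δ (z t))))
    (fun t ht => ((hz t ht).continuousWithinAt).pow 2) (fun t ht => ?_) (fun t ht => ?_)
  · have := ((hz t (interior_subset ht)).mono interior_subset).pow 2
    exact this.congr_deriv (by simp; ring)
  · have := mul_chi_nonneg hγ.le hδ (z t)
    linarith

lemma abs_le_of_decay (hγ : 0 < γ) (hδ : 0 < δ)
    (hz : ∀ t ∈ Icc a b, HasDerivWithinAt z (-chi γ δ (z t)) (Icc a b) t) (hab : a ≤ b) :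
    |z b| ≤ |z a| :=
  sq_le_sq.1 (antitoneOn_sq_of_decay hγ hδ hz (left_mem_Icc.2 hab) (right_mem_Icc.2 hab) hab)

/-- A change of sign would pass through a zero of `z`, after which the antitone `z²` must remain
zero. -/
lemma nonneg_of_decay (hγ : 0 < γ) (hδ : 0 < δ)
    (hz : ∀ t ∈ Icc a b, HasDerivWithinAt z (-chi γ δ (z t)) (Icc a b) t) (hab : a ≤ b)
    (ha : 0 ≤ z a) : 0 ≤ z b := by
  by_contra! hb
  obtain ⟨x, hx, hzx⟩ := intermediate_value_Icc' hab (fun t ht => (hz t ht).continuousWithinAt)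
    ⟨hb.le, ha⟩
  have := antitoneOn_sq_of_decay hγ hδ hz hx (right_mem_Icc.2 hab) hx.2
  simp only [hzx] at this
  nlinarith

lemma nonpos_of_decay (hγ : 0 < γ) (hδ : 0 < δ)
    (hz : ∀ t ∈ Icc a b, HasDerivWithinAt z (-chi γ δ (z t)) (Icc a b) t) (hab : a ≤ b)
    (ha : z a ≤ 0) : z b ≤ 0 := by
  by_contra! hb
  obtain ⟨x, hx, hzx⟩ := intermediate_value_Icc hab (fun t ht => (hz t ht).continuousWithinAt)
    ⟨ha, hb.le⟩
  have := antitoneOn_sq_of_decay hγ hδ hz hx (right_mem_Icc.2 hab) hx.2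
  simp only [hzx] at this
  nlinarith

/-- The solution stays between its initial value and zero. -/
lemma mem_uIcc_of_decay (hγ : 0 < γ) (hδ : 0 < δ)
    (hz : ∀ t ∈ Icc a b, HasDerivWithinAt z (-chi γ δ (z t)) (Icc a b) t) (hab : a ≤ b) :
    z b ∈ uIcc 0 (z a) := by
  have h1 := abs_le_of_decay hγ hδ hz hab
  rw [mem_uIcc]
  rcases le_total 0 (z a) with h | h
  · left
    rw [abs_of_nonneg h] at h1
    exact ⟨nonneg_of_decay hγ hδ hz hab h, (le_abs_self _).trans h1⟩
  · right
    rw [abs_of_nonpos h] at h1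
    exact ⟨by linarith [neg_abs_le (z b)], nonpos_of_decay hγ hδ hz hab h⟩

/-- Since `|z|` never exceeds `Z = max δ |z a|`, one has `z χ(z) ≥ k z²` with `k = γ δ / Z`. Hence
`z² exp(2k(t - a))` is antitone and the decay is exponential, although saturation makes the rate
depend on the initial value. -/
lemma tendsto_zero_of_decay (hγ : 0 < γ) (hδ : 0 < δ)
    (hz : ∀ t ∈ Ici a, HasDerivWithinAt z (-chi γ δ (z t)) (Ici a) t) :
    Tendsto z atTop (𝓝 0) := by
  have hz' : ∀ b, ∀ t ∈ Icc a b, HasDerivWithinAt z (-chi γ δ (z t)) (Icc a b) t :=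
    fun b t ht => (hz t ht.1).mono Icc_subset_Ici_self
  set Z := max δ |z a|
  have hZ : 0 < Z := hδ.trans_le (le_max_left _ _)
  set k := γ * δ / Z
  have hk : 0 < k := by positivity
  have hanti : AntitoneOn (fun t => z t ^ 2 * Real.exp (2 * k * (t - a))) (Ici a) := by
    refine antitoneOn_of_hasDerivWithinAt_nonpos (convex_Ici a)
      (f' := fun t => (2 * (k * z t ^ 2 - z t * chi γ δ (z t))) * Real.exp (2 * k * (t - a)))
      (fun t ht => ((hz t ht).continuousWithinAt.pow 2).mul (by fun_prop)) (fun t ht => ?_)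
      (fun t ht => ?_)
    · have h1 := ((hz t (interior_subset ht)).mono interior_subset).pow 2
      have h2 : HasDerivAt (fun t => Real.exp (2 * k * (t - a)))
          (Real.exp (2 * k * (t - a)) * (2 * k * 1)) t :=
        (((hasDerivAt_id t).sub_const a).const_mul (2 * k)).exp
      exact (h1.mul h2.hasDerivWithinAt).congr_deriv (by simp; ring)
    · have h3 : a ≤ t := interior_subset ht
      have h1 : |z t| ≤ Z := (abs_le_of_decay hγ hδ (hz' t) h3).trans (le_max_right _ _)
      have h2 := mul_chi_ge hγ.le hδ (le_max_left δ |z a|) h1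
      exact mul_nonpos_of_nonpos_of_nonneg (by linarith) (Real.exp_pos _).le
  have hbound : ∀ t ≥ a, z t ^ 2 ≤ z a ^ 2 * Real.exp (-(2 * k * (t - a))) := fun t ht => by
    have := hanti self_mem_Ici ht ht
    simp only [sub_self, mul_zero, Real.exp_zero, mul_one] at this
    rwa [Real.exp_neg, ← div_eq_mul_inv, le_div_iff₀ (Real.exp_pos _)]
  have hlim : Tendsto (fun t => z a ^ 2 * Real.exp (-(2 * k * (t - a)))) atTop (𝓝 0) := by
    rw [← mul_zero (z a ^ 2)]
    refine (Real.tendsto_exp_neg_atTop_nhds_zero.comp ?_).const_mul _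
    exact (tendsto_atTop_add_const_right _ (-a) tendsto_id).const_mul_atTop (by positivity)
  have hsq : Tendsto (fun t => z t ^ 2) atTop (𝓝 0) :=
    tendsto_of_tendsto_of_tendsto_of_le_of_le' tendsto_const_nhds hlim
      (.of_forall fun t => sq_nonneg _) ((eventually_ge_atTop a).mono hbound)
  have := hsq.sqrt
  simp only [Real.sqrt_sq_eq_abs, Real.sqrt_zero] at this
  exact (tendsto_zero_iff_abs_tendsto_zero _).2 this

end Decay

/-! ### Behaviour near the switching surface -/

/-- The angle rotates at the constant rate `w` on `[a, b]`. -/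
def TurnsOn (θ : ℝ → ℝ) (w a b : ℝ) : Prop := ∀ t ∈ Icc a b, θ t = θ a + w * (t - a)

lemma TurnsOn.hasDerivWithinAt {θ : ℝ → ℝ} {w a b t : ℝ} (h : TurnsOn θ w a b)
    (ht : t ∈ Icc a b) : HasDerivWithinAt θ w (Icc a b) t := by
  have h1 : HasDerivAt (fun t => θ a + w * (t - a)) (w * 1) t :=
    (((hasDerivAt_id t).sub_const a).const_mul w).const_add (θ a)
  rw [mul_one] at h1
  exact h1.hasDerivWithinAt.congr (fun s hs => h s hs) (h t ht)

namespace Env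

/-- Quantitative assumptions under which the law drives the robot to the switching surface and keeps
it there while the distance to the centre lies in `[Rm, Rp]`. -/
structure Bounds (E : Env) (ubar v₀ μ Rm Rp : ℝ) : Prop extends E.Regular where
  ubar_pos : 0 < ubar
  v₀_nonneg : 0 ≤ v₀
  μ_nonneg : 0 ≤ μ
  speed_lt : v₀ + μ < E.v
  Rm_pos : 0 < Rm
  centre_speed : ∀ t, 0 ≤ t → ‖E.centreVel t‖ ≤ v₀
  chi_le : ∀ R ∈ Icc Rm Rp, E.γ * E.δ ≤ μ * (E.c * |deriv E.f R|)
  turn : ∀ r θ t, 0 ≤ t → ‖E.sep r t‖ ∈ Icc Rm Rp → E.surf r θ t = 0 →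
    0 < |E.tangVel r θ t| ∧
    |E.drift r θ t| + E.γ * |E.rangeRate r θ t|
      + |deriv (deriv E.f) ‖E.sep r t‖| / |deriv E.f ‖E.sep r t‖| * E.rangeRate r θ t ^ 2
      < ubar * |E.tangVel r θ t|
  exists_target : ∃ R ∈ Icc Rm Rp, E.c * E.f R = E.d₀

namespace Bounds

variable {E : Env} {ubar v₀ μ Rm Rp : ℝ} {r : ℝ → Plane} {θ : ℝ → ℝ} {T s : ℝ}

lemma sep_ne_zero (h : E.Bounds ubar v₀ μ Rm Rp) (hR : ‖E.sep r T‖ ∈ Icc Rm Rp) :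
    E.sep r T ≠ 0 :=
  norm_pos_iff.1 (h.Rm_pos.trans_le hR.1)

/-- Multiplying `turn` by `c |f'|` shows that the control term of `d̈` dominates all the others. The
surplus over `γ |ḋ|` is what later absorbs the variation of `χ(d - d₀)`. -/
lemma measAcc_gt (h : E.Bounds ubar v₀ μ Rm Rp) (hT : 0 ≤ T) (hR : ‖E.sep r T‖ ∈ Icc Rm Rp)
    (hS : E.surf r θ T = 0) (hs : s = 1 ∨ s = -1) :
    E.γ * |E.measRate r θ T| <
      s * SignType.sign (E.tangVel r θ T) * E.measAcc r θ (s * ubar) T := by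
  obtain ⟨h1, h2⟩ := h.turn r θ T hT hR hS
  have hneg := h.f_deriv_neg _ (norm_pos_iff.2 (h.sep_ne_zero hR))
  set x := E.tangVel r θ T
  set F := deriv E.f ‖E.sep r T‖ with hF
  set F' := deriv (deriv E.f) ‖E.sep r T‖ with hF'
  set G := E.rangeRate r θ T with hG
  set b := E.drift r θ T with hb
  have hc := h.c_pos
  -- The sign of `x` is kept as an abstract `k = ±1` with `k x = |x|`, so that both parts of the
  -- surface are treated by one computation.
  have hsg : ∀ k : ℝ, (k = 1 ∨ k = -1) → k * x = |x| →
      E.γ * |E.measRate r θ T| < s * k * E.measAcc r θ (s * ubar) T := by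
    intro k hk hkx
    have hss : s * s = 1 := by rcases hs with rfl | rfl <;> norm_num
    rw [measRate, measAcc, ← hF, ← hF', ← hG, ← hb, abs_mul, abs_mul, abs_of_pos hc,
      abs_of_neg hneg]
    rw [abs_of_neg hneg] at h2
    have e1 : |F'| / -F * G ^ 2 * (-F) = |F'| * G ^ 2 := by
      have := hneg.ne
      field_simp
    have e2 : s * k * (E.c * (F' * G ^ 2 + F * (b - s * ubar * x)))
        = E.c * (s * k * F' * G ^ 2 + s * k * F * b + (-F) * ubar * |x|) := by
      rw [← hkx]; linear_combination (-E.c * k * F * ubar * x) * hss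
    have e3 : |s * k| = 1 := by
      rcases hs with rfl | rfl <;> rcases hk with rfl | rfl <;> norm_num
    have e4 : -(|F'| * G ^ 2) ≤ s * k * F' * G ^ 2 := by
      have := neg_abs_le (s * k * F' * G ^ 2)
      rwa [abs_mul, abs_mul, e3, one_mul, abs_of_nonneg (sq_nonneg G)] at this
    have e5 : -(-F * |b|) ≤ s * k * F * b := by
      have := neg_abs_le (s * k * F * b)
      rwa [abs_mul, abs_mul, e3, one_mul, abs_of_neg hneg] at this
    have e6 := mul_lt_mul_of_pos_right h2 (neg_pos.2 hneg)
    rw [e2, show E.γ * (E.c * -F * |G|) = E.c * (-F * (E.γ * |G|)) by ring]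
    refine mul_lt_mul_of_pos_left ?_ hc
    nlinarith [e1]
  rcases lt_or_gt_of_ne (abs_pos.1 h1) with hx | hx
  · exact hsg _ (by simp [hx]) (by simp [hx, abs_of_neg])
  · exact hsg _ (by simp [hx]) (by simp [hx, abs_of_pos])

/-- Close to the surface, under a saturated control the switching function is strictly monotone. -/
lemma exists_strict_mono (h : E.Bounds ubar v₀ μ Rm Rp) (hp : E.IsPath r θ) (hT : 0 ≤ T)
    (hR : ‖E.sep r T‖ ∈ Icc Rm Rp) (hS : E.surf r θ T = 0) :
    ∃ ε > 0, (∀ t, 0 ≤ t → |t - T| < ε → E.sep r t ≠ 0 ∧ 0 < E.tangVel r θ T * E.tangVel r θ t) ∧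
      ∀ a b s, (s = 1 ∨ s = -1) → 0 ≤ a → a < b → |a - T| < ε → |b - T| < ε →
        TurnsOn θ (s * ubar) a b →
        0 < E.tangVel r θ T * (s * E.surf r θ b - s * E.surf r θ a) := by
  have hreg : E.RegPath r θ := ⟨h.toRegular, hp⟩
  have h0 := h.sep_ne_zero hR
  have hx := (h.turn r θ T hT hR hS).1
  set x := E.tangVel r θ T with hxdef
  set k : ℝ := ((SignType.sign x : SignType) : ℝ) with hk
  have hx2 : 0 < x * x := mul_self_pos.2 (abs_pos.1 hx)
  -- The midpoint of the two sides of `measAcc_gt` at `T` is a constant that, by continuity,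
  -- separates them throughout a neighbourhood.
  have key : ∀ s : ℝ, (s = 1 ∨ s = -1) → ∀ᶠ y in 𝓝 T, y ∈ Ici 0 →
      E.γ * |E.measRate r θ y| < E.γ * |E.measRate r θ T| / 2 +
        (s * k * E.measAcc r θ (s * ubar) T) / 2 ∧
      E.γ * |E.measRate r θ T| / 2 + (s * k * E.measAcc r θ (s * ubar) T) / 2 <
        s * k * E.measAcc r θ (s * ubar) y := by
    intro s hs
    have h1 := h.measAcc_gt hT hR hS hs
    rw [← eventually_nhdsWithin_iff]
    refine Eventually.and ?_ ?_
    · exact ((hreg.continuousWithinAt_measRate hT h0).abs.const_mul E.γ).eventually_lt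
        continuousWithinAt_const (by linarith)
    · exact continuousWithinAt_const.eventually_lt
        ((hreg.continuousWithinAt_measAcc (s * ubar) hT h0).const_mul (s * k)) (by linarith)
  have key2 : ∀ᶠ y in 𝓝 T, y ∈ Ici 0 → E.sep r y ≠ 0 ∧ 0 < x * E.tangVel r θ y := by
    rw [← eventually_nhdsWithin_iff]
    exact (hreg.eventually_sep_ne_zero hT h0).and (continuousWithinAt_const.eventually_lt
      ((hreg.continuousWithinAt_tangVel hT h0).const_mul x) hx2)
  obtain ⟨ε, hε, hball⟩ := Metric.eventually_nhds_iff.1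
    (((key 1 (.inl rfl)).and (key (-1) (.inr rfl))).and key2)
  refine ⟨ε, hε, fun t ht htT => (hball (by rwa [Real.dist_eq])).2 ht, ?_⟩
  intro a b s hs ha hab haT hbT hturn
  obtain ⟨M, hM⟩ : ∃ M, ∀ y ∈ Icc a b, E.sep r y ≠ 0 ∧ E.γ * |E.measRate r θ y| < M ∧
      M < s * k * E.measAcc r θ (s * ubar) y := by
    refine ⟨E.γ * |E.measRate r θ T| / 2 + (s * k * E.measAcc r θ (s * ubar) T) / 2, ?_⟩
    intro y hy
    have hyT : dist y T < ε := by
      rw [Real.dist_eq, abs_lt] at *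
      constructor <;> linarith [hy.1, hy.2]
    have hy0 : y ∈ Ici (0 : ℝ) := ha.trans hy.1
    obtain ⟨⟨h1, h2⟩, h3⟩ := hball hyT
    refine ⟨(h3 hy0).1, ?_⟩
    rcases hs with rfl | rfl
    · exact h1 hy0
    · exact h2 hy0
  have hsub : Icc a b ⊆ Ici (0 : ℝ) := fun y hy => ha.trans hy.1
  have hnhds : ∀ y ∈ Ioo a b, Icc a b ∈ 𝓝 y := fun y hy => Icc_mem_nhds hy.1 hy.2
  -- The mean value theorem is applied separately to `ḋ` and to `d`, because `χ` is only Lipschitz.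
  -- The intermediate points `p` and `q` differ, hence the need for a uniform separating constant
  -- `M`.
  obtain ⟨p, hp1, hp2⟩ := exists_hasDerivAt_eq_slope (E.measRate r θ)
    (E.measAcc r θ (s * ubar)) hab
    (fun y hy => (hreg.continuousWithinAt_measRate (hsub hy) (hM y hy).1).mono hsub)
    (fun y hy => (hreg.hasDerivWithinAt_measRate hsub (hsub (Ioo_subset_Icc_self hy))
      (hM y (Ioo_subset_Icc_self hy)).1
      (hturn.hasDerivWithinAt (Ioo_subset_Icc_self hy))).hasDerivAt (hnhds y hy))
  obtain ⟨q, hq1, hq2⟩ := exists_hasDerivAt_eq_slope (E.meas r) (E.measRate r θ) hab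
    (fun y hy => (hreg.continuousWithinAt_meas (hsub hy) (hM y hy).1).mono hsub)
    (fun y hy => (hreg.hasDerivWithinAt_meas (hsub (Ioo_subset_Icc_self hy))
      (hM y (Ioo_subset_Icc_self hy)).1).hasDerivAt
        (mem_of_superset (hnhds y hy) hsub))
  have hba : 0 < b - a := sub_pos.2 hab
  rw [eq_div_iff hba.ne'] at hp2 hq2
  have hMp := (hM p (Ioo_subset_Icc_self hp1)).2.2
  have hMq := (hM q (Ioo_subset_Icc_self hq1)).2.1
  have hchi := abs_chi_sub_le h.γ_pos.le h.δ_pos.le (E.meas r b - E.d₀) (E.meas r a - E.d₀)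
  rw [sub_sub_sub_cancel_right, ← hq2, abs_mul, abs_of_pos hba, ← mul_assoc] at hchi
  have hchi2 := hchi.trans_lt (mul_lt_mul_of_pos_right hMq hba)
  have hp3 := mul_lt_mul_of_pos_right hMp hba
  rw [mul_assoc, hp2] at hp3
  set D := chi E.γ E.δ (E.meas r b - E.d₀) - chi E.γ E.δ (E.meas r a - E.d₀) with hD
  have hdiff : s * E.surf r θ b - s * E.surf r θ a
      = s * (E.measRate r θ b - E.measRate r θ a) + s * D := by
    rw [surf, surf, hD]; ring
  rw [hdiff]
  obtain ⟨hD1, hD2⟩ := abs_lt.1 hchi2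
  rcases lt_or_gt_of_ne (abs_pos.1 hx) with hx' | hx'
  · have hk1 : k = -1 := by simp [hk, hx']
    rw [hk1] at hp3
    refine mul_pos_of_neg_of_neg hx' ?_
    rcases hs with rfl | rfl <;> nlinarith
  · have hk1 : k = 1 := by simp [hk, hx']
    rw [hk1] at hp3
    refine mul_pos hx' ?_
    rcases hs with rfl | rfl <;> nlinarith

end Bounds

end Env

/-! ### Circular arcs under a saturated control -/

lemma exists_eq_norm_smul_heading (x : Plane) : ∃ φ, x = ‖x‖ • heading φ := by
  have h0 : ‖(⟨x 0, x 1⟩ : ℂ)‖ = ‖x‖ := by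
    refine (sq_eq_sq₀ (norm_nonneg _) (norm_nonneg _)).1 ?_
    rw [norm_sq_eq, ← Complex.normSq_eq_norm_sq, Complex.normSq_mk]; ring
  refine ⟨Complex.arg ⟨x 0, x 1⟩, ?_⟩
  rw [← h0]
  ext i
  fin_cases i
  · simp
  · simp

lemma inner_heading_heading (α φ : ℝ) : inner ℝ (heading α) (heading φ) = Real.cos (α - φ) := by
  rw [inner_eq, Real.cos_sub]; simp

lemma eq_inner_smul_of_cross_eq_zero {x : Plane} {α : ℝ} (h : cross x (heading α) = 0) :
    x = inner ℝ x (heading α) • heading α := by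
  rw [inner_eq]
  simp only [cross, heading_zero, heading_one] at h ⊢
  have h1 := Real.sin_sq_add_cos_sq α
  ext i
  fin_cases i
  · simp; linear_combination (Real.sin α) * h - x 0 * h1
  · simp; linear_combination (-Real.cos α) * h - x 1 * h1

lemma TurnsOn.tail {θ : ℝ → ℝ} {w a a' b : ℝ} (h : TurnsOn θ w a b) (ha : a' ∈ Icc a b) :
    TurnsOn θ w a' b := fun t ht => by
  rw [h t ⟨ha.1.trans ht.1, ht.2⟩, h a' ha]; ring

namespace Env

variable {E : Env} {ubar v₀ μ Rm Rp : ℝ} {r : ℝ → Plane} {θ : ℝ → ℝ} {s : ℝ}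

/-- Under a constant nonzero control the robot moves on a circle. -/
lemma RegPath.norm_sub_le_of_turnsOn (h : E.RegPath r θ) {w τ : ℝ} (hw : w ≠ 0)
    (hturn : TurnsOn θ w 0 τ) {t : ℝ} (ht : t ∈ Icc 0 τ) :
    ‖r t - r 0‖ ≤ 2 * E.v / |w| := by
  have hsub : Icc (0 : ℝ) τ ⊆ Ici 0 := Icc_subset_Ici_self
  -- The point `r + (v/w) leftNormal θ` is the centre of the circle, so it does not move.
  have hd : ∀ y ∈ Icc 0 τ, HasDerivWithinAt (fun y => r y + (E.v / w) • leftNormal (θ y)) 0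
      (Icc 0 τ) y := fun y hy => by
    have h1 := ((h.position_deriv y hy.1).mono hsub).add
      (((hasDerivAt_leftNormal (θ y)).scomp_hasDerivWithinAt y
        (hturn.hasDerivWithinAt hy)).const_smul (E.v / w))
    refine h1.congr_deriv ?_
    rw [smul_smul, div_mul_cancel₀ _ hw, smul_neg, add_neg_cancel]
  have hc := constant_of_derivWithin_zero (fun y hy => (hd y hy).differentiableWithinAt)
    (fun y hy => (hd y (Ico_subset_Icc_self hy)).derivWithin
      (uniqueDiffOn_Icc (hy.1.trans_lt hy.2) y (Ico_subset_Icc_self hy))) t ht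
  have h2 : r t - r 0 = (E.v / w) • (leftNormal (θ 0) - leftNormal (θ t)) := by
    rw [smul_sub, sub_eq_sub_iff_add_eq_add, hc]; abel
  rw [h2, norm_smul, Real.norm_eq_abs, abs_div, abs_of_pos h.v_pos]
  have h3 : ‖leftNormal (θ 0) - leftNormal (θ t)‖ ≤ 1 + 1 := by
    refine (norm_sub_le _ _).trans ?_
    rw [norm_leftNormal, norm_leftNormal]
  calc E.v / |w| * ‖leftNormal (θ 0) - leftNormal (θ t)‖ ≤ E.v / |w| * (1 + 1) :=
        mul_le_mul_of_nonneg_left h3 (div_nonneg h.v_pos.le (abs_nonneg w))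
    _ = 2 * E.v / |w| := by ring

/-- The distance within which the relative position stays during two full turns. -/
def turnRange (v ubar v₀ : ℝ) : ℝ := (2 * v + 4 * Real.pi * v₀) / ubar

namespace Bounds

lemma norm_centre_sub_le (h : E.Bounds ubar v₀ μ Rm Rp) {t : ℝ} (ht : 0 ≤ t) :
    ‖E.r₀ t - E.r₀ 0‖ ≤ v₀ * t := by
  have := norm_image_sub_le_of_norm_deriv_le_segment' (f := E.r₀) (f' := E.centreVel) (a := 0)
    (b := t) (C := v₀) (fun x hx => (h.hasDerivWithinAt_centre hx.1).mono Icc_subset_Ici_self)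
    (fun x hx => h.centre_speed x hx.1) t ⟨ht, le_rfl⟩
  simpa using this

lemma turnRange_pos (h : E.Bounds ubar v₀ μ Rm Rp) : 0 < turnRange E.v ubar v₀ := by
  have h1 := h.v_pos
  have h2 := h.v₀_nonneg
  have h3 := h.ubar_pos
  have := Real.pi_pos
  rw [turnRange]; positivity

/-- The robot moves by at most the diameter `2v/ubar` of its circle, and the field centre by at most
`v₀` times the duration `4π/ubar` of two turns. -/
lemma norm_sep_sub_le (h : E.Bounds ubar v₀ μ Rm Rp) (hp : E.IsPath r θ) (hs : s = 1 ∨ s = -1)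
    {τ : ℝ} (hτ : τ ≤ 4 * Real.pi / ubar) (hturn : TurnsOn θ (s * ubar) 0 τ) {t : ℝ}
    (ht : t ∈ Icc 0 τ) : ‖E.sep r t - E.sep r 0‖ ≤ turnRange E.v ubar v₀ := by
  have hu := h.ubar_pos
  have habs : |s * ubar| = ubar := by
    rcases hs with rfl | rfl <;> simp [abs_of_pos hu]
  have hw : s * ubar ≠ 0 := abs_pos.1 (habs.symm ▸ hu)
  have h1 := (RegPath.mk h.toRegular hp).norm_sub_le_of_turnsOn hw hturn ht
  have h2 := h.norm_centre_sub_le ht.1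
  rw [habs] at h1
  calc ‖E.sep r t - E.sep r 0‖ = ‖(r t - r 0) - (E.r₀ t - E.r₀ 0)‖ := by
        rw [sep, sep]; congr 1; abel
    _ ≤ 2 * E.v / ubar + v₀ * t := (norm_sub_le _ _).trans (add_le_add h1 h2)
    _ ≤ 2 * E.v / ubar + v₀ * (4 * Real.pi / ubar) := by
        gcongr
        · exact h.v₀_nonneg
        · exact ht.2.trans hτ
    _ = turnRange E.v ubar v₀ := by rw [turnRange]; ring

/-- Where the robot heads along the line to the centre, in the sense opposite to that demanded by the
control `s * ubar`, the switching function has the sign of `s`. -/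
lemma surf_pos_of_cross_eq_zero (h : E.Bounds ubar v₀ μ Rm Rp) (hs : s = 1 ∨ s = -1) {t : ℝ}
    (ht : 0 ≤ t) (hR : ‖E.sep r t‖ ∈ Icc Rm Rp) (hc : cross (E.sep r t) (heading (θ t)) = 0)
    (hi : s * inner ℝ (E.sep r t) (heading (θ t)) < 0) : 0 < s * E.surf r θ t := by
  have hN := norm_pos_iff.2 (h.sep_ne_zero hR)
  have hss : s * s = 1 := by rcases hs with rfl | rfl <;> norm_num
  have habs : |s| = 1 := by rcases hs with rfl | rfl <;> norm_num
  set N := ‖E.sep r t‖ with hNdef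
  have h1 : s * inner ℝ (E.sep r t) (heading (θ t)) = -N := by
    have h2 := inner_sq_add_cross_sq (E.sep r t) (heading (θ t))
    rw [hc, norm_heading] at h2
    have h3 : (s * inner ℝ (E.sep r t) (heading (θ t))) ^ 2 = N ^ 2 := by
      linear_combination h2 + (inner ℝ (E.sep r t) (heading (θ t))) ^ 2 * hss
    rcases sq_eq_sq_iff_eq_or_eq_neg.1 h3 with h4 | h4
    · linarith
    · exact h4
  have h5 : -(N * v₀) ≤ s * inner ℝ (E.sep r t) (E.centreVel t) := by
    have h6 : |s * inner ℝ (E.sep r t) (E.centreVel t)| ≤ N * v₀ := by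
      rw [abs_mul, habs, one_mul]
      exact (abs_real_inner_le_norm _ _).trans
        (mul_le_mul_of_nonneg_left (h.centre_speed t ht) hN.le)
    exact (abs_le.1 h6).1
  -- Aligned with the line of sight, the robot outruns the centre by at least `v - v₀ > μ`, whereas
  -- `χ` is worth at most `μ` in units of `c |f'|`.
  have hG : s * E.rangeRate r θ t ≤ -(E.v - v₀) := by
    rw [rangeRate, relVel, inner_sub_right, inner_smul_right, ← mul_div_assoc, div_le_iff₀ hN]
    linear_combination E.v * h1 + h5
  have hf := h.f_deriv_neg _ hN
  have hcf : 0 < E.c * |deriv E.f N| := mul_pos h.c_pos (abs_pos.2 hf.ne)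
  have hchi : |chi E.γ E.δ (E.meas r t - E.d₀)| ≤ μ * (E.c * |deriv E.f N|) :=
    (abs_chi_le h.γ_pos.le h.δ_pos.le _).trans (h.chi_le N hR)
  have h7 : -(μ * (E.c * |deriv E.f N|)) ≤ s * chi E.γ E.δ (E.meas r t - E.d₀) := by
    have : |s * chi E.γ E.δ (E.meas r t - E.d₀)| ≤ μ * (E.c * |deriv E.f N|) := by
      rwa [abs_mul, habs, one_mul]
    exact (abs_le.1 this).1
  have h8 : s * E.surf r θ t = (E.c * |deriv E.f N|) * (-(s * E.rangeRate r θ t))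
      + s * chi E.γ E.δ (E.meas r t - E.d₀) := by
    rw [surf, measRate, abs_of_neg hf]; ring
  rw [h8]
  have h9 := mul_le_mul_of_nonneg_left (neg_le_neg hG) hcf.le
  have h10 := mul_pos hcf (sub_pos.2 h.speed_lt)
  nlinarith

/-- The robot cannot make two full turns without crossing the switching surface. -/
lemma exists_surf_pos (h : E.Bounds ubar v₀ μ Rm Rp) (hp : E.IsPath r θ) (hs : s = 1 ∨ s = -1)
    (hturn : TurnsOn θ (s * ubar) 0 (4 * Real.pi / ubar))
    (hR0 : turnRange E.v ubar v₀ < ‖E.sep r 0‖)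
    (hR : ∀ t ∈ Icc 0 (4 * Real.pi / ubar), ‖E.sep r t‖ ∈ Icc Rm Rp) :
    ∃ t ∈ Ioo 0 (4 * Real.pi / ubar), 0 < s * E.surf r θ t := by
  have hu := h.ubar_pos
  have hpi := Real.pi_pos
  have hss : s * s = 1 := by rcases hs with rfl | rfl <;> norm_num
  have hreg : E.RegPath r θ := ⟨h.toRegular, hp⟩
  obtain ⟨φ, hφ⟩ := exists_eq_norm_smul_heading (E.sep r 0)
  have hN0 : 0 < ‖E.sep r 0‖ := h.turnRange_pos.trans hR0
  -- The relative position changes by less than its initial length, so it keeps a positive component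
  -- along its initial direction.
  have hhalf : ∀ t ∈ Icc 0 (4 * Real.pi / ubar), 0 < inner ℝ (E.sep r t) (heading φ) := by
    intro t ht
    have h1 := h.norm_sep_sub_le hp hs le_rfl hturn ht
    have h2 : inner ℝ (E.sep r t) (heading φ)
        = inner ℝ (E.sep r t - E.sep r 0) (heading φ) + ‖E.sep r 0‖ := by
      have h3 : inner ℝ (E.sep r 0) (heading φ) = ‖E.sep r 0‖ := by
        conv_lhs => rw [hφ]
        rw [inner_smul_left, real_inner_self_eq_norm_sq, norm_heading]; simp
      rw [inner_sub_left, h3]; ring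
    have h4 := (abs_le.1 ((abs_real_inner_le_norm (E.sep r t - E.sep r 0) (heading φ)))).1
    rw [norm_heading, mul_one] at h4
    linarith
  -- the time when the robot heads to the left of the initial direction from the centre
  obtain ⟨k, ⟨hk1, hk2⟩, -⟩ := existsUnique_add_zsmul_mem_Ico Real.two_pi_pos
    (s * (φ + Real.pi / 2 - θ 0)) (Real.pi / 2)
  -- Here `x` lies in `[π/2, 5π/2)`: the half-turn from `x` to `x + π` starts after time zero and
  -- ends before two full turns are completed.
  set x := s * (φ + Real.pi / 2 - θ 0) + k • (2 * Real.pi) with hx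
  have hθ : ∀ y, 0 ≤ y → x + y ≤ 4 * Real.pi →
      θ ((x + y) / ubar) = φ + Real.pi / 2 + s * y + (s * k) * (2 * Real.pi) := by
    intro y hy hxy
    rw [hturn ((x + y) / ubar) ⟨div_nonneg (by linarith) hu.le, by gcongr⟩, hx, zsmul_eq_mul]
    field_simp
    linear_combination 2 * (φ + Real.pi / 2 - θ 0) * hss
  obtain ⟨m, hm⟩ : ∃ m : ℤ, s * k = m := by
    rcases hs with rfl | rfl
    · exact ⟨k, by simp⟩
    · exact ⟨-k, by simp⟩
  have hcos : ∀ y, 0 ≤ y → x + y ≤ 4 * Real.pi → Real.cos (θ ((x + y) / ubar) - φ)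
      = -(s * Real.sin y) := by
    intro y hy hxy
    rw [hθ y hy hxy, hm, show φ + Real.pi / 2 + s * y + m * (2 * Real.pi) - φ
      = (s * y + Real.pi / 2) + m * (2 * Real.pi) by ring, Real.cos_add_int_mul_two_pi,
      Real.cos_add_pi_div_two]
    rcases hs with rfl | rfl <;> simp
  have hhead : ∀ y, 0 ≤ y → x + y ≤ 4 * Real.pi → heading (θ ((x + y) / ubar))
      = heading (φ + Real.pi / 2 + s * y) := by
    intro y hy hxy
    rw [hθ y hy hxy, hm, heading, heading, Real.cos_add_int_mul_two_pi,
      Real.sin_add_int_mul_two_pi]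
  have hleft : heading (φ + Real.pi / 2) = leftNormal φ := by
    rw [heading, leftNormal, Real.cos_add_pi_div_two, Real.sin_add_pi_div_two]
  have hle : x / ubar ≤ (x + Real.pi) / ubar := by gcongr; linarith
  have hmem : ∀ t ∈ Icc (x / ubar) ((x + Real.pi) / ubar), t ∈ Ioo 0 (4 * Real.pi / ubar) := by
    intro t ht
    refine ⟨(div_pos (by linarith) hu).trans_le ht.1, ht.2.trans_lt ?_⟩
    gcongr; linarith
  have hcont : ContinuousOn (fun t => cross (E.sep r t) (heading (θ t)))
      (Icc (x / ubar) ((x + Real.pi) / ubar)) :=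
    (hreg.continuousOn_sep.cross (continuous_heading.comp_continuousOn
      hreg.angle_continuousOn)).mono fun t ht => (hmem t ht).1.le
  have hA : 0 < cross (E.sep r (x / ubar)) (heading (θ (x / ubar))) := by
    have h1 := hhead 0 le_rfl (by linarith)
    rw [add_zero, mul_zero, add_zero] at h1
    rw [h1, hleft, cross_leftNormal]
    exact hhalf _ (Ioo_subset_Icc_self (hmem _ (left_mem_Icc.2 hle)))
  have hB : cross (E.sep r ((x + Real.pi) / ubar)) (heading (θ ((x + Real.pi) / ubar))) < 0 := by
    have h1 := hhead Real.pi hpi.le (by linarith)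
    have h2 : heading (φ + Real.pi / 2 + s * Real.pi) = -leftNormal φ := by
      rw [← hleft]
      ext i
      rcases hs with rfl | rfl <;> fin_cases i <;>
        simp [neg_mul, ← sub_eq_add_neg, Real.cos_sub_pi, Real.sin_sub_pi]
    have h3 : ∀ a b : Plane, cross a (-b) = -cross a b := fun a b => by simp [cross]; ring
    rw [h1, h2, h3, cross_leftNormal, neg_lt_zero]
    exact hhalf _ (Ioo_subset_Icc_self (hmem _ (right_mem_Icc.2 hle)))
  -- At the ends of the half-turn the heading is `± leftNormal φ`, where the oriented area has
  -- opposite signs; in between the robot is aligned with the line of sight.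
  obtain ⟨t, ht, hct⟩ := intermediate_value_Icc' hle hcont ⟨hB.le, hA.le⟩
  have ht' := Ioo_subset_Icc_self (hmem t ht)
  refine ⟨t, hmem t ht, h.surf_pos_of_cross_eq_zero hs ht'.1 (hR t ht') hct ?_⟩
  have h1 := hhalf t ht'
  -- At alignment the positive component along `heading φ` equals `-(s ⟨sep, heading θ⟩) sin y` with
  -- `sin y ≥ 0`, which decides the sense of the heading.
  rw [eq_inner_smul_of_cross_eq_zero hct, inner_smul_left, inner_heading_heading] at h1
  obtain ⟨y, hy, rfl⟩ : ∃ y ∈ Icc 0 Real.pi, t = (x + y) / ubar := by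
    refine ⟨ubar * t - x, ⟨?_, ?_⟩, by field_simp; ring⟩
    · have := (div_le_iff₀ hu).1 ht.1; linarith
    · have := (le_div_iff₀ hu).1 ht.2; linarith
  rw [hcos y hy.1 (by linarith [hy.2])] at h1
  have h2 : 0 ≤ Real.sin y := Real.sin_nonneg_of_mem_Icc hy
  simp only [conj_trivial] at h1
  by_contra! hcon
  nlinarith [mul_nonneg hcon h2]

end Bounds

end Env

/-! ### Arrival at the switching surface and sliding -/

namespace Env

variable {E : Env} {ubar v₀ μ Rm Rp : ℝ} {r : ℝ → Plane} {θ : ℝ → ℝ} {s : ℝ}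

/-- On `(a, b)` the robot is off the centre and on the side of the switching surface where the law
commands the angular velocity `s * ubar`. -/
def Commands (E : Env) (r : ℝ → Plane) (θ : ℝ → ℝ) (s a b : ℝ) : Prop :=
  ∀ t ∈ Ioo a b, E.sep r t ≠ 0 ∧ s * E.surf r θ t < 0

namespace Bounds

/-- Obeying the command `s`, the robot reaches the attractive part of the switching surface within
two full turns. -/
lemma reach_surface (h : E.Bounds ubar v₀ μ Rm Rp) (hp : E.IsPath r θ) (hs : s = 1 ∨ s = -1)
    (hlaw : ∀ τ, 0 < τ → E.Commands r θ s 0 τ → TurnsOn θ (s * ubar) 0 τ)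
    (hstart : ∃ ε > 0, E.Commands r θ s 0 ε)
    (hRm : Rm + turnRange E.v ubar v₀ ≤ ‖E.sep r 0‖)
    (hRp : ‖E.sep r 0‖ + turnRange E.v ubar v₀ ≤ Rp) :
    ∃ t₁ > 0, TurnsOn θ (s * ubar) 0 t₁ ∧ E.Commands r θ s 0 t₁ ∧
      (∀ t ∈ Icc 0 t₁, ‖E.sep r t‖ ∈ Icc Rm Rp) ∧ E.surf r θ t₁ = 0 ∧ 0 < E.tangVel r θ t₁ := by
  have hreg : E.RegPath r θ := ⟨h.toRegular, hp⟩
  set T := 4 * Real.pi / ubar with hT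
  have hTpos : 0 < T := div_pos (by have := Real.pi_pos; positivity) h.ubar_pos
  obtain ⟨ε, hε, hcε⟩ := hstart
  let B : Set ℝ := {τ | 0 < τ ∧ τ ≤ T ∧ E.Commands r θ s 0 τ}
  have hB0 : min ε T ∈ B := ⟨lt_min hε hTpos, min_le_right _ _,
    fun t ht => hcε t ⟨ht.1, ht.2.trans_le (min_le_left _ _)⟩⟩
  have hBb : BddAbove B := ⟨T, fun τ hτ => hτ.2.1⟩
  set t₁ := sSup B with ht₁
  have ht₁pos : 0 < t₁ := (lt_min hε hTpos).trans_le (le_csSup hBb hB0)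
  have ht₁T : t₁ ≤ T := csSup_le ⟨_, hB0⟩ fun τ hτ => hτ.2.1
  have hcom : E.Commands r θ s 0 t₁ := fun t ht => by
    obtain ⟨τ, hτ, htτ⟩ := exists_lt_of_lt_csSup ⟨_, hB0⟩ ht.2
    exact hτ.2.2 t ⟨ht.1, htτ⟩
  have hturn := hlaw t₁ ht₁pos hcom
  have hR : ∀ t ∈ Icc 0 t₁, ‖E.sep r t‖ ∈ Icc Rm Rp := fun t ht => by
    have h1 := (abs_le.1 ((abs_norm_sub_norm_le _ _).trans
      (h.norm_sep_sub_le hp hs ht₁T hturn ht)))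
    constructor <;> linarith [h1.1, h1.2]
  have ht₁R := hR t₁ (right_mem_Icc.2 ht₁pos.le)
  have ht₁0 := h.sep_ne_zero ht₁R
  have hcont : ContinuousWithinAt (fun t => s * E.surf r θ t) (Ici 0) t₁ :=
    (hreg.continuousWithinAt_surf ht₁pos.le ht₁0).const_mul s
  have hle : s * E.surf r θ t₁ ≤ 0 :=
    mem_of_continuousWithinAt_right_end isClosed_Iic le_rfl ht₁pos hcont
      fun t ht => (hcom t ht).2.le
  -- Were `S` still off zero at the supremum, then either two full turns have been made, against
  -- `exists_surf_pos`, or continuity prolongs the obedience beyond the supremum.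
  have hge : 0 ≤ s * E.surf r θ t₁ := by
    by_contra! hlt
    rcases ht₁T.eq_or_lt with h1 | h1
    · rw [h1] at hturn hR hcom
      obtain ⟨t, ht, hpos⟩ := h.exists_surf_pos hp hs hturn
        (by linarith [h.Rm_pos]) hR
      exact (hcom t ht).2.not_gt hpos
    · have h2 : ∀ᶠ t in 𝓝 t₁, t ∈ Ici 0 → E.sep r t ≠ 0 ∧ s * E.surf r θ t < 0 := by
        rw [← eventually_nhdsWithin_iff]
        exact (hreg.eventually_sep_ne_zero ht₁pos.le ht₁0).and
          (hcont.eventually_lt continuousWithinAt_const hlt)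
      obtain ⟨η, hη, hball⟩ := Metric.eventually_nhds_iff.1 h2
      have h3 : min (t₁ + η) T ∈ B := by
        refine ⟨lt_min (by linarith) hTpos, min_le_right _ _, fun t ht => ?_⟩
        rcases lt_or_ge t t₁ with h4 | h4
        · exact hcom t ⟨ht.1, h4⟩
        · refine hball ?_ ht.1.le
          rw [Real.dist_eq, abs_of_nonneg (by linarith)]
          linarith [ht.2.trans_le (min_le_left _ _)]
      exact (lt_min (by linarith) h1).not_ge (le_csSup hBb h3)
  have hss : s ≠ 0 := by rcases hs with rfl | rfl <;> norm_num
  have hS : E.surf r θ t₁ = 0 := (mul_eq_zero.1 (le_antisymm hle hge)).resolve_left hss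
  refine ⟨t₁, ht₁pos, hturn, hcom, hR, hS, ?_⟩
  -- Arrival on the repelling part is impossible: just before `t₁` the quantity `s S` is negative
  -- and at `t₁` it is zero, while `exists_strict_mono` makes it increase only if `x > 0`.
  by_contra! hneg
  obtain ⟨η, hη, -, hmono⟩ := h.exists_strict_mono hp ht₁pos.le ht₁R hS
  have ha : max (t₁ / 2) (t₁ - η / 2) < t₁ := max_lt (by linarith) (by linarith)
  have ha0 : 0 < max (t₁ / 2) (t₁ - η / 2) := (half_pos ht₁pos).trans_le (le_max_left _ _)
  have h1 := hmono _ t₁ s hs ha0.le ha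
    (by rw [abs_sub_comm, abs_of_pos (sub_pos.2 ha)]; linarith [le_max_right (t₁ / 2) (t₁ - η / 2)])
    (by simpa using hη) (hturn.tail ⟨ha0.le, ha.le⟩)
  rw [hS, mul_zero, zero_sub] at h1
  have h2 := (hcom _ ⟨ha0, ha⟩).2
  nlinarith

/-- While the switching function vanishes, the deviation of the measurement obeys `z' = -χ(z)`. -/
lemma hasDerivWithinAt_deviation (h : E.Bounds ubar v₀ μ Rm Rp) (hp : E.IsPath r θ) {t : ℝ}
    (ht : 0 ≤ t) (h0 : E.sep r t ≠ 0) (hS : E.surf r θ t = 0) :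
    HasDerivWithinAt (fun t => E.meas r t - E.d₀) (-chi E.γ E.δ (E.meas r t - E.d₀)) (Ici 0) t :=
  (((RegPath.mk h.toRegular hp).hasDerivWithinAt_meas ht h0).sub_const E.d₀).congr_deriv
    (by rw [surf] at hS; linarith)

lemma strictAntiOn_profile (h : E.Regular) : StrictAntiOn (fun x => E.c * E.f x) (Ioi 0) := by
  refine strictAntiOn_of_deriv_neg (convex_Ioi 0)
    (continuousOn_const.mul h.f_contDiffOn.continuousOn) fun x hx => ?_
  rw [interior_Ioi] at hx
  rw [((h.hasDerivAt_f hx).const_mul E.c).deriv]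
  exact mul_neg_of_pos_of_neg h.c_pos (h.f_deriv_neg x hx)

/-- A distance at which the measurement lies between the desired value and the measurement at an
admissible distance is admissible. -/
lemma mem_Icc_of_deviation_mem (h : E.Bounds ubar v₀ μ Rm Rp) {x y : ℝ} (hy : y ∈ Icc Rm Rp)
    (hx : 0 < x) (hz : E.c * E.f x - E.d₀ ∈ uIcc 0 (E.c * E.f y - E.d₀)) : x ∈ Icc Rm Rp := by
  obtain ⟨R, hR, hRd⟩ := h.exists_target
  have hanti := strictAntiOn_profile h.toRegular
  have hR0 : R ∈ Ioi (0 : ℝ) := h.Rm_pos.trans_le hR.1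
  have hy0 : y ∈ Ioi (0 : ℝ) := h.Rm_pos.trans_le hy.1
  have key : ∀ a b : ℝ, 0 < a → 0 < b → E.c * E.f a ≤ E.c * E.f b → b ≤ a :=
    fun a b ha hb hab => (hanti.le_iff_ge ha hb).1 hab
  rw [mem_uIcc] at hz
  rcases hz with ⟨h1, h2⟩ | ⟨h1, h2⟩
  · exact ⟨hy.1.trans (key _ _ hx hy0 (by linarith)), (key _ _ hR0 hx (by linarith)).trans hR.2⟩
  · exact ⟨hR.1.trans (key _ _ hx hR0 (by linarith)), (key _ _ hy0 hx (by linarith)).trans hy.2⟩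

/-- During sliding the deviation lies between its initial value and zero. As the profile is
monotone, the distance lies between the initial one and that of the desired isoline, both
admissible. -/
lemma norm_sep_mem_of_sliding (h : E.Bounds ubar v₀ μ Rm Rp) (hp : E.IsPath r θ) {a b : ℝ}
    (ha : 0 ≤ a) (hab : a ≤ b) (hR : ‖E.sep r a‖ ∈ Icc Rm Rp)
    (hslide : ∀ t ∈ Icc a b, E.sep r t ≠ 0 ∧ E.surf r θ t = 0) : ‖E.sep r b‖ ∈ Icc Rm Rp := by
  have hz : ∀ t ∈ Icc a b, HasDerivWithinAt (fun t => E.meas r t - E.d₀)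
      (-chi E.γ E.δ (E.meas r t - E.d₀)) (Icc a b) t := fun t ht =>
    (h.hasDerivWithinAt_deviation hp (ha.trans ht.1) (hslide t ht).1 (hslide t ht).2).mono
      fun y hy => ha.trans hy.1
  exact h.mem_Icc_of_deviation_mem hR (norm_pos_iff.2 (hslide b (right_mem_Icc.2 hab)).1)
    (mem_uIcc_of_decay h.γ_pos h.δ_pos hz hab)

/-- Once on the attractive part of the switching surface, the robot stays there. -/
lemma stays_on_surface (h : E.Bounds ubar v₀ μ Rm Rp) (hp : E.IsPath r θ) {t₁ : ℝ} (ht₁ : 0 ≤ t₁)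
    (hlaw : ∀ s a b, (s = 1 ∨ s = -1) → 0 ≤ a → a < b → E.Commands r θ s a b →
      TurnsOn θ (s * ubar) a b)
    (hR : ‖E.sep r t₁‖ ∈ Icc Rm Rp) (hS : E.surf r θ t₁ = 0) (hx : 0 < E.tangVel r θ t₁) :
    ∀ t, t₁ ≤ t → ‖E.sep r t‖ ∈ Icc Rm Rp ∧ E.surf r θ t = 0 ∧ 0 < E.tangVel r θ t := by
  have hreg : E.RegPath r θ := ⟨h.toRegular, hp⟩
  intro t₂ ht₂
  refine forall_Icc_of_continuation (a := t₁) (b := t₂)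
    (p := fun t => ‖E.sep r t‖ ∈ Icc Rm Rp ∧ E.surf r θ t = 0 ∧ 0 < E.tangVel r θ t)
    ⟨hR, hS, hx⟩ ?_ ?_ t₂ ⟨ht₂, le_rfl⟩
  · rintro t htt₁ - hbefore
    have ht0 : 0 ≤ t := ht₁.trans htt₁.le
    have hRt : ‖E.sep r t‖ ∈ Icc Rm Rp :=
      mem_of_continuousWithinAt_right_end (K := Icc Rm Rp) isClosed_Icc ht₁ htt₁ (hreg.continuousOn_sep.norm t ht0)
        fun y hy => (hbefore y (Ioo_subset_Ico_self hy)).1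
    have h0 := h.sep_ne_zero hRt
    have hSt : E.surf r θ t = 0 :=
      mem_of_continuousWithinAt_right_end (K := {0}) isClosed_singleton ht₁ htt₁
        (hreg.continuousWithinAt_surf ht0 h0)
        fun y hy => (hbefore y (Ioo_subset_Ico_self hy)).2.1
    -- The limit preserves only `x ≥ 0`; strictness returns because `turn` forbids `x = 0` on the
    -- surface.
    have hxt : 0 ≤ E.tangVel r θ t :=
      mem_of_continuousWithinAt_right_end (K := Ici 0) isClosed_Ici ht₁ htt₁
        (hreg.continuousWithinAt_tangVel ht0 h0)
        fun y hy => (hbefore y (Ioo_subset_Ico_self hy)).2.2.le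
    exact ⟨hRt, hSt, lt_of_le_of_ne hxt (abs_pos.1 (h.turn r θ t ht0 hRt hSt).1).symm⟩
  · rintro t htt₁ - hupto
    obtain ⟨hRt, hSt, hxt⟩ := hupto t ⟨htt₁, le_rfl⟩
    have ht0 : 0 ≤ t := ht₁.trans htt₁
    obtain ⟨ε, hε, hnear, hmono⟩ := h.exists_strict_mono hp ht0 hRt hSt
    have habs : ∀ y ∈ Ico t (t + ε), |y - t| < ε := fun y hy => by
      rw [abs_of_nonneg (sub_nonneg.2 hy.1)]; linarith [hy.2]
    have hzero : ∀ y ∈ Ioo t (t + ε), E.surf r θ y = 0 := by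
      intro y hy
      by_contra hne
      obtain ⟨s, hs, hneg⟩ : ∃ s : ℝ, (s = 1 ∨ s = -1) ∧ s * E.surf r θ y < 0 := by
        rcases lt_or_gt_of_ne hne with h1 | h1
        · exact ⟨1, .inl rfl, by linarith⟩
        · exact ⟨-1, .inr rfl, by linarith⟩
      have hcont : ContinuousOn (E.surf r θ) (Icc t y) := fun x hx' =>
        (hreg.continuousWithinAt_surf (ht0.trans hx'.1) (hnear x (ht0.trans hx'.1)
          (habs x ⟨hx'.1, hx'.2.trans_lt hy.2⟩)).1).mono fun w hw => ht0.trans hw.1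
      -- From the last zero `p` before `y` the sign of `S` is constant, so the law holds the control
      -- extremal. Since `x > 0`, `s S` then increases from zero, which contradicts `s S(y) < 0`.
      obtain ⟨p, ⟨hp1, hp2⟩, hpmax⟩ : ∃ p, IsGreatest (Icc t y ∩ E.surf r θ ⁻¹' {0}) p := by
        refine IsCompact.exists_isGreatest ?_ ⟨t, left_mem_Icc.2 hy.1.le, hSt⟩
        exact isCompact_Icc.of_isClosed_subset
          (hcont.preimage_isClosed_of_isClosed isClosed_Icc isClosed_singleton) inter_subset_left
      have hp2' : E.surf r θ p = 0 := hp2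
      have hpy : p < y := lt_of_le_of_ne hp1.2 fun he => hne (he ▸ hp2')
      have hneg' : ∀ x ∈ Ioc p y, s * E.surf r θ x < 0 := by
        refine neg_of_ne_zero_of_neg_right
          ((hcont.mono (Icc_subset_Icc_left hp1.1)).const_smul s) (fun x hx' h0 => ?_) hneg
        have h1 : E.surf r θ x = 0 := by
          rcases hs with rfl | rfl <;> simpa using h0
        exact hx'.1.not_ge (hpmax ⟨⟨hp1.1.trans hx'.1.le, hx'.2⟩, h1⟩)
      have hturn : TurnsOn θ (s * ubar) p y := hlaw s p y hs (ht0.trans hp1.1) hpy fun x hx' =>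
        ⟨(hnear x (ht0.trans (hp1.1.trans hx'.1.le)) (habs x ⟨hp1.1.trans hx'.1.le,
          hx'.2.trans hy.2⟩)).1, hneg' x (Ioo_subset_Ioc_self hx')⟩
      have h1 := hmono p y s hs (ht0.trans hp1.1) hpy (habs p ⟨hp1.1, hpy.trans hy.2⟩)
        (habs y ⟨hy.1.le, hy.2⟩) hturn
      rw [hp2', mul_zero, sub_zero] at h1
      nlinarith
    refine ⟨ε, hε, fun y hy => ⟨?_, hzero y hy, ?_⟩⟩
    · refine h.norm_sep_mem_of_sliding hp ht₁ (htt₁.trans hy.1.le) hR fun x hx' => ?_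
      rcases le_or_gt x t with h1 | h1
      · exact ⟨h.sep_ne_zero (hupto x ⟨hx'.1, h1⟩).1, (hupto x ⟨hx'.1, h1⟩).2.1⟩
      · exact ⟨(hnear x (ht0.trans h1.le) (habs x ⟨h1.le, hx'.2.trans_lt hy.2⟩)).1,
          hzero x ⟨h1, hx'.2.trans_lt hy.2⟩⟩
    · exact pos_of_mul_pos_right (hnear y (ht0.trans hy.1.le) (habs y ⟨hy.1.le, hy.2⟩)).2 hxt.le

lemma tendsto_meas_of_sliding (h : E.Bounds ubar v₀ μ Rm Rp) (hp : E.IsPath r θ) {t₁ : ℝ}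
    (ht₁ : 0 ≤ t₁) (hslide : ∀ t, t₁ ≤ t → E.sep r t ≠ 0 ∧ E.surf r θ t = 0) :
    Tendsto (E.meas r) atTop (𝓝 E.d₀) := by
  have h1 := tendsto_zero_of_decay (z := fun t => E.meas r t - E.d₀) (a := t₁) h.γ_pos h.δ_pos
    fun t ht => (h.hasDerivWithinAt_deviation hp (ht₁.trans ht) (hslide t ht).1
      (hslide t ht).2).mono (Ici_subset_Ici.2 ht₁)
  simpa using h1.add_const E.d₀

/-- Every motion obeying the law and not sliding along the repelling part of the switching surface
reaches the attractive part and stays there. -/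
lemma exists_sliding_time (h : E.Bounds ubar v₀ μ Rm Rp) (hp : E.IsPath r θ)
    (hlaw : ∀ s a b, (s = 1 ∨ s = -1) → 0 ≤ a → a < b → E.Commands r θ s a b →
      TurnsOn θ (s * ubar) a b)
    (hstable : ∀ᵐ t ∂(volume.restrict (Ioi (0 : ℝ))), E.sep r t ≠ 0 → E.surf r θ t = 0 →
      0 ≤ E.tangVel r θ t)
    (hRm : Rm + turnRange E.v ubar v₀ ≤ ‖E.sep r 0‖)
    (hRp : ‖E.sep r 0‖ + turnRange E.v ubar v₀ ≤ Rp) :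
    ∃ t₁ ≥ 0, (∀ t ∈ Icc 0 t₁, E.sep r t ≠ 0) ∧
      ∀ t, t₁ ≤ t → E.sep r t ≠ 0 ∧ E.surf r θ t = 0 := by
  have hreg : E.RegPath r θ := ⟨h.toRegular, hp⟩
  have hL := h.turnRange_pos
  have hR0 : ‖E.sep r 0‖ ∈ Icc Rm Rp := ⟨by linarith, by linarith⟩
  have h0 := h.sep_ne_zero hR0
  have hmain : ∀ s : ℝ, (s = 1 ∨ s = -1) → (∃ ε > 0, E.Commands r θ s 0 ε) →
      ∃ t₁ ≥ 0, (∀ t ∈ Icc 0 t₁, E.sep r t ≠ 0) ∧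
        ∀ t, t₁ ≤ t → E.sep r t ≠ 0 ∧ E.surf r θ t = 0 := by
    intro s hs hstart
    obtain ⟨t₁, ht₁, -, -, hR, hS, hx⟩ := h.reach_surface hp hs
      (fun τ hτ hc => hlaw s 0 τ hs le_rfl hτ hc) hstart hRm hRp
    refine ⟨t₁, ht₁.le, fun t ht => h.sep_ne_zero (hR t ht), fun t ht => ?_⟩
    have h1 := h.stays_on_surface hp ht₁.le hlaw (hR t₁ (right_mem_Icc.2 ht₁.le)) hS hx t ht
    exact ⟨h.sep_ne_zero h1.1, h1.2.1⟩
  rcases eq_or_ne (E.surf r θ 0) 0 with hS | hS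
  · have hx := (h.turn r θ 0 le_rfl hR0 hS).1
    rcases lt_or_gt_of_ne (abs_pos.1 hx) with hx | hx
    · -- on the repelling part: the motion leaves the surface at once
      obtain ⟨ε, hε, hnear, hmono⟩ := h.exists_strict_mono hp le_rfl hR0 hS
      have hnear' : ∀ t ∈ Ioo 0 ε, E.sep r t ≠ 0 ∧ E.tangVel r θ t < 0 := fun t ht => by
        have h1 := hnear t ht.1.le (by simpa [abs_of_pos ht.1] using ht.2)
        exact ⟨h1.1, by by_contra! hcon; nlinarith [h1.2]⟩
      have hcont : ContinuousOn (E.surf r θ) (Ioo 0 ε) := fun t ht =>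
        (hreg.continuousWithinAt_surf ht.1.le (hnear' t ht).1).mono fun w hw => hw.1.le
      have hne : ∀ t ∈ Ioo 0 ε, E.surf r θ t ≠ 0 := by
        intro t ht hSt
        -- a time before `t` off the surface
        obtain ⟨y, hy, hSy⟩ : ∃ y ∈ Ioo 0 t, E.surf r θ y ≠ 0 := by
          by_contra! hcon
          have h1 : ∀ᵐ y ∂(volume.restrict (Ioo 0 t)), y ∈ Ioo 0 t ∧
              (E.sep r y ≠ 0 → E.surf r θ y = 0 → 0 ≤ E.tangVel r θ y) :=
            (ae_restrict_mem measurableSet_Ioo).and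
              (ae_restrict_of_ae_restrict_of_subset Ioo_subset_Ioi_self hstable)
          have h2 : ∀ᵐ y ∂(volume.restrict (Ioo 0 t)), False := by
            filter_upwards [h1] with y hy
            have h3 := hnear' y ⟨hy.1.1, hy.1.2.trans ht.2⟩
            exact h3.2.not_ge (hy.2 h3.1 (hcon y hy.1))
          rw [eventually_false_iff_eq_bot, ae_eq_bot, Measure.restrict_eq_zero] at h2
          simp [ht.1.not_ge] at h2
        obtain ⟨s, hs, hneg⟩ : ∃ s : ℝ, (s = 1 ∨ s = -1) ∧ s * E.surf r θ y < 0 := by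
          rcases lt_or_gt_of_ne hSy with h1 | h1
          · exact ⟨1, .inl rfl, by linarith⟩
          · exact ⟨-1, .inr rfl, by linarith⟩
        have hcont' : ContinuousOn (E.surf r θ) (Icc y t) :=
          hcont.mono fun x hx' => ⟨hy.1.trans_le hx'.1, hx'.2.trans_lt ht.2⟩
        -- Between `y` and the first later zero `p` the law holds the control extremal, and with `x
        -- < 0` this pushes `S` further from zero, so no return is possible.
        obtain ⟨p, ⟨hp1, hp2⟩, hpmin⟩ : ∃ p, IsLeast (Icc y t ∩ E.surf r θ ⁻¹' {0}) p := by
          refine IsCompact.exists_isLeast ?_ ⟨t, right_mem_Icc.2 hy.2.le, hSt⟩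
          exact isCompact_Icc.of_isClosed_subset
            (hcont'.preimage_isClosed_of_isClosed isClosed_Icc isClosed_singleton)
            inter_subset_left
        have hp2' : E.surf r θ p = 0 := hp2
        have hyp : y < p := lt_of_le_of_ne hp1.1 fun he => hSy (he ▸ hp2')
        have hneg' : ∀ x ∈ Ico y p, s * E.surf r θ x < 0 := by
          intro x hx'
          by_contra! hcon
          obtain ⟨q, hq, hSq⟩ := intermediate_value_Icc hx'.1
            ((hcont'.mono (Icc_subset_Icc_right (hx'.2.le.trans hp1.2))).const_smul s)
            ⟨hneg.le, hcon⟩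
          have h1 : E.surf r θ q = 0 := by rcases hs with rfl | rfl <;> simpa using hSq
          exact (hq.2.trans_lt hx'.2).not_ge
            (hpmin ⟨⟨hq.1, hq.2.trans (hx'.2.le.trans hp1.2)⟩, h1⟩)
        have hturn : TurnsOn θ (s * ubar) y p := hlaw s y p hs hy.1.le hyp fun x hx' =>
          ⟨(hnear' x ⟨hy.1.trans hx'.1, hx'.2.trans_le (hp1.2.trans ht.2.le)⟩).1,
            hneg' x (Ioo_subset_Ico_self hx')⟩
        have hyε : y < ε := hy.2.trans ht.2
        have hpε : p < ε := hp1.2.trans_lt ht.2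
        have h1 := hmono y p s hs hy.1.le hyp (by simpa [abs_of_pos hy.1] using hyε)
          (by simpa [abs_of_pos (hy.1.trans hyp)] using hpε) hturn
        rw [hp2', mul_zero, zero_sub] at h1
        nlinarith
      obtain ⟨s, hs, hneg⟩ : ∃ s : ℝ, (s = 1 ∨ s = -1) ∧ s * E.surf r θ (ε / 2) < 0 := by
        rcases lt_or_gt_of_ne (hne (ε / 2) ⟨by linarith, by linarith⟩) with h1 | h1
        · exact ⟨1, .inl rfl, by linarith⟩
        · exact ⟨-1, .inr rfl, by linarith⟩
      refine hmain s hs ⟨ε / 2, by linarith, fun t ht => ⟨(hnear' t ⟨ht.1, by linarith [ht.2]⟩).1, ?_⟩⟩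
      have hsub : Icc (t / 2) (ε / 2) ⊆ Ioo 0 ε := fun x hx' =>
        ⟨by linarith [ht.1, hx'.1], by linarith [hx'.2]⟩
      refine neg_of_ne_zero_of_neg_right ((hcont.mono hsub).const_smul s) (fun x hx' hzero => ?_)
        hneg t ⟨by linarith [ht.1], ht.2.le⟩
      refine hne x (hsub (Ioc_subset_Icc_self hx')) ?_
      rcases hs with rfl | rfl <;> simpa using hzero
    · have h1 := h.stays_on_surface hp le_rfl hlaw hR0 hS hx
      refine ⟨0, le_rfl, fun t ht => ?_, fun t ht => ⟨h.sep_ne_zero (h1 t ht).1, (h1 t ht).2.1⟩⟩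
      exact h.sep_ne_zero (h1 t ht.1).1
  · obtain ⟨s, hs, hneg⟩ : ∃ s : ℝ, (s = 1 ∨ s = -1) ∧ s * E.surf r θ 0 < 0 := by
      rcases lt_or_gt_of_ne hS with h1 | h1
      · exact ⟨1, .inl rfl, by linarith⟩
      · exact ⟨-1, .inr rfl, by linarith⟩
    have h2 : ∀ᶠ t in 𝓝 (0 : ℝ), t ∈ Ici 0 → E.sep r t ≠ 0 ∧ s * E.surf r θ t < 0 := by
      rw [← eventually_nhdsWithin_iff]
      exact (hreg.eventually_sep_ne_zero le_rfl h0).and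
        (((hreg.continuousWithinAt_surf le_rfl h0).const_mul s).eventually_lt
          continuousWithinAt_const hneg)
    obtain ⟨η, hη, hball⟩ := Metric.eventually_nhds_iff.1 h2
    exact hmain s hs ⟨η, hη, fun t ht =>
      hball (by simpa [Real.dist_eq, abs_of_pos ht.1] using ht.2) ht.1.le⟩

end Bounds

end Env

/-! ### Closed-loop motions as paths obeying the law -/

lemma intervalIntegrable_of_measurable_of_abs_le {u : ℝ → ℝ} {M a b : ℝ} (hu : Measurable u)
    (hM : ∀ t, 0 ≤ t → |u t| ≤ M) (ha : 0 ≤ a) (hb : 0 ≤ b) : IntervalIntegrable u volume a b := by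
  rw [intervalIntegrable_iff]
  refine Measure.integrableOn_of_bounded (M := M) (by simp) hu.aestronglyMeasurable ?_
  filter_upwards [ae_restrict_mem measurableSet_uIoc] with t ht
  exact hM t ((le_min ha hb).trans ht.1.le)

namespace IsClosedLoopMotion

variable {E : Env} {ubar θin : ℝ} {rin : Plane} {r : ℝ → Plane} {θ u : ℝ → ℝ}

lemma angle_sub {v d₀ γ δ : ℝ} {r₀ : ℝ → Plane} {D : ℝ → Plane → ℝ}
    (hm : IsClosedLoopMotion v ubar d₀ γ δ r₀ D rin θin r θ u) {a b : ℝ} (ha : 0 ≤ a) (hb : 0 ≤ b) :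
    θ b - θ a = ∫ t in a..b, u t := by
  have hI : ∀ {a b : ℝ}, 0 ≤ a → 0 ≤ b → IntervalIntegrable u volume a b := fun ha hb =>
    intervalIntegrable_of_measurable_of_abs_le hm.measurable_control hm.abs_control_le ha hb
  rw [hm.angle_eq a ha, hm.angle_eq b hb, add_sub_add_left_eq_sub,
    intervalIntegral.integral_interval_sub_left (hI le_rfl hb) (hI le_rfl ha)]

variable (hm : IsClosedLoopMotion E.v ubar E.d₀ E.γ E.δ E.r₀ (field E.c E.f E.r₀) rin θin r θ u)
include hm

lemma isPath : E.IsPath r θ := by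
  refine ⟨hm.position_deriv, ?_⟩
  have hlip : LipschitzOnWith (Real.toNNReal ubar) θ (Ici 0) := by
    have hu : 0 ≤ ubar := (abs_nonneg _).trans (hm.abs_control_le 0 le_rfl)
    refine LipschitzOnWith.of_dist_le_mul fun x hx y hy => ?_
    rw [Real.coe_toNNReal _ hu, Real.dist_eq, Real.dist_eq, hm.angle_sub hy hx]
    refine intervalIntegral.norm_integral_le_of_norm_le_const (f := u) fun t ht => ?_
    exact hm.abs_control_le t ((le_min hy hx).trans ht.1.le)
  exact hlip.continuousOn

/-- Off the surface the law determines `u` almost everywhere, and the angle sees `u` only through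
its integral. -/
lemma turnsOn_of_commands (hreg : E.Regular) {s a b : ℝ} (hs : s = 1 ∨ s = -1) (ha : 0 ≤ a)
    (hc : E.Commands r θ s a b) : TurnsOn θ (s * ubar) a b := by
  have hrp : E.RegPath r θ := ⟨hreg, hm.isPath⟩
  intro t ht
  have h1 := hm.angle_sub ha (ha.trans ht.1)
  have h2 : ∫ x in a..t, u x = ∫ _ in a..t, s * ubar := by
    refine intervalIntegral.integral_congr_ae ?_
    have hlaw := (ae_restrict_iff' measurableSet_Ioi).1 hm.law
    have hb : ∀ᵐ x : ℝ ∂volume, x ≠ b := by simp [ae_iff]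
    filter_upwards [hlaw, hb] with x hx hxb hxt
    rw [uIoc_of_le ht.1] at hxt
    have hx0 : 0 < x := ha.trans_lt hxt.1
    obtain ⟨h0, hneg⟩ := hc x ⟨hxt.1, lt_of_le_of_ne (hxt.2.trans ht.2) hxb⟩
    have hsw := hrp.switching_eq hx0 h0
    rw [hsw] at hx
    rcases hs with rfl | rfl
    · have h3 : E.surf r θ x < 0 := by linarith
      rw [hx hx0 (sub_ne_zero.1 h0) h3.ne, Real.sign_of_neg h3]; norm_num
    · have h3 : 0 < E.surf r θ x := by linarith
      rw [hx hx0 (sub_ne_zero.1 h0) h3.ne', Real.sign_of_pos h3]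
  rw [h2, intervalIntegral.integral_const, smul_eq_mul] at h1
  linarith

end IsClosedLoopMotion

namespace Env.RegPath

variable {E : Env} {r : ℝ → Plane} {θ : ℝ → ℝ}

/-- By `inner_gradient` the two quantities differ by the factor `-c f'/v`, which is positive. -/
lemma noUnstableSliding_iff (h : E.RegPath r θ) :
    NoUnstableSliding E.d₀ E.γ E.δ E.r₀ (field E.c E.f E.r₀) r θ ↔
      ∀ᵐ t ∂(volume.restrict (Ioi (0 : ℝ))), E.sep r t ≠ 0 → E.surf r θ t = 0 →
        0 ≤ E.tangVel r θ t := by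
  rw [NoUnstableSliding, ae_restrict_iff' measurableSet_Ioi, ae_restrict_iff' measurableSet_Ioi]
  refine eventually_congr (.of_forall fun t => ?_)
  refine forall_congr' fun ht => ?_
  have hne : r t ≠ E.r₀ t ↔ E.sep r t ≠ 0 := sub_ne_zero.symm
  rw [hne]
  refine forall_congr' fun h0 => ?_
  rw [h.switching_eq ht h0, h.inner_gradient h0]
  refine forall_congr' fun _ => ?_
  have hk : 0 < -(E.c * deriv E.f ‖E.sep r t‖ / E.v) := neg_pos.2 (div_neg_of_neg_of_pos
    (mul_neg_of_pos_of_neg h.c_pos (h.f_deriv_neg _ (norm_pos_iff.2 h0))) h.v_pos)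
  exact mul_nonneg_iff_of_pos_left hk

end Env.RegPath

/-- Every motion of the closed loop avoids the centre and reaches the desired isoline. -/
lemma Env.Bounds.motion_reaches_isoline {E : Env} {ubar v₀ μ Rm Rp θin : ℝ} {rin : Plane}
    {r : ℝ → Plane} {θ u : ℝ → ℝ} (h : E.Bounds ubar v₀ μ Rm Rp)
    (hRm : Rm + turnRange E.v ubar v₀ ≤ ‖rin - E.r₀ 0‖)
    (hRp : ‖rin - E.r₀ 0‖ + turnRange E.v ubar v₀ ≤ Rp)
    (hm : IsClosedLoopMotion E.v ubar E.d₀ E.γ E.δ E.r₀ (field E.c E.f E.r₀) rin θin r θ u)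
    (hn : NoUnstableSliding E.d₀ E.γ E.δ E.r₀ (field E.c E.f E.r₀) r θ) :
    (∀ t, 0 ≤ t → r t ≠ E.r₀ t) ∧
      Tendsto (fun t => field E.c E.f E.r₀ t (r t)) atTop (𝓝 E.d₀) := by
  have hp := hm.isPath
  rw [← hm.position_zero] at hRm hRp
  obtain ⟨t₁, ht₁, h1, h2⟩ := h.exists_sliding_time hp
    (fun s a b hs ha _ hc => hm.turnsOn_of_commands h.toRegular hs ha hc)
    ((RegPath.mk h.toRegular hp).noUnstableSliding_iff.1 hn) hRm hRp
  refine ⟨fun t ht => sub_ne_zero.1 ?_, h.tendsto_meas_of_sliding hp ht₁ h2⟩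
  rcases le_total t t₁ with h3 | h3
  · exact h1 t ⟨ht, h3⟩
  · exact (h2 t h3).1

/-! ### Tools for the existence of motions -/

/-- A bounded, uniformly Lipschitz scalar equation has a solution on the whole line. -/
lemma exists_global_solution {F : ℝ → ℝ → ℝ} {K L : NNReal} (hlip : ∀ t, LipschitzWith K (F t))
    (hcont : ∀ x, Continuous fun t => F t x) (hbound : ∀ t x, ‖F t x‖ ≤ L) (t₀ x₀ : ℝ) :
    ∃ x : ℝ → ℝ, x t₀ = x₀ ∧ ∀ t, HasDerivAt x (F t (x t)) t := by
  have hlocal : ∀ n : ℕ, ∃ x : ℝ → ℝ, x t₀ = x₀ ∧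
      ∀ t ∈ Icc (t₀ - (n + 1)) (t₀ + (n + 1)),
        HasDerivWithinAt x (F t (x t)) (Icc (t₀ - (n + 1)) (t₀ + (n + 1))) t := by
    intro n
    have hmem : t₀ ∈ Icc (t₀ - (n + 1 : ℝ)) (t₀ + (n + 1)) := by constructor <;> linarith
    -- With speed at most `L`, the ball of radius `L (n + 1)` cannot be left during time `n + 1`, so
    -- no smallness of the interval is needed.
    have hPL : IsPicardLindelof F (tmin := t₀ - (n + 1)) (tmax := t₀ + (n + 1)) ⟨t₀, hmem⟩ x₀
        (L * (n + 1)) 0 L K :=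
      { lipschitzOnWith := fun t _ => (hlip t).lipschitzOnWith
        continuousOn := fun y _ => (hcont y).continuousOn
        norm_le := fun t _ y _ => hbound t y
        mul_max_le := by simp }
    exact hPL.exists_eq_forall_mem_Icc_hasDerivWithinAt₀
  choose x hx0 hx using hlocal
  have hat : ∀ (n : ℕ) (t : ℝ), |t - t₀| < n + 1 → HasDerivAt (x n) (F t (x n t)) t := by
    intro n t ht
    rw [abs_lt] at ht
    exact (hx n t ⟨by linarith, by linarith⟩).hasDerivAt
      (Icc_mem_nhds (by linarith) (by linarith))
  have hagree : ∀ (m n : ℕ) (t : ℝ), |t - t₀| < m + 1 → |t - t₀| < n + 1 → x m t = x n t := by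
    intro m n t hm hn
    set M := min (m + 1 : ℝ) (n + 1) with hM
    have hM0 : 0 < M := lt_min (by positivity) (by positivity)
    have hin : ∀ y ∈ Ioo (t₀ - M) (t₀ + M), |y - t₀| < M := fun y hy =>
      abs_lt.2 ⟨by linarith [hy.1], by linarith [hy.2]⟩
    have ht := abs_lt.1 (lt_min hm hn)
    exact ODE_solution_unique_of_mem_Ioo (v := F) (s := fun _ => univ) (K := K) (t₀ := t₀)
      (a := t₀ - M) (b := t₀ + M)
      (fun t _ => (hlip t).lipschitzOnWith) ⟨by linarith, by linarith⟩
      (fun y hy => ⟨hat m y ((hin y hy).trans_le (min_le_left _ _)), mem_univ _⟩)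
      (fun y hy => ⟨hat n y ((hin y hy).trans_le (min_le_right _ _)), mem_univ _⟩)
      ((hx0 m).trans (hx0 n).symm) ⟨by linarith [ht.1], by linarith [ht.2]⟩
  -- The ceiling picks, for each time, a local solution whose open interval contains that time; by
  -- uniqueness the choice does not matter.
  refine ⟨fun t => x ⌈|t - t₀|⌉₊ t, by simpa using hx0 _, fun t => ?_⟩
  have hlt : ∀ y : ℝ, |y - t₀| < (⌈|y - t₀|⌉₊ : ℝ) + 1 := fun y =>
    (Nat.le_ceil _).trans_lt (lt_add_one _)
  have hev : (fun y => x ⌈|y - t₀|⌉₊ y) =ᶠ[𝓝 t] x ⌈|t - t₀|⌉₊ := by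
    have hopen : ∀ᶠ y in 𝓝 t, |y - t₀| < (⌈|t - t₀|⌉₊ : ℝ) + 1 :=
      (Continuous.tendsto (by fun_prop) t).eventually_lt_const (hlt t)
    filter_upwards [hopen] with y hy
    exact hagree _ _ y (hlt y) hy
  exact (hat _ t (hlt t)).congr_of_eventuallyEq hev

/-- Divide the increments by `|s - t|` and pass to the limit. This bounds `d̈` on the surface
without differentiating `χ`. -/
lemma abs_deriv_le_of_eventually_abs_sub_le {f g : ℝ → ℝ} {f' g' k t : ℝ}
    (hf : HasDerivAt f f' t) (hg : HasDerivAt g g' t)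
    (h : ∀ᶠ s in 𝓝 t, |f s - f t| ≤ k * |g s - g t|) : |f'| ≤ k * |g'| := by
  have h1 := (hasDerivAt_iff_tendsto_slope.1 hf).abs
  have h2 := (hasDerivAt_iff_tendsto_slope.1 hg).abs.const_mul k
  refine le_of_tendsto_of_tendsto h1 h2 ?_
  filter_upwards [nhdsWithin_le_nhds h] with s hs
  rw [slope_def_field, slope_def_field, abs_div, abs_div, ← mul_div_assoc]
  gcongr

/-- Differentiate within each of the two closed pieces and take the union; within a piece whose
closure misses the point, any value is a derivative. -/
lemma hasDerivWithinAt_glue {V : Type*} [NormedAddCommGroup V] [NormedSpace ℝ V]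
    {f g f' g' : ℝ → V} {t₁ : ℝ} (ht₁ : 0 ≤ t₁)
    (hf : ∀ t ∈ Icc 0 t₁, HasDerivWithinAt f (f' t) (Ici 0) t)
    (hg : ∀ t, t₁ ≤ t → HasDerivWithinAt g (g' t) (Ici t₁) t) (h : f t₁ = g t₁)
    (h' : f' t₁ = g' t₁) {t : ℝ} (ht : 0 ≤ t) :
    HasDerivWithinAt (fun t => if t ≤ t₁ then f t else g t) (if t ≤ t₁ then f' t else g' t)
      (Ici 0) t := by
  have hgeq : ∀ y, t₁ ≤ y → (if y ≤ t₁ then f y else g y) = g y := fun y hy => by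
    split_ifs with h1
    · rw [le_antisymm h1 hy, h]
    · rfl
  have hgeq' : t₁ ≤ t → (if t ≤ t₁ then f' t else g' t) = g' t := fun hy => by
    split_ifs with h1
    · rw [le_antisymm h1 hy, h']
    · rfl
  rw [← Icc_union_Ici_eq_Ici ht₁]
  refine HasDerivWithinAt.union ?_ ?_
  · rcases le_or_gt t t₁ with h1 | h1
    · rw [if_pos h1]
      exact ((hf t ⟨ht, h1⟩).mono Icc_subset_Ici_self).congr (fun y hy => if_pos hy.2) (if_pos h1)
    · exact HasFDerivWithinAt.of_notMem_closure (by
        rw [isClosed_Icc.closure_eq]; exact fun hm => hm.2.not_gt h1)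
  · rcases le_or_gt t₁ t with h1 | h1
    · rw [hgeq' h1]
      exact (hg t h1).congr (fun y hy => hgeq y hy) (hgeq t h1)
    · exact HasFDerivWithinAt.of_notMem_closure (by
        rw [isClosed_Ici.closure_eq]; exact fun hm => (not_le.2 h1) hm)

lemma continuousOn_glue {V : Type*} [TopologicalSpace V] {f g : ℝ → V} {t₁ : ℝ} (ht₁ : 0 ≤ t₁)
    (hf : ContinuousOn f (Icc 0 t₁)) (hg : ContinuousOn g (Ici t₁)) (h : f t₁ = g t₁) :
    ContinuousOn (fun t => if t ≤ t₁ then f t else g t) (Ici 0) := by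
  rw [← Icc_union_Ici_eq_Ici ht₁]
  refine ContinuousOn.union_of_isClosed (hf.congr fun y hy => if_pos hy.2)
    (hg.congr fun y hy => ?_) isClosed_Icc isClosed_Ici
  split_ifs with h1
  · rw [le_antisymm h1 hy, h]
  · rfl

/-- The level is attained at most once: between two such times the antitone `z²` would be constant,
yet its derivative `-2 z χ(z)` is negative there. These times are the only possible kinks of the
sliding heading. -/
lemma countable_abs_eq_of_decay {γ δ t₁ : ℝ} {z : ℝ → ℝ} (hγ : 0 < γ) (hδ : 0 < δ)
    (hz : ∀ t, HasDerivAt z (-chi γ δ (z t)) t) : {t | t₁ < t ∧ |z t| = δ}.Countable := by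
  refine Set.Subsingleton.countable ?_
  have key : ∀ a b : ℝ, a < b → |z a| = δ → |z b| = δ → False := by
    intro a b hab ha hb
    have hanti := antitoneOn_sq_of_decay (a := a) (b := b) hγ hδ fun t _ => (hz t).hasDerivWithinAt
    have ha2 : z a ^ 2 = δ ^ 2 := by rw [← sq_abs, ha]
    have hb2 : z b ^ 2 = δ ^ 2 := by rw [← sq_abs, hb]
    have hconst : ∀ t ∈ Icc a b, z t ^ 2 = δ ^ 2 := fun t ht => le_antisymm
      ((hanti (left_mem_Icc.2 hab.le) ht ht.1).trans_eq ha2)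
      (hb2.symm.le.trans (hanti ht (right_mem_Icc.2 hab.le) ht.2))
    have hm : (a + b) / 2 ∈ Ioo a b := ⟨by linarith, by linarith⟩
    have h1 : HasDerivAt (fun t => z t ^ 2) 0 ((a + b) / 2) :=
      (hasDerivAt_const ((a + b) / 2) (δ ^ 2)).congr_of_eventuallyEq
        ((Icc_mem_nhds hm.1 hm.2) |> fun hn => by filter_upwards [hn] with t ht using hconst t ht)
    have h2 := ((hz ((a + b) / 2)).pow 2).unique h1
    have h3 := hconst _ (Ioo_subset_Icc_self hm)
    have habs : |z ((a + b) / 2)| = δ := by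
      rw [← abs_of_pos hδ]; exact sq_eq_sq_iff_abs_eq_abs _ _ |>.1 h3
    have h4 := mul_chi_ge hγ.le hδ le_rfl habs.le
    rw [h3] at h4
    have h5 : 0 < γ * δ / δ * δ ^ 2 := by positivity
    simp only [Nat.cast_ofNat, Nat.add_one_sub_one, pow_one] at h2
    linarith
  intro a ha b hb
  rcases lt_trichotomy a b with h | h | h
  · exact (key a b h ha.2 hb.2).elim
  · exact h
  · exact (key b a h hb.2 ha.2).elim

lemma norm_heading_sub_le (a b : ℝ) : ‖heading a - heading b‖ ≤ |a - b| := by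
  have := convex_univ.norm_image_sub_le_of_norm_hasDerivWithin_le (f := heading)
    (f' := leftNormal) (C := 1) (fun x _ => (hasDerivAt_heading x).hasDerivWithinAt)
    (fun x _ => (norm_leftNormal x).le) (mem_univ b) (mem_univ a)
  simpa using this

lemma norm_leftNormal_sub_le (a b : ℝ) : ‖leftNormal a - leftNormal b‖ ≤ |a - b| := by
  have := convex_univ.norm_image_sub_le_of_norm_hasDerivWithin_le (f := leftNormal)
    (f' := fun x => -heading x) (C := 1) (fun x _ => (hasDerivAt_leftNormal x).hasDerivWithinAt)
    (fun x _ => by rw [norm_neg, norm_heading]) (mem_univ b) (mem_univ a)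
  simpa using this

lemma abs_inner_heading_le (w : Plane) (a : ℝ) : |inner ℝ w (heading a)| ≤ ‖w‖ := by
  simpa [norm_heading] using abs_real_inner_le_norm w (heading a)

lemma abs_inner_leftNormal_le (w : Plane) (a : ℝ) : |inner ℝ w (leftNormal a)| ≤ ‖w‖ := by
  simpa [norm_leftNormal] using abs_real_inner_le_norm w (leftNormal a)

lemma abs_sqrt_sub_sqrt_le {a b k : ℝ} (hk : 0 < k) (ha : k ^ 2 ≤ a) (hb : k ^ 2 ≤ b) :
    |√a - √b| ≤ |a - b| / (2 * k) := by
  have h1 : k ≤ √a := Real.le_sqrt_of_sq_le ha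
  have h2 : k ≤ √b := Real.le_sqrt_of_sq_le hb
  have h3 : a - b = (√a - √b) * (√a + √b) := by
    have := Real.sq_sqrt ((sq_nonneg k).trans ha)
    have := Real.sq_sqrt ((sq_nonneg k).trans hb)
    linarith
  rw [le_div_iff₀ (by positivity), h3, abs_mul, abs_of_pos (by linarith : 0 < √a + √b)]
  exact mul_le_mul_of_nonneg_left (by linarith) (abs_nonneg _)

lemma eq_inner_heading_add_inner_leftNormal (w : Plane) (a : ℝ) :
    w = inner ℝ w (heading a) • heading a + inner ℝ w (leftNormal a) • leftNormal a := by
  have h1 := Real.sin_sq_add_cos_sq a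
  rw [inner_eq, inner_eq]
  ext i
  fin_cases i
  · simp; linear_combination -w 0 * h1
  · simp; linear_combination -w 1 * h1

lemma heading_add (a b : ℝ) :
    heading (a + b) = Real.cos b • heading a + Real.sin b • leftNormal a := by
  ext i
  fin_cases i
  · simp [Real.cos_add]; ring
  · simp [Real.sin_add]; ring

/-- A left inverse of the profile is differentiable at the values of the profile. -/
lemma Env.Regular.hasDerivAt_of_leftInverse {E : Env} (h : E.Regular) {g : ℝ → ℝ}
    (hg : ∀ x, 0 < x → g (E.c * E.f x) = x) {x : ℝ} (hx : 0 < x) :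
    HasDerivAt g (E.c * deriv E.f x)⁻¹ (E.c * E.f x) := by
  have hne : E.c * deriv E.f x ≠ 0 := mul_ne_zero h.c_pos.ne' (h.f_deriv_neg x hx).ne
  have hs : HasStrictDerivAt (fun y => E.c * E.f y) (E.c * deriv E.f x) x := by
    have h1 := (h.f_contDiffOn.contDiffAt (Ioi_mem_nhds hx)).hasStrictDerivAt (by norm_num)
    exact h1.const_mul E.c
  have h2 := (hs.to_localInverse hne).hasDerivAt
  refine h2.congr_of_eventuallyEq ?_
  exact (hs.hasStrictFDerivAt_equiv hne).localInverse_unique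
    ((lt_mem_nhds hx).mono fun y hy => hg y hy)

/-! ### Construction of a sliding path -/

namespace Env

/-- The bearing equation of a sliding motion: `w`, `q` and `ρ` stand for the velocity of the centre,
the rate of the distance and the distance. -/
def bearingRate (v : ℝ) (w : ℝ → Plane) (q ρ : ℝ → ℝ) (t ψ : ℝ) : ℝ :=
  (√(v ^ 2 - (inner ℝ (w t) (heading ψ) + q t) ^ 2) - inner ℝ (w t) (leftNormal ψ)) / ρ t

/-- The radial velocity `⟨w, heading ψ⟩ + q` is at most `v₀ + μ < v` in modulus. The radicand
therefore stays above a positive constant, where the square root is Lipschitz, and the bearing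
equation is bounded and uniformly Lipschitz in `ψ`. -/
lemma exists_bearing {v v₀ μ Rm : ℝ} {w : ℝ → Plane} {q ρ : ℝ → ℝ} (hv₀ : 0 ≤ v₀) (hμ : 0 ≤ μ)
    (hv : v₀ + μ < v) (hRm : 0 < Rm) (hw : Continuous w) (hq : Continuous q) (hρ : Continuous ρ)
    (hwv : ∀ t, ‖w t‖ ≤ v₀) (hqμ : ∀ t, |q t| ≤ μ) (hρR : ∀ t, Rm ≤ ρ t) (t₁ ψ₁ : ℝ) :
    ∃ ψ : ℝ → ℝ, ψ t₁ = ψ₁ ∧ ∀ t, HasDerivAt ψ (bearingRate v w q ρ t (ψ t)) t := by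
  set k := √(v ^ 2 - (v₀ + μ) ^ 2) with hk
  have hkk : 0 < v ^ 2 - (v₀ + μ) ^ 2 := by nlinarith
  have hkpos : 0 < k := Real.sqrt_pos.2 hkk
  have hvpos : 0 < v := by linarith
  have hP : ∀ t ψ, |inner ℝ (w t) (heading ψ) + q t| ≤ v₀ + μ := fun t ψ =>
    (abs_add_le _ _).trans (add_le_add ((abs_inner_heading_le _ _).trans (hwv t)) (hqμ t))
  have hPk : ∀ t ψ, k ^ 2 ≤ v ^ 2 - (inner ℝ (w t) (heading ψ) + q t) ^ 2 := fun t ψ => by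
    rw [hk, Real.sq_sqrt hkk.le]
    have := sq_le_sq' (neg_le_of_abs_le (hP t ψ)) (le_of_abs_le (hP t ψ))
    linarith
  have hbound : ∀ t ψ, ‖bearingRate v w q ρ t ψ‖ ≤ (v + v₀) / Rm := fun t ψ => by
    have h0 := hRm.trans_le (hρR t)
    rw [bearingRate, Real.norm_eq_abs, abs_div, abs_of_pos h0]
    have h1 : |√(v ^ 2 - (inner ℝ (w t) (heading ψ) + q t) ^ 2)| ≤ v := by
      rw [abs_of_nonneg (Real.sqrt_nonneg _)]
      exact Real.sqrt_le_iff.2 ⟨hvpos.le, by nlinarith [sq_nonneg (inner ℝ (w t) (heading ψ) + q t)]⟩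
    have h2 := (abs_inner_leftNormal_le (w t) ψ).trans (hwv t)
    have h3 := (abs_sub _ _).trans (add_le_add h1 h2)
    exact div_le_div₀ (by linarith) h3 hRm (hρR t)
  have hlip : ∀ t, LipschitzWith (Real.toNNReal ((v / k * v₀ + v₀) / Rm))
      (bearingRate v w q ρ t) := fun t => by
    refine LipschitzWith.of_dist_le_mul fun a b => ?_
    rw [Real.coe_toNNReal _ (by positivity), Real.dist_eq, Real.dist_eq]
    have h0 := hRm.trans_le (hρR t)
    rw [bearingRate, bearingRate, ← sub_div, abs_div, abs_of_pos h0]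
    set A := inner ℝ (w t) (heading a) + q t with hA
    set B := inner ℝ (w t) (heading b) + q t with hB
    have h1 : |A - B| ≤ v₀ * |a - b| := by
      rw [hA, hB, add_sub_add_right_eq_sub, ← inner_sub_right]
      exact (abs_real_inner_le_norm _ _).trans
        (mul_le_mul (hwv t) (norm_heading_sub_le a b) (norm_nonneg _) hv₀)
    have h2 : |inner ℝ (w t) (leftNormal a) - inner ℝ (w t) (leftNormal b)| ≤ v₀ * |a - b| := by
      rw [← inner_sub_right]
      exact (abs_real_inner_le_norm _ _).trans
        (mul_le_mul (hwv t) (norm_leftNormal_sub_le a b) (norm_nonneg _) hv₀)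
    have h3 : |√(v ^ 2 - A ^ 2) - √(v ^ 2 - B ^ 2)| ≤ v / k * (v₀ * |a - b|) := by
      refine (abs_sqrt_sub_sqrt_le hkpos (hPk t a) (hPk t b)).trans ?_
      rw [show v ^ 2 - A ^ 2 - (v ^ 2 - B ^ 2) = -(A + B) * (A - B) by ring, abs_mul, abs_neg]
      have h4 : |A + B| ≤ 2 * v := (abs_add_le _ _).trans (by linarith [hP t a, hP t b])
      calc |A + B| * |A - B| / (2 * k) ≤ 2 * v * (v₀ * |a - b|) / (2 * k) := by gcongr
        _ = v / k * (v₀ * |a - b|) := by field_simp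
    have h5 : |√(v ^ 2 - A ^ 2) - inner ℝ (w t) (leftNormal a)
        - (√(v ^ 2 - B ^ 2) - inner ℝ (w t) (leftNormal b))| ≤ (v / k * v₀ + v₀) * |a - b| := by
      rw [sub_sub_sub_comm]
      refine (abs_sub _ _).trans ((add_le_add h3 h2).trans_eq (by ring))
    calc _ ≤ (v / k * v₀ + v₀) * |a - b| / Rm :=
          div_le_div₀ (by positivity) h5 hRm (hρR t)
      _ = (v / k * v₀ + v₀) / Rm * |a - b| := by ring
  refine exists_global_solution (L := Real.toNNReal ((v + v₀) / Rm)) hlip (fun x => ?_)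
    (fun t x => ?_) t₁ ψ₁
  · unfold bearingRate
    refine Continuous.div ?_ hρ fun t => (hRm.trans_le (hρR t)).ne'
    exact (((continuous_const.sub (((hw.inner continuous_const).add hq).pow 2)).sqrt).sub
      (hw.inner continuous_const))
  · rw [Real.coe_toNNReal _ (by positivity)]; exact hbound t x

namespace Bounds

variable {E : Env} {ubar v₀ μ Rm Rp : ℝ}

/-- Solutions of `z' = -χ(z)` are measurements along a distance function. -/
lemma exists_range (h : E.Bounds ubar v₀ μ Rm Rp) {ρ₁ : ℝ} (hρ₁ : ρ₁ ∈ Icc Rm Rp) (t₁ : ℝ) :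
    ∃ z ρ : ℝ → ℝ, (∀ t, HasDerivAt z (-chi E.γ E.δ (z t)) t) ∧ ρ t₁ = ρ₁ ∧
      ∀ t, t₁ ≤ t → ρ t ∈ Icc Rm Rp ∧ E.c * E.f (ρ t) - E.d₀ = z t ∧
        HasDerivAt ρ (-chi E.γ E.δ (z t) / (E.c * deriv E.f (ρ t))) t := by
  have hL : ∀ t x : ℝ, ‖-chi E.γ E.δ x‖ ≤ Real.toNNReal (E.γ * E.δ) := fun t x => by
    rw [norm_neg, Real.coe_toNNReal _ (mul_pos h.γ_pos h.δ_pos).le]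
    exact abs_chi_le h.γ_pos.le h.δ_pos.le x
  have hK : ∀ t : ℝ, LipschitzWith (Real.toNNReal E.γ) fun x => -chi E.γ E.δ x := fun t => by
    refine LipschitzWith.of_dist_le_mul fun x y => ?_
    rw [Real.coe_toNNReal _ h.γ_pos.le, dist_neg_neg, Real.dist_eq, Real.dist_eq]
    exact abs_chi_sub_le h.γ_pos.le h.δ_pos.le x y
  obtain ⟨z, hz1, hz⟩ := exists_global_solution (F := fun _ x => -chi E.γ E.δ x) hK
    (fun x => continuous_const) hL t₁ (E.c * E.f ρ₁ - E.d₀)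
  obtain ⟨R, hR, hRd⟩ := h.exists_target
  have hanti := strictAntiOn_profile h.toRegular
  have hρ₁0 : ρ₁ ∈ Ioi (0 : ℝ) := h.Rm_pos.trans_le hρ₁.1
  have hR0 : R ∈ Ioi (0 : ℝ) := h.Rm_pos.trans_le hR.1
  set F := fun x => E.c * E.f x with hF
  have hFc : ContinuousOn F (Ioi 0) := continuousOn_const.mul h.f_contDiffOn.continuousOn
  set g := Function.invFunOn F (Ioi 0) with hg
  have hgF : ∀ x, 0 < x → g (F x) = x := fun x hx =>
    hanti.injOn (Function.invFunOn_mem ⟨x, hx, rfl⟩) hx (Function.invFunOn_eq ⟨x, hx, rfl⟩)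
  have hzmem : ∀ t, t₁ ≤ t → z t ∈ uIcc 0 (F ρ₁ - E.d₀) := fun t ht => by
    have := mem_uIcc_of_decay (a := t₁) (b := t) h.γ_pos h.δ_pos
      (fun y _ => (hz y).hasDerivWithinAt) ht
    rwa [hz1] at this
  -- The value `d₀ + z` stays between the desired value and the initial one, both attained by the
  -- profile, so the intermediate value theorem applies.
  have hrange : ∀ t, t₁ ≤ t → ∃ x, 0 < x ∧ F x = E.d₀ + z t := fun t ht => by
    have h1 : E.d₀ + z t ∈ uIcc (F R) (F ρ₁) := by
      have := hzmem t ht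
      have hRd' : F R = E.d₀ := hRd
      rw [hRd']
      rw [mem_uIcc] at this ⊢
      rcases this with h2 | h2
      · left; constructor <;> linarith [h2.1, h2.2]
      · right; constructor <;> linarith [h2.1, h2.2]
    have hsub : uIcc R ρ₁ ⊆ Ioi 0 := fun x hx => (lt_min hR0 hρ₁0).trans_le hx.1
    obtain ⟨x, hx, hxe⟩ := intermediate_value_uIcc (hFc.mono hsub) h1
    exact ⟨x, hsub hx, hxe⟩
  refine ⟨z, fun t => g (E.d₀ + z t), hz, ?_, fun t ht => ?_⟩
  · simp only
    rw [hz1, add_sub_cancel]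
    exact hgF ρ₁ hρ₁0
  · obtain ⟨x, hx, hxz⟩ := hrange t ht
    have hxg : g (E.d₀ + z t) = x := by rw [← hxz, hgF x hx]
    have hzx : E.c * E.f x - E.d₀ = z t := by
      have : E.c * E.f x = E.d₀ + z t := hxz
      linarith
    simp only [hxg]
    refine ⟨h.mem_Icc_of_deviation_mem hρ₁ hx (by rw [hzx]; exact hzmem t ht), hzx, ?_⟩
    have h1 := h.hasDerivAt_of_leftInverse hgF hx
    rw [show E.c * E.f x = E.d₀ + z t from hxz] at h1
    have h2 : HasDerivAt (fun t => g (E.d₀ + z t))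
        ((E.c * deriv E.f x)⁻¹ * -chi E.γ E.δ (z t)) t :=
      HasDerivAt.comp (h := fun t => E.d₀ + z t) (h₂ := g) t h1 ((hz t).const_add E.d₀)
    exact h2.congr_deriv (by rw [div_eq_mul_inv, mul_comm])

/-- A sliding motion starting at a given point of the attractive part of the surface. -/
lemma exists_sliding_path (h : E.Bounds ubar v₀ μ Rm Rp) {r₁ : ℝ → Plane} {θ₁ : ℝ → ℝ} {t₁ : ℝ}
    (ht₁ : 0 ≤ t₁) (hR : ‖E.sep r₁ t₁‖ ∈ Icc Rm Rp) (hS : E.surf r₁ θ₁ t₁ = 0)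
    (hx : 0 < E.tangVel r₁ θ₁ t₁) :
    ∃ (p : ℝ → Plane) (θ : ℝ → ℝ), p t₁ = r₁ t₁ ∧ θ t₁ = θ₁ t₁ ∧
      (∀ t, t₁ ≤ t → HasDerivWithinAt p (E.v • heading (θ t)) (Ici t₁) t) ∧
      ContinuousOn θ (Ici t₁) ∧ {t | t₁ < t ∧ ¬ DifferentiableAt ℝ θ t}.Countable ∧
      ∀ t, t₁ ≤ t → ‖E.sep p t‖ ∈ Icc Rm Rp ∧ E.surf p θ t = 0 ∧ 0 < E.tangVel p θ t := by
  have hvp := h.v_pos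
  obtain ⟨z, ρ, hz, hρ1, hρ⟩ := h.exists_range hR t₁
  -- This is the rate of the distance forced by `S = 0`.
  set q : ℝ → ℝ := fun t => -chi E.γ E.δ (z t) / (E.c * deriv E.f (ρ t)) with hqdef
  have hρpos : ∀ t, t₁ ≤ t → 0 < ρ t := fun t ht => h.Rm_pos.trans_le (hρ t ht).1.1
  have hcf : ∀ t, t₁ ≤ t → E.c * deriv E.f (ρ t) < 0 := fun t ht =>
    mul_neg_of_pos_of_neg h.c_pos (h.f_deriv_neg _ (hρpos t ht))
  have hqμ : ∀ t, t₁ ≤ t → |q t| ≤ μ := fun t ht => by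
    rw [hqdef, abs_div, abs_neg, div_le_iff₀ (abs_pos.2 (hcf t ht).ne), abs_mul, abs_of_pos h.c_pos]
    exact (abs_chi_le h.γ_pos.le h.δ_pos.le _).trans (h.chi_le _ (hρ t ht).1)
  have hfρ : ∀ t, t₁ ≤ t → HasDerivAt (fun t => E.c * deriv E.f (ρ t))
      (E.c * (deriv (deriv E.f) (ρ t) * q t)) t := fun t ht =>
    ((h.hasDerivAt_deriv_f (hρpos t ht)).comp t (hρ t ht).2.2).const_mul E.c
  have hqc : ∀ t, t₁ ≤ t → ContinuousAt q t := fun t ht =>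
    (((continuous_chi h.δ_pos.le).continuousAt.comp (hz t).continuousAt).neg).div
      (hfρ t ht).continuousAt (hcf t ht).ne
  -- extension of the data to negative times
  have hmax : ∀ {X : Type} [TopologicalSpace X] (g : ℝ → X), ContinuousOn g (Ici t₁) →
      Continuous fun t => g (max t t₁) := fun g hg =>
    hg.comp_continuous (by fun_prop) fun t => le_max_right t t₁
  -- As `tangVel` is positive initially, the angle from the line of sight to the heading lies in
  -- `(0, π)` and is an arccosine. Subtracting it from the heading angle gives the initial bearing.
  obtain ⟨ψ, hψ1, hψ⟩ := exists_bearing (v := E.v) (w := fun t => E.centreVel (max t t₁))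
    (q := fun t => q (max t t₁)) (ρ := fun t => ρ (max t t₁)) h.v₀_nonneg h.μ_nonneg h.speed_lt
    h.Rm_pos (hmax _ (h.contDiffOn_centreVel.continuousOn.mono (Ici_subset_Ici.2 ht₁)))
    (hmax _ fun t ht => (hqc t ht).continuousWithinAt)
    (hmax _ fun t ht => (hρ t ht).2.2.continuousAt.continuousWithinAt)
    (fun t => h.centre_speed _ (ht₁.trans (le_max_right _ _))) (fun t => hqμ _ (le_max_right _ _))
    (fun t => (hρ _ (le_max_right _ _)).1.1) t₁
    (θ₁ t₁ - Real.arccos (inner ℝ (E.sep r₁ t₁) (heading (θ₁ t₁)) / ‖E.sep r₁ t₁‖))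
  set P : ℝ → ℝ := fun t => inner ℝ (E.centreVel t) (heading (ψ t)) + q t with hP
  have hψ' : ∀ t, t₁ ≤ t → HasDerivAt ψ
      ((√(E.v ^ 2 - P t ^ 2) - inner ℝ (E.centreVel t) (leftNormal (ψ t))) / ρ t) t :=
    fun t ht => by
      have := hψ t
      rwa [bearingRate, max_eq_left ht] at this
  have hPv : ∀ t, t₁ ≤ t → |P t| < E.v := fun t ht =>
    ((abs_add_le _ _).trans (add_le_add ((abs_inner_heading_le _ _).trans
      (h.centre_speed t (ht₁.trans ht))) (hqμ t ht))).trans_lt h.speed_lt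
  have hPv1 : ∀ t, t₁ ≤ t → -1 < P t / E.v ∧ P t / E.v < 1 := fun t ht => by
    rw [← abs_lt, abs_div, abs_of_pos hvp, div_lt_one hvp]; exact hPv t ht
  have hcos : ∀ t, t₁ ≤ t → Real.cos (Real.arccos (P t / E.v)) = P t / E.v := fun t ht =>
    Real.cos_arccos (hPv1 t ht).1.le (hPv1 t ht).2.le
  have hsin : ∀ t, t₁ ≤ t → E.v * Real.sin (Real.arccos (P t / E.v)) = √(E.v ^ 2 - P t ^ 2) :=
    fun t ht => by
      rw [Real.sin_arccos]
      conv_lhs => rw [← Real.sqrt_sq hvp.le]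
      rw [← Real.sqrt_mul (sq_nonneg _), Real.sqrt_sq hvp.le]
      congr 1; field_simp
  have hspos : ∀ t, t₁ ≤ t → 0 < √(E.v ^ 2 - P t ^ 2) := fun t ht => by
    refine Real.sqrt_pos.2 (sub_pos.2 (sq_lt_sq.2 ?_))
    rw [abs_of_pos hvp]; exact hPv t ht
  -- initial values
  have hN1 := norm_pos_iff.2 (h.sep_ne_zero hR)
  set N := E.sep r₁ t₁ with hN
  set e := heading (θ₁ t₁) with he
  set α := Real.arccos (inner ℝ N e / ‖N‖) with hα
  have hsq := inner_sq_add_cross_sq N e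
  rw [he, norm_heading, ← he, one_pow, mul_one] at hsq
  have hcross : 0 < cross N e := by
    rw [tangVel, div_pos_iff_of_pos_right hN1] at hx
    exact pos_of_mul_pos_right hx hvp.le
  have hle : |inner ℝ N e / ‖N‖| ≤ 1 := by
    rw [abs_div, abs_norm, div_le_one hN1, ← abs_norm, ← sq_le_sq]
    nlinarith [sq_nonneg (cross N e)]
  have hcosα : Real.cos α = inner ℝ N e / ‖N‖ :=
    Real.cos_arccos (abs_le.1 hle).1 (abs_le.1 hle).2
  have hsinα : Real.sin α = cross N e / ‖N‖ := by
    rw [hα, Real.sin_arccos, show 1 - (inner ℝ N e / ‖N‖) ^ 2 = (cross N e / ‖N‖) ^ 2 by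
      field_simp; linarith, Real.sqrt_sq (by positivity)]
  have hn : ‖N‖ • heading (ψ t₁) = N := by
    rw [hψ1, sub_eq_add_neg, heading_add, Real.cos_neg, Real.sin_neg, hcosα, hsinα, smul_add,
      smul_smul, smul_smul, mul_neg, mul_div_cancel₀ _ hN1.ne', mul_div_cancel₀ _ hN1.ne']
    conv_rhs => rw [eq_inner_heading_add_inner_leftNormal N (θ₁ t₁), inner_leftNormal]
  have hα1 : inner ℝ N e / ‖N‖ = P t₁ / E.v := by
    have h1 : E.rangeRate r₁ θ₁ t₁ = q t₁ := by
      have h2 := (hρ t₁ le_rfl).2.1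
      rw [hρ1] at h2
      rw [surf, measRate, meas, h2] at hS
      rw [hqdef]
      simp only
      rw [hρ1, eq_div_iff (by have := (hcf t₁ le_rfl).ne; rwa [hρ1] at this)]
      linarith
    rw [hP]
    simp only
    rw [← h1, rangeRate, relVel, ← hN, inner_sub_right, inner_smul_right]
    have h3 : inner ℝ N (E.centreVel t₁) = ‖N‖ * inner ℝ (E.centreVel t₁) (heading (ψ t₁)) := by
      conv_lhs => rw [← hn]
      rw [inner_smul_left, real_inner_comm]; simp
    rw [h3]
    field_simp
    ring
  -- The robot's velocity must have radial component `P` and length `v`. The arccosine chooses the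
  -- positive transversal component `√(v² - P²)`, that is, the attractive part of the surface.
  refine ⟨fun t => E.r₀ t + ρ t • heading (ψ t), fun t => ψ t + Real.arccos (P t / E.v),
    ?_, ?_, fun t ht => ?_, fun t ht => ?_, ?_, fun t ht => ?_⟩
  · simp only
    rw [hρ1, hn, hN, sep]; abel
  · simp only
    rw [hψ1, ← hα1]; ring
  · have h1 := (((h.hasDerivWithinAt_centre (ht₁.trans ht)).mono (Ici_subset_Ici.2 ht₁))).add
      ((hρ t ht).2.2.hasDerivWithinAt.smul
        (((hasDerivAt_heading (ψ t)).scomp t (hψ' t ht)).hasDerivWithinAt (s := Ici t₁)))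
    refine h1.congr_deriv ?_
    have h2 : E.v * Real.cos (Real.arccos (P t / E.v)) = P t := by
      rw [hcos t ht]; field_simp
    have h3 : E.v • heading (ψ t + Real.arccos (P t / E.v))
        = P t • heading (ψ t) + √(E.v ^ 2 - P t ^ 2) • leftNormal (ψ t) := by
      rw [heading_add, smul_add, smul_smul, smul_smul, h2, hsin t ht]
    rw [h3, smul_smul, mul_div_cancel₀ _ (hρpos t ht).ne']
    rw [hP]
    simp only [Function.comp_apply]
    nth_rewrite 1 [eq_inner_heading_add_inner_leftNormal (E.centreVel t) (ψ t)]
    module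
  · refine ContinuousWithinAt.add (hψ t).continuousAt.continuousWithinAt ?_
    refine Real.continuous_arccos.continuousAt.comp_continuousWithinAt ?_
    exact ((((h.hasDerivWithinAt_centreVel (ht₁.trans ht)).continuousWithinAt.mono
      (Ici_subset_Ici.2 ht₁)).inner (𝕜 := ℝ) (continuous_heading.continuousAt.comp
      (hψ t).continuousAt).continuousWithinAt).add (hqc t ht).continuousWithinAt).div_const _
  -- The heading can fail to be differentiable only where `χ` has a kink along `z`.
  · refine (countable_abs_eq_of_decay (t₁ := t₁) h.γ_pos h.δ_pos hz).mono ?_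
    rintro t ⟨ht1, ht2⟩
    refine ⟨ht1, ?_⟩
    by_contra hne
    refine ht2 ((hψ t).differentiableAt.add ?_)
    have h0 : t₁ ≤ t := le_of_lt ht1
    have h1 : DifferentiableAt ℝ q t :=
      (((differentiableAt_chi h.δ_pos hne).comp t (hz t).differentiableAt).neg).div
        (hfρ t h0).differentiableAt (hcf t h0).ne
    have h2 : DifferentiableAt ℝ E.centreVel t :=
      ((h.hasDerivWithinAt_centreVel (ht₁.trans h0)).hasDerivAt
        (Ici_mem_nhds (ht₁.trans_lt ht1))).differentiableAt
    have h3 : DifferentiableAt ℝ P t :=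
      (h2.inner ℝ ((hasDerivAt_heading (ψ t)).differentiableAt.comp t
        (hψ t).differentiableAt)).add h1
    exact DifferentiableAt.comp (g := Real.arccos) (f := fun t => P t / E.v) t
      (Real.differentiableAt_arccos.2 ⟨(hPv1 t h0).1.ne', (hPv1 t h0).2.ne⟩) (h3.div_const E.v)
  · set p : ℝ → Plane := fun t => E.r₀ t + ρ t • heading (ψ t) with hp
    set θ : ℝ → ℝ := fun t => ψ t + Real.arccos (P t / E.v) with hθ
    have hρt := hρpos t ht
    have hsep : E.sep p t = ρ t • heading (ψ t) := by rw [sep, hp]; simp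
    have hnorm : ‖E.sep p t‖ = ρ t := by
      rw [hsep, norm_smul, norm_heading, mul_one, Real.norm_eq_abs, abs_of_pos hρt]
    have hin : inner ℝ (heading (ψ t)) (heading (θ t)) = P t / E.v := by
      rw [real_inner_comm, inner_heading_heading, hθ]
      simp only [add_sub_cancel_left]
      exact hcos t ht
    have hcr : cross (heading (ψ t)) (heading (θ t)) = Real.sin (Real.arccos (P t / E.v)) := by
      have : Real.arccos (P t / E.v) = θ t - ψ t := by rw [hθ]; ring
      rw [this, Real.sin_sub, cross]
      simp; ring
    refine ⟨hnorm ▸ (hρ t ht).1, ?_, ?_⟩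
    · have hG : E.rangeRate p θ t = q t := by
        rw [rangeRate, hnorm, hsep, relVel, inner_smul_left, inner_sub_right, inner_smul_right, hin,
          real_inner_comm, hP]
        simp only [conj_trivial]
        field_simp
        ring
      rw [surf, measRate, meas, hG, hnorm, (hρ t ht).2.1, hqdef]
      simp only
      rw [mul_div_cancel₀ _ (hcf t ht).ne]; ring
    · have hcm : cross (ρ t • heading (ψ t)) (heading (θ t))
          = ρ t * cross (heading (ψ t)) (heading (θ t)) := by
        simp [cross]; ring
      rw [tangVel, hnorm, hsep, hcm, hcr, show E.v * (ρ t * Real.sin (Real.arccos (P t / E.v)))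
        = ρ t * (E.v * Real.sin (Real.arccos (P t / E.v))) by ring, hsin t ht]
      have := hspos t ht
      positivity

end Bounds

end Env

/-! ### Motions assembled from an arc and a sliding path -/

namespace Env

variable {E : Env} {ubar v₀ μ Rm Rp : ℝ}

section Congr

variable {r r' : ℝ → Plane} {θ θ' : ℝ → ℝ} {t : ℝ}

lemma sep_congr (hr : r t = r' t) : E.sep r t = E.sep r' t := by rw [sep, sep, hr]

lemma surf_congr (hr : r t = r' t) (hθ : θ t = θ' t) : E.surf r θ t = E.surf r' θ' t := by
  simp only [surf, measRate, meas, rangeRate, relVel, sep, hr, hθ]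

lemma tangVel_congr (hr : r t = r' t) (hθ : θ t = θ' t) :
    E.tangVel r θ t = E.tangVel r' θ' t := by
  simp only [tangVel, sep, hr, hθ]

end Congr

/-- The path of a robot with a given continuous orientation. -/
lemma exists_path (v : ℝ) {θ : ℝ → ℝ} (hθ : Continuous θ) (x : Plane) :
    ∃ r : ℝ → Plane, r 0 = x ∧ ∀ t, HasDerivAt r (v • heading (θ t)) t := by
  have hc : Continuous fun t => v • heading (θ t) := (continuous_heading.comp hθ).const_smul v
  exact ⟨fun t => x + ∫ s in (0 : ℝ)..t, v • heading (θ s), by simp,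
    fun t => (hc.integral_hasStrictDerivAt 0 t).hasDerivAt.const_add x⟩

namespace Bounds

/-- A path on the switching surface turns slower than the bound on the control. -/
lemma abs_turn_lt (h : E.Bounds ubar v₀ μ Rm Rp) {r : ℝ → Plane} {θ : ℝ → ℝ} (hp : E.IsPath r θ)
    {t₁ t u : ℝ} (ht₁ : 0 ≤ t₁) (ht : t₁ < t) (hR : ‖E.sep r t‖ ∈ Icc Rm Rp)
    (hS : ∀ y, t₁ < y → E.surf r θ y = 0) (hu : HasDerivAt θ u t) : |u| < ubar := by
  have hreg : E.RegPath r θ := ⟨h.toRegular, hp⟩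
  have ht0 : 0 < t := ht₁.trans_lt ht
  have h0 := h.sep_ne_zero hR
  have hN := norm_pos_iff.2 h0
  obtain ⟨h1, h2⟩ := h.turn r θ t ht0.le hR (hS t ht)
  have hd1 : HasDerivAt (E.measRate r θ) (E.measAcc r θ u t) t :=
    (hreg.hasDerivWithinAt_measRate Subset.rfl ht0.le h0 hu.hasDerivWithinAt).hasDerivAt
      (Ici_mem_nhds ht0)
  have hd2 : HasDerivAt (E.meas r) (E.measRate r θ t) t :=
    (hreg.hasDerivWithinAt_meas ht0.le h0).hasDerivAt (Ici_mem_nhds ht0)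
  -- On the surface `ḋ = -χ(d - d₀)`, so increments of `ḋ` are at most `γ` times those of `d`.
  -- Solving the resulting bound on `d̈` for the control term and comparing it with `turn` gives
  -- `|u| |x| < ubar |x|`.
  have h3 : |E.measAcc r θ u t| ≤ E.γ * |E.measRate r θ t| := by
    refine abs_deriv_le_of_eventually_abs_sub_le hd1 hd2 ?_
    filter_upwards [lt_mem_nhds ht] with y hy
    have e1 := hS y hy
    have e2 := hS t ht
    rw [surf] at e1 e2
    rw [eq_neg_of_add_eq_zero_left e1, eq_neg_of_add_eq_zero_left e2, neg_sub_neg, abs_sub_comm]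
    refine (abs_chi_sub_le h.γ_pos.le h.δ_pos.le _ _).trans_eq ?_
    rw [sub_sub_sub_cancel_right]
  have hneg := h.f_deriv_neg _ hN
  rw [measAcc, measRate] at h3
  set x := E.tangVel r θ t
  set F := deriv E.f ‖E.sep r t‖ with hF
  set F' := deriv (deriv E.f) ‖E.sep r t‖ with hF'
  set G := E.rangeRate r θ t with hG
  set b := E.drift r θ t with hb
  rw [abs_mul, abs_mul, abs_mul, abs_of_pos h.c_pos, ← mul_assoc, mul_comm E.γ, mul_assoc,
    mul_assoc, mul_le_mul_iff_right₀ h.c_pos] at h3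
  have hF0 : 0 < |F| := abs_pos.2 hneg.ne
  have e1 : |F * (u * x)| ≤ |F' * G ^ 2 + F * (b - u * x)| + |F' * G ^ 2| + |F * b| := by
    have : F * (u * x) = -(F' * G ^ 2 + F * (b - u * x)) + F' * G ^ 2 + F * b := by ring
    calc |F * (u * x)| = |-(F' * G ^ 2 + F * (b - u * x)) + F' * G ^ 2 + F * b| := by rw [← this]
      _ ≤ _ := (abs_add_three _ _ _).trans_eq (by rw [abs_neg])
  rw [abs_mul F b, abs_mul F (u * x), abs_mul u, abs_mul F', abs_of_nonneg (sq_nonneg G)] at e1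
  have e2 := mul_lt_mul_of_pos_left h2 hF0
  have e3 : |F| * (|b| + E.γ * |G| + |F'| / |F| * G ^ 2)
      = |F| * |b| + |F| * (E.γ * |G|) + |F'| * G ^ 2 := by field_simp
  rw [e3] at e2
  have e4 : |F| * (|u| * |x|) < |F| * (ubar * |x|) := by nlinarith
  exact lt_of_mul_lt_mul_right (lt_of_mul_lt_mul_left e4 hF0.le) h1.le

/-- A path that obeys the law up to its arrival at the attractive part of the switching surface extends
to a motion of the closed loop. -/
lemma exists_motion_of_arrival (h : E.Bounds ubar v₀ μ Rm Rp) {r₁ : ℝ → Plane} {θ₁ : ℝ → ℝ}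
    {s θin t₁ : ℝ} (hp₁ : E.IsPath r₁ θ₁) (hs : s = 1 ∨ s = -1)
    (hθ₁ : ∀ t, θ₁ t = θin + s * ubar * t) (ht₁ : 0 ≤ t₁) (hc : E.Commands r₁ θ₁ s 0 t₁)
    (hR : ‖E.sep r₁ t₁‖ ∈ Icc Rm Rp) (hS : E.surf r₁ θ₁ t₁ = 0) (hx : 0 < E.tangVel r₁ θ₁ t₁) :
    ∃ (r : ℝ → Plane) (θ u : ℝ → ℝ),
      IsClosedLoopMotion E.v ubar E.d₀ E.γ E.δ E.r₀ (field E.c E.f E.r₀) (r₁ 0) θin r θ u ∧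
      NoUnstableSliding E.d₀ E.γ E.δ E.r₀ (field E.c E.f E.r₀) r θ := by
  obtain ⟨p, θ₂, hp1, hθ1, hpd, hθc, hθd, hslide⟩ := h.exists_sliding_path ht₁ hR hS hx
  set r : ℝ → Plane := fun t => if t ≤ t₁ then r₁ t else p t with hr
  set θ : ℝ → ℝ := fun t => if t ≤ t₁ then θ₁ t else θ₂ t with hθ
  set u : ℝ → ℝ := fun t => if t ≤ t₁ then s * ubar else deriv θ₂ t with hu
  have hrle : ∀ t, t ≤ t₁ → r t = r₁ t := fun t ht => if_pos ht
  have hθle : ∀ t, t ≤ t₁ → θ t = θ₁ t := fun t ht => if_pos ht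
  have hrge : ∀ t, t₁ ≤ t → r t = p t := fun t ht => by
    rcases ht.eq_or_lt with h1 | h1
    · rw [← h1, hrle t₁ le_rfl, hp1]
    · exact if_neg h1.not_ge
  have hθge : ∀ t, t₁ ≤ t → θ t = θ₂ t := fun t ht => by
    rcases ht.eq_or_lt with h1 | h1
    · rw [← h1, hθle t₁ le_rfl, hθ1]
    · exact if_neg h1.not_ge
  have hθ₁c : Continuous θ₁ := by
    rw [funext hθ₁]; fun_prop
  have hpath : E.IsPath r θ := by
    refine ⟨fun t ht => ?_, continuousOn_glue ht₁ hθ₁c.continuousOn hθc hθ1.symm⟩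
    have := hasDerivWithinAt_glue (f' := fun t => E.v • heading (θ₁ t))
      (g' := fun t => E.v • heading (θ₂ t)) ht₁ (fun t ht => hp₁.position_deriv t ht.1) hpd
      hp1.symm (by simp only [hθ1]) ht
    refine this.congr_deriv ?_
    simp only [hθ]
    split_ifs <;> rfl
  have hreg : E.RegPath r θ := ⟨h.toRegular, hpath⟩
  have hslide' : ∀ t, t₁ ≤ t → ‖E.sep r t‖ ∈ Icc Rm Rp ∧ E.surf r θ t = 0 ∧
      0 < E.tangVel r θ t := fun t ht => by
    rw [sep_congr (hrge t ht), surf_congr (hrge t ht) (hθge t ht),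
      tangVel_congr (hrge t ht) (hθge t ht)]
    exact hslide t ht
  have hcom : ∀ t ∈ Ioo 0 t₁, E.sep r t ≠ 0 ∧ s * E.surf r θ t < 0 := fun t ht => by
    rw [sep_congr (hrle t ht.2.le), surf_congr (hrle t ht.2.le) (hθle t ht.2.le)]
    exact hc t ht
  have hu_le : ∀ t, |u t| ≤ ubar := fun t => by
    by_cases h1 : t ≤ t₁
    · rw [hu]
      simp only [if_pos h1]
      rcases hs with rfl | rfl <;> simp [abs_of_pos h.ubar_pos]
    · rw [hu]
      simp only [if_neg h1]
      rw [not_le] at h1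
      by_cases h2 : DifferentiableAt ℝ θ₂ t
      · have hev : θ =ᶠ[𝓝 t] θ₂ := by
          filter_upwards [lt_mem_nhds h1] with y hy using hθge y hy.le
        exact (h.abs_turn_lt hpath ht₁ h1 (hslide' t h1.le).1 (fun y hy => (hslide' y hy.le).2.1)
          (h2.hasDerivAt.congr_of_eventuallyEq hev)).le
      -- At a kink of the heading the default value zero of `deriv` is an admissible control.
      · rw [deriv_zero_of_not_differentiableAt h2, abs_zero]; exact h.ubar_pos.le
  have hu_meas : Measurable u :=
    Measurable.ite measurableSet_Iic measurable_const (measurable_deriv θ₂)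
  have hint : ∀ {a b : ℝ}, 0 ≤ a → 0 ≤ b → IntervalIntegrable u volume a b := fun ha hb =>
    intervalIntegrable_of_measurable_of_abs_le hu_meas (fun t _ => hu_le t) ha hb
  have hint1 : ∀ t, 0 ≤ t → t ≤ t₁ → ∫ y in (0 : ℝ)..t, u y = s * ubar * t := fun t ht ht' => by
    have : ∫ y in (0 : ℝ)..t, u y = ∫ _ in (0 : ℝ)..t, s * ubar := by
      refine intervalIntegral.integral_congr fun y hy => ?_
      rw [uIcc_of_le ht] at hy
      exact if_pos (hy.2.trans ht')
    rw [this, intervalIntegral.integral_const, smul_eq_mul]; ring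
  -- The fundamental theorem of calculus tolerates the countably many kinks because `θ₂` is
  -- continuous.
  have hint2 : ∀ t, t₁ ≤ t → ∫ y in t₁..t, u y = θ₂ t - θ₂ t₁ := fun t ht => by
    refine integral_eq_of_hasDerivAt_off_countable_of_le θ₂ u ht hθd
      (hθc.mono Icc_subset_Ici_self) (fun y hy => ?_) (hint ht₁ (ht₁.trans ht))
    have h1 : t₁ < y := hy.1.1
    have h2 : DifferentiableAt ℝ θ₂ y := by
      by_contra hcon
      exact hy.2 ⟨h1, hcon⟩
    rw [hu]
    simp only [if_neg h1.not_ge]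
    exact h2.hasDerivAt
  refine ⟨r, θ, u, ⟨hu_meas, fun t _ => hu_le t, hrle 0 ht₁, hpath.position_deriv, fun t ht => ?_,
    (ae_restrict_iff' measurableSet_Ioi).2 (.of_forall fun t ht hne hsw => ?_)⟩,
    hreg.noUnstableSliding_iff.2 ((ae_restrict_iff' measurableSet_Ioi).2
      (.of_forall fun t ht _ hsurf => ?_))⟩
  · rcases le_or_gt t t₁ with h1 | h1
    · rw [hint1 t ht h1, hθle t h1, hθ₁]
    · rw [← intervalIntegral.integral_add_adjacent_intervals (hint le_rfl ht₁) (hint ht₁ ht),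
        hint1 t₁ ht₁ le_rfl, hint2 t h1.le, hθge t h1.le, hθ1, hθ₁ t₁]; ring
  · have ht' : 0 < t := ht
    rw [hreg.switching_eq ht' (sub_ne_zero.2 hne)] at hsw ⊢
    rcases lt_or_ge t t₁ with h1 | h1
    · have h2 := (hcom t ⟨ht', h1⟩).2
      rw [show u t = s * ubar from if_pos h1.le]
      rcases hs with rfl | rfl
      · rw [Real.sign_of_neg (by linarith)]; ring
      · rw [Real.sign_of_pos (by linarith)]
    · exact absurd (hslide' t h1).2.1 hsw
  · rcases lt_or_ge t t₁ with h1 | h1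
    · have h2 := (hcom t ⟨ht, h1⟩).2
      rw [hsurf, mul_zero] at h2
      exact (lt_irrefl _ h2).elim
    · exact (hslide' t h1).2.2.le

/-- The closed loop has a motion that does not slide along the repelling part of the surface. -/
lemma exists_motion (h : E.Bounds ubar v₀ μ Rm Rp) (rin : Plane) (θin : ℝ)
    (hRm : Rm + turnRange E.v ubar v₀ ≤ ‖rin - E.r₀ 0‖)
    (hRp : ‖rin - E.r₀ 0‖ + turnRange E.v ubar v₀ ≤ Rp) :
    ∃ (r : ℝ → Plane) (θ u : ℝ → ℝ),
      IsClosedLoopMotion E.v ubar E.d₀ E.γ E.δ E.r₀ (field E.c E.f E.r₀) rin θin r θ u ∧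
      NoUnstableSliding E.d₀ E.γ E.δ E.r₀ (field E.c E.f E.r₀) r θ := by
  have hpaths : ∀ s : ℝ, ∃ r : ℝ → Plane, r 0 = rin ∧
      E.IsPath r fun t => θin + s * ubar * t := fun s => by
    have hc : Continuous fun t => θin + s * ubar * t := by fun_prop
    obtain ⟨r, hr0, hr⟩ := exists_path E.v hc rin
    exact ⟨r, hr0, fun t _ => (hr t).hasDerivWithinAt, hc.continuousOn⟩
  have hL := h.turnRange_pos
  have hmain : ∀ (s : ℝ) (r : ℝ → Plane), (s = 1 ∨ s = -1) → r 0 = rin →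
      E.IsPath r (fun t => θin + s * ubar * t) →
      (∃ ε > 0, E.Commands r (fun t => θin + s * ubar * t) s 0 ε) →
      ∃ (r : ℝ → Plane) (θ u : ℝ → ℝ),
        IsClosedLoopMotion E.v ubar E.d₀ E.γ E.δ E.r₀ (field E.c E.f E.r₀) rin θin r θ u ∧
        NoUnstableSliding E.d₀ E.γ E.δ E.r₀ (field E.c E.f E.r₀) r θ := by
    intro s r hs hr0 hp hstart
    have hsep : E.sep r 0 = rin - E.r₀ 0 := by rw [sep, hr0]
    obtain ⟨t₁, ht₁, -, hcom, hR, hS, hx⟩ := h.reach_surface hp hs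
      (fun τ _ _ t _ => by ring) hstart (hsep ▸ hRm) (hsep ▸ hRp)
    have := h.exists_motion_of_arrival hp hs (fun t => rfl) ht₁.le hcom
      (hR t₁ (right_mem_Icc.2 ht₁.le)) hS hx
    rwa [hr0] at this
  choose r hr0 hp using hpaths
  have hR0 : ∀ s, ‖E.sep (r s) 0‖ ∈ Icc Rm Rp := fun s => by
    rw [sep, hr0]; constructor <;> linarith
  have hsurf : ∀ s s', E.surf (r s) (fun t => θin + s * ubar * t) 0
      = E.surf (r s') (fun t => θin + s' * ubar * t) 0 := fun s s' =>
    surf_congr (by rw [hr0, hr0]) (by simp)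
  rcases eq_or_ne (E.surf (r 1) (fun t => θin + 1 * ubar * t) 0) 0 with hS | hS
  · have hx := (h.turn _ _ 0 le_rfl (hR0 1) hS).1
    rcases lt_or_gt_of_ne (abs_pos.1 hx) with hx | hx
    · obtain ⟨ε, hε, hnear, hmono⟩ := h.exists_strict_mono (hp 1) le_rfl (hR0 1) hS
      -- From the repelling part either saturated turn moves `S` to the side where that very turn is
      -- commanded; the choice of `1` is arbitrary.
      refine hmain 1 (r 1) (.inl rfl) (hr0 1) (hp 1) ⟨ε, hε, fun t ht => ?_⟩
      have habs : |t - 0| < ε := by simpa [abs_of_pos ht.1] using ht.2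
      refine ⟨(hnear t ht.1.le habs).1, ?_⟩
      have h1 := hmono 0 t 1 (.inl rfl) le_rfl ht.1 (by simpa using hε) habs
        (fun y _ => by ring)
      rw [hS] at h1
      nlinarith
    -- The motion slides from the start: the arrival time is zero and the arc is empty.
    · have := h.exists_motion_of_arrival (hp 1) (.inl rfl) (fun t => rfl) le_rfl
        (fun t ht => (ht.1.trans ht.2).false.elim) (hR0 1) hS hx
      rwa [hr0] at this
  · obtain ⟨s, hs, hneg⟩ : ∃ s : ℝ, (s = 1 ∨ s = -1) ∧
        s * E.surf (r s) (fun t => θin + s * ubar * t) 0 < 0 := by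
      rcases lt_or_gt_of_ne hS with h1 | h1
      · exact ⟨1, .inl rfl, by linarith⟩
      · exact ⟨-1, .inr rfl, by rw [hsurf (-1) 1]; linarith⟩
    have hreg : E.RegPath (r s) (fun t => θin + s * ubar * t) := ⟨h.toRegular, hp s⟩
    have h0 := h.sep_ne_zero (hR0 s)
    have h2 : ∀ᶠ t in 𝓝 (0 : ℝ), t ∈ Ici 0 → E.sep (r s) t ≠ 0 ∧
        s * E.surf (r s) (fun t => θin + s * ubar * t) t < 0 := by
      rw [← eventually_nhdsWithin_iff]
      exact (hreg.eventually_sep_ne_zero le_rfl h0).and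
        (((hreg.continuousWithinAt_surf le_rfl h0).const_mul s).eventually_lt
          continuousWithinAt_const hneg)
    obtain ⟨η, hη, hball⟩ := Metric.eventually_nhds_iff.1 h2
    exact hmain s (r s) hs (hr0 s) (hp s) ⟨η, hη, fun t ht =>
      hball (by simpa [Real.dist_eq, abs_of_pos ht.1] using ht.2) ht.1.le⟩

end Bounds

end Env

/-! ### The turning-rate estimate -/

/-- Two transversal velocities whose normal parts differ by `G`. -/
lemma abs_transversal_sub_le {v μ σ wn G s s₀ : ℝ} (hμ : 0 ≤ μ) (hσ : 0 < σ) (hσs : σ ≤ s)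
    (hσs₀ : σ ≤ s₀) (hs : s ^ 2 = v ^ 2 - (wn + G) ^ 2) (hs₀ : s₀ ^ 2 = v ^ 2 - wn ^ 2)
    (hG : |G| ≤ μ) (hwn : |wn| ≤ v) (hwG : |wn + G| ≤ v) : |s - s₀| ≤ μ * v / σ := by
  have e1 : (s - s₀) * (s + s₀) = -(G * (2 * wn + G)) := by linear_combination hs - hs₀
  have e2 : |s - s₀| * (s + s₀) ≤ μ * (2 * v) := by
    rw [← abs_of_pos (by linarith : 0 < s + s₀), ← abs_mul, e1, abs_neg, abs_mul]
    refine mul_le_mul hG ?_ (abs_nonneg _) hμ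
    rw [show 2 * wn + G = wn + (wn + G) by ring]
    exact (abs_add_le _ _).trans (by linarith)
  have e3 := mul_le_mul_of_nonneg_left (add_le_add hσs hσs₀) (abs_nonneg (s - s₀))
  rw [le_div_iff₀ hσ]
  linarith

/-- The turning rate demanded on the surface, compared with that for the zero normal velocity
relative to the centre. -/
lemma turn_perturbation {v v₀ a₀ R M γ b μ σ s s₀ k : ℝ} (hv : 0 ≤ v) (ha₀ : 0 ≤ a₀) (hR : 0 < R)
    (hγ : 0 ≤ γ) (hb : 0 ≤ b) (hμ : 0 ≤ μ) (hσ : 0 < σ) (hσs : σ ≤ s) (hσs₀ : σ ≤ s₀)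
    (hη : |s - s₀| ≤ μ * v / σ) (hk : k ^ 2 ≤ v₀ ^ 2)
    (hM : a₀ / s₀ + (s₀ + k) ^ 2 / (R * s₀) ≤ M) :
    (a₀ + (s + k) ^ 2 / R) / s + (γ * μ + b * μ ^ 2) / s
      ≤ M + ((v / R + γ + b * μ) / σ + v * (a₀ + v₀ ^ 2 / R) / σ ^ 3) * μ := by
  have hspos : 0 < s := hσ.trans_le hσs
  have hs₀pos : 0 < s₀ := hσ.trans_le hσs₀
  obtain ⟨hη2, hη1⟩ := abs_le.1 hη
  have hηpos : 0 ≤ μ * v / σ := by positivity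
  have hinv : 1 / s - 1 / s₀ ≤ μ * v / σ / σ ^ 2 := by
    rw [div_sub_div _ _ hspos.ne' hs₀pos.ne', one_mul, mul_one]
    refine div_le_div₀ hηpos (by linarith) (by positivity) ?_
    rw [sq]; exact mul_le_mul hσs hσs₀ hσ.le hspos.le
  have hkv : k ^ 2 / R ≤ v₀ ^ 2 / R := div_le_div_of_nonneg_right hk hR.le
  have hmain : (a₀ + (s + k) ^ 2 / R) / s ≤ M + (a₀ + v₀ ^ 2 / R) * (μ * v / σ / σ ^ 2)
      + μ * v / σ / R := by
    -- The change from `s₀` to `s` splits exactly into a part through `1/s` and a part linear in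
    -- `s`. With `|s - s₀| ≤ μ v/σ` these give the `σ³` term and the `v/R` term of the tuning
    -- condition.
    have e1 : (a₀ + (s + k) ^ 2 / R) / s = (a₀ / s₀ + (s₀ + k) ^ 2 / (R * s₀))
        + (a₀ + k ^ 2 / R) * (1 / s - 1 / s₀) + (s - s₀) / R := by field_simp; ring
    rw [e1]
    refine add_le_add (add_le_add hM ?_) (div_le_div_of_nonneg_right hη1 hR.le)
    calc (a₀ + k ^ 2 / R) * (1 / s - 1 / s₀) ≤ (a₀ + k ^ 2 / R) * (μ * v / σ / σ ^ 2) :=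
          mul_le_mul_of_nonneg_left hinv (by positivity)
      _ ≤ _ := mul_le_mul_of_nonneg_right (by linarith) (by positivity)
  have hrest : (γ * μ + b * μ ^ 2) / s ≤ (γ * μ + b * μ ^ 2) / σ :=
    div_le_div_of_nonneg_left (by positivity) hσ hσs
  have e2 : (a₀ + v₀ ^ 2 / R) * (μ * v / σ / σ ^ 2) + μ * v / σ / R + (γ * μ + b * μ ^ 2) / σ
      = ((v / R + γ + b * μ) / σ + v * (a₀ + v₀ ^ 2 / R) / σ ^ 3) * μ := by field_simp; ring
  linarith

/-- On the switching surface the required turning rate is within the bound on the control. -/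
lemma turn_estimate {v v₀ a₀ R ubar Δu γ b μ σ wn wt vt G ρ an β : ℝ} (hv₀ : 0 ≤ v₀) (hv : v₀ < v)
    (ha₀ : 0 ≤ a₀) (hR : 0 < R) (hγ : 0 ≤ γ) (hμ : 0 ≤ μ) (hμv : v₀ + μ < v)
    (hσ : 0 < σ) (hσ2 : σ ^ 2 = (v - v₀) ^ 2 - 2 * v * μ - μ ^ 2)
    (hman : ∀ vn ∈ Icc 0 v₀, a₀ / √(v ^ 2 - vn ^ 2)
      + (√(v ^ 2 - vn ^ 2) + √(v₀ ^ 2 - vn ^ 2)) ^ 2 / (R * √(v ^ 2 - vn ^ 2)) ≤ ubar - Δu)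
    (htune : ((v / R + γ + b * μ) / σ + v * (a₀ + v₀ ^ 2 / R) / σ ^ 3) * μ < Δu)
    (hw : wn ^ 2 + wt ^ 2 ≤ v₀ ^ 2) (hvt : vt ^ 2 + (wn + G) ^ 2 = v ^ 2) (hG : |G| ≤ μ)
    (hρ : R ≤ ρ) (han : |an| ≤ a₀) (hβ : 0 ≤ β) (hβb : β ≤ b) :
    0 < |vt| ∧ |(vt - wt) ^ 2 / ρ - an| + γ * |G| + β * G ^ 2 < ubar * |vt| := by
  have hvpos : 0 < v := hv₀.trans_lt hv
  have hb : 0 ≤ b := hβ.trans hβb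
  have hwn2 : wn ^ 2 ≤ v₀ ^ 2 := by linarith [sq_nonneg wt]
  have hwn : |wn| ≤ v₀ := abs_le_of_sq_le_sq hwn2 hv₀
  have hvv : v₀ ^ 2 ≤ v ^ 2 := pow_le_pow_left₀ hv₀ hv.le 2
  have hwG : |wn + G| ≤ v₀ + μ := (abs_add_le _ _).trans (add_le_add hwn hG)
  have hwG2 := sq_le_sq' (neg_le_of_abs_le hwG) (le_of_abs_le hwG)
  have hm1 := mul_nonneg hv₀ (sub_nonneg.2 hv.le)
  have hm2 := mul_nonneg hμ (sub_nonneg.2 hv.le)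
  have hm3 := mul_nonneg hμ hvpos.le
  have hs2 : |vt| ^ 2 = v ^ 2 - (wn + G) ^ 2 := by rw [sq_abs]; linarith
  -- The radial velocity is at most `v₀ + μ`, and `v² - (v₀ + μ)²` exceeds `σ²` by `2 (v₀ + μ)(v -
  -- v₀)`.
  have hσs : σ ≤ |vt| := by
    refine (abs_le_of_sq_le_sq' ?_ (abs_nonneg vt)).2
    rw [hσ2, hs2]
    linarith
  have hspos : 0 < |vt| := hσ.trans_le hσs
  -- The free variable of the maneuverability condition is taken to be the modulus of the radial
  -- component of the centre's velocity.
  have hman' := hman |wn| ⟨abs_nonneg _, hwn⟩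
  rw [sq_abs] at hman'
  have hs₀2 : √(v ^ 2 - wn ^ 2) ^ 2 = v ^ 2 - wn ^ 2 := Real.sq_sqrt (by linarith)
  have hk2 : √(v₀ ^ 2 - wn ^ 2) ^ 2 = v₀ ^ 2 - wn ^ 2 := Real.sq_sqrt (by linarith)
  have hk0 : 0 ≤ √(v₀ ^ 2 - wn ^ 2) := Real.sqrt_nonneg _
  have hσs₀ : σ ≤ √(v ^ 2 - wn ^ 2) := by
    refine (abs_le_of_sq_le_sq' ?_ (Real.sqrt_nonneg _)).2
    rw [hσ2, hs₀2]
    linarith [sq_nonneg μ]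
  have hwt : |wt| ≤ √(v₀ ^ 2 - wn ^ 2) := abs_le_of_sq_le_sq (by linarith) hk0
  have hη := abs_transversal_sub_le hμ hσ hσs hσs₀ hs2 hs₀2 hG (hwn.trans hv.le)
    (hwG.trans hμv.le)
  have hkv : √(v₀ ^ 2 - wn ^ 2) ^ 2 ≤ v₀ ^ 2 := by linarith [sq_nonneg wn]
  have hsum : (a₀ + (|vt| + √(v₀ ^ 2 - wn ^ 2)) ^ 2 / R) / |vt| + (γ * μ + b * μ ^ 2) / |vt|
      < ubar :=
    (turn_perturbation hvpos.le ha₀ hR hγ hb hμ hσ hσs hσs₀ hη hkv hman').trans_lt (by linarith)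
  rw [← add_div, div_lt_iff₀ hspos] at hsum
  have hρ0 : 0 < ρ := hR.trans_le hρ
  have hdrift : |(vt - wt) ^ 2 / ρ - an| ≤ (|vt| + √(v₀ ^ 2 - wn ^ 2)) ^ 2 / R + a₀ := by
    refine (abs_sub _ _).trans (add_le_add ?_ han)
    rw [abs_of_nonneg (by positivity)]
    refine div_le_div₀ (by positivity) ?_ hR hρ
    have e3 : |vt - wt| ≤ |vt| + √(v₀ ^ 2 - wn ^ 2) := (abs_sub _ _).trans (by linarith)
    exact sq_le_sq' (neg_le_of_abs_le e3) (le_of_abs_le e3)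
  have hG2 : β * G ^ 2 ≤ b * μ ^ 2 := by
    refine mul_le_mul hβb ?_ (sq_nonneg _) hb
    exact sq_le_sq' (neg_le_of_abs_le hG) (le_of_abs_le hG)
  have hγG := mul_le_mul_of_nonneg_left hG hγ
  exact ⟨hspos, by linarith⟩

lemma norm_le_of_forall_pos {g : ℝ → Plane} {M : ℝ}
    (hg : ContinuousOn g (Ici 0)) (hM : ∀ t, 0 < t → ‖g t‖ ≤ M) {t : ℝ} (ht : 0 ≤ t) :
    ‖g t‖ ≤ M := by
  rcases ht.eq_or_lt with rfl | ht
  · have h1 : Tendsto (fun t => ‖g t‖) (𝓝[>] 0) (𝓝 ‖g 0‖) :=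
      ((hg 0 self_mem_Ici).mono Ioi_subset_Ici_self).norm
    exact le_of_tendsto h1 (eventually_nhdsWithin_of_forall hM)
  · exact hM t ht

/-! ### Verification of the bounds from the data -/

namespace Data

variable (P : Data)

/-- The standing assumptions of the theorem on the numerical data and the profile. -/
structure Standing (Δu : ℝ) : Prop where
  ubar_pos : 0 < P.ubar
  v₀_nonneg : 0 ≤ P.v₀
  a₀_nonneg : 0 ≤ P.a₀
  Rin_le : P.Rinm ≤ P.Rinp
  cm_pos : 0 < P.cm
  f_contDiffOn : ContDiffOn ℝ 2 P.f (Ioi 0)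
  f_deriv_neg : ∀ z, 0 < z → deriv P.f z < 0
  range_cm : P.d₀ / P.cm ∈ P.f '' Ioi 0
  range_cp : P.d₀ / P.cp ∈ P.f '' Ioi 0
  v_gt : P.v₀ < P.v
  far : (2 * P.v + 4 * Real.pi * P.v₀) / P.ubar < P.Rinm
  Δu_pos : 0 < Δu
  maneuverable : P.Maneuverable Δu

/-- The closed-loop environment for given uncertain data and controller parameters. -/
def env (c γ δ : ℝ) (r₀ : ℝ → Plane) : Env where
  v := P.v
  c := c
  d₀ := P.d₀
  γ := γ
  δ := δ
  f := P.f
  r₀ := r₀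

variable {P} {Δu : ℝ}

lemma finv_spec {y : ℝ} (hy : y ∈ P.f '' Ioi 0) : 0 < P.finv y ∧ P.f (P.finv y) = y :=
  ⟨Function.invFunOn_mem hy, Function.invFunOn_eq hy⟩

namespace Standing

variable (h : P.Standing Δu)
include h

lemma v_pos : 0 < P.v := h.v₀_nonneg.trans_lt h.v_gt

lemma range_pos : 0 < (2 * P.v + 4 * Real.pi * P.v₀) / P.ubar := by
  have := h.v_pos
  have := h.v₀_nonneg
  have := h.ubar_pos
  have := Real.pi_pos
  positivity

lemma Rm_pos : 0 < P.Rm :=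
  lt_min (sub_pos.2 h.far) (lt_min (finv_spec h.range_cm).1 (finv_spec h.range_cp).1)

lemma Rm_le_Rp : P.Rm ≤ P.Rp := by
  have h1 := h.range_pos
  exact (min_le_left _ _).trans (le_trans (by linarith [h.Rin_le]) (le_max_left _ _))

lemma Icc_subset : Icc P.Rm P.Rp ⊆ Ioi 0 := fun _ hx => h.Rm_pos.trans_le hx.1

lemma contDiffOn_deriv : ContDiffOn ℝ 1 (deriv P.f) (Ioi 0) :=
  h.f_contDiffOn.deriv_of_isOpen isOpen_Ioi (by norm_num)

lemma continuousOn_abs_deriv : ContinuousOn (fun R => |deriv P.f R|) (Icc P.Rm P.Rp) :=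
  (h.contDiffOn_deriv.continuousOn.mono h.Icc_subset).abs

lemma minSlope_le {R : ℝ} (hR : R ∈ Icc P.Rm P.Rp) : P.minSlope ≤ |deriv P.f R| :=
  csInf_le (isCompact_Icc.bddBelow_image h.continuousOn_abs_deriv) (mem_image_of_mem _ hR)

lemma minSlope_pos : 0 < P.minSlope := by
  obtain ⟨R, hR, hRe⟩ := (isCompact_Icc.image_of_continuousOn h.continuousOn_abs_deriv).sInf_mem
    ((nonempty_Icc.2 h.Rm_le_Rp).image _)
  have h1 : P.minSlope = |deriv P.f R| := hRe.symm
  rw [h1]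
  exact abs_pos.2 (h.f_deriv_neg R (h.Icc_subset hR)).ne

lemma le_bn {R : ℝ} (hR : R ∈ Icc P.Rm P.Rp) :
    |deriv (deriv P.f) R| / |deriv P.f R| ≤ P.bn := by
  refine le_csSup (isCompact_Icc.bddAbove_image ?_)
    (mem_image_of_mem (fun R => |deriv (deriv P.f) R| / |deriv P.f R|) hR)
  exact (((h.contDiffOn_deriv.continuousOn_deriv_of_isOpen isOpen_Ioi le_rfl).mono
    h.Icc_subset).abs).div h.continuousOn_abs_deriv
    fun x hx => (abs_pos.2 (h.f_deriv_neg x (h.Icc_subset hx)).ne).ne'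

/-- With `γ = 1` fixed, the left side of the last tuning inequality is continuous in `μ` and
vanishes at zero, so every small `μ > 0` is suitable; `δ = μ c₋ min |f'|` realises it. -/
lemma exists_tuned : ∃ γ δ : ℝ, 0 < γ ∧ 0 < δ ∧ P.Tuned Δu γ δ := by
  have hm : 0 < P.cm * P.minSlope := mul_pos h.cm_pos h.minSlope_pos
  have hvv : 0 < P.v - P.v₀ := sub_pos.2 h.v_gt
  have hσ0 : P.sigma 0 = P.v - P.v₀ := by
    rw [sigma]; simp [Real.sqrt_sq hvv.le]
  have hσc : ContinuousAt P.sigma 0 := by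
    unfold sigma; fun_prop
  have hc : ContinuousAt (fun μ => ((P.v / P.Rm + 1 + P.bn * μ) / P.sigma μ
      + P.v * (P.a₀ + P.v₀ ^ 2 / P.Rm) / P.sigma μ ^ 3) * μ) 0 := by
    have hne : P.sigma 0 ≠ 0 := hσ0 ▸ hvv.ne'
    exact (((by fun_prop : ContinuousAt (fun μ => P.v / P.Rm + 1 + P.bn * μ) 0).div hσc hne).add
      (continuousAt_const.div (hσc.pow 3) (pow_ne_zero 3 hne))).mul continuousAt_id
  have h1 : ∀ᶠ μ in 𝓝 (0 : ℝ), ((P.v / P.Rm + 1 + P.bn * μ) / P.sigma μ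
      + P.v * (P.a₀ + P.v₀ ^ 2 / P.Rm) / P.sigma μ ^ 3) * μ < Δu :=
    hc.tendsto.eventually_lt_const (by simpa using h.Δu_pos)
  have h2 : 0 < √(P.v ^ 2 + (P.v - P.v₀) ^ 2) - P.v :=
    sub_pos.2 (Real.lt_sqrt_of_sq_lt (by linarith [pow_pos hvv 2]))
  have h3 : ∀ᶠ μ in 𝓝[>] (0 : ℝ), _ := nhdsWithin_le_nhds (h1.and (gt_mem_nhds h2))
  obtain ⟨μ, ⟨hμ1, hμ2⟩, hμ0⟩ := (h3.and self_mem_nhdsWithin).exists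
  have hμ : P.muStar 1 (μ * (P.cm * P.minSlope)) = μ := by
    rw [muStar, one_mul, mul_div_cancel_right₀ _ hm.ne']
  refine ⟨1, μ * (P.cm * P.minSlope), one_pos, mul_pos hμ0 hm, ?_⟩
  rw [Tuned, hμ]
  exact ⟨hμ0, hμ2, hμ1⟩

lemma regular {c γ δ : ℝ} {r₀ : ℝ → Plane} {rin : Plane} (hk : P.Known c r₀ rin) (hγ : 0 < γ)
    (hδ : 0 < δ) : (P.env c γ δ r₀).Regular where
  v_pos := h.v_pos
  c_pos := h.cm_pos.trans_le hk.intensity_lower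
  γ_pos := hγ
  δ_pos := hδ
  f_contDiffOn := h.f_contDiffOn
  f_deriv_neg := h.f_deriv_neg
  r₀_contDiffOn := hk.contDiffOn

/-- The value `d₀/c` lies between `d₀/c₋` and `d₀/c₊`, in an order that depends on the sign of `d₀`.
The intermediate value theorem puts the desired distance between the two extreme ones. -/
lemma exists_target {c : ℝ} (hc : P.cm ≤ c) (hc' : c ≤ P.cp) :
    ∃ R ∈ Icc P.Rm P.Rp, c * P.f R = P.d₀ := by
  obtain ⟨hm0, hm⟩ := finv_spec h.range_cm
  obtain ⟨hp0, hp⟩ := finv_spec h.range_cp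
  have hcm := h.cm_pos
  have hc0 : 0 < c := hcm.trans_le hc
  have hcp0 : 0 < P.cp := hc0.trans_le hc'
  have hi1 : 1 / c ≤ 1 / P.cm := one_div_le_one_div_of_le hcm hc
  have hi2 : 1 / P.cp ≤ 1 / c := one_div_le_one_div_of_le hc0 hc'
  have hmem : P.d₀ / c ∈ uIcc (P.f (P.finv (P.d₀ / P.cm))) (P.f (P.finv (P.d₀ / P.cp))) := by
    rw [hm, hp, mem_uIcc, div_eq_mul_one_div P.d₀ c, div_eq_mul_one_div P.d₀ P.cm,
      div_eq_mul_one_div P.d₀ P.cp]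
    rcases le_total 0 P.d₀ with h0 | h0
    · exact .inr ⟨mul_le_mul_of_nonneg_left hi2 h0, mul_le_mul_of_nonneg_left hi1 h0⟩
    · exact .inl ⟨mul_le_mul_of_nonpos_left hi1 h0, mul_le_mul_of_nonpos_left hi2 h0⟩
  have hsub : uIcc (P.finv (P.d₀ / P.cm)) (P.finv (P.d₀ / P.cp)) ⊆ Ioi 0 := fun x hx =>
    (lt_min hm0 hp0).trans_le hx.1
  obtain ⟨R, hR, hRe⟩ := intermediate_value_uIcc (h.f_contDiffOn.continuousOn.mono hsub) hmem
  refine ⟨R, ⟨(min_le_right _ _).trans hR.1, hR.2.trans (le_max_right _ _)⟩, ?_⟩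
  rw [hRe]; field_simp

lemma centre_speed {c γ δ : ℝ} {r₀ : ℝ → Plane} {rin : Plane} (hk : P.Known c r₀ rin) (hγ : 0 < γ)
    (hδ : 0 < δ) {t : ℝ} (ht : 0 ≤ t) : ‖(P.env c γ δ r₀).centreVel t‖ ≤ P.v₀ := by
  refine norm_le_of_forall_pos (h.regular hk hγ hδ).contDiffOn_centreVel.continuousOn
    (fun t ht => ?_) ht
  rw [Env.centreVel, derivWithin_of_mem_nhds (Ici_mem_nhds ht)]
  exact hk.speed_le t ht

lemma centre_accel {c γ δ : ℝ} {r₀ : ℝ → Plane} {rin : Plane} (hk : P.Known c r₀ rin) (hγ : 0 < γ)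
    (hδ : 0 < δ) {t : ℝ} (ht : 0 ≤ t) : ‖(P.env c γ δ r₀).centreAcc t‖ ≤ P.a₀ := by
  refine norm_le_of_forall_pos (h.regular hk hγ hδ).continuousOn_centreAcc (fun t ht => ?_) ht
  have hev : (P.env c γ δ r₀).centreVel =ᶠ[𝓝 t] deriv r₀ := by
    filter_upwards [lt_mem_nhds ht] with y hy
    exact derivWithin_of_mem_nhds (Ici_mem_nhds hy)
  rw [Env.centreAcc, derivWithin_of_mem_nhds (Ici_mem_nhds ht), hev.deriv_eq]
  exact hk.accel_le t ht

lemma bounds {c γ δ : ℝ} {r₀ : ℝ → Plane} {rin : Plane} (hk : P.Known c r₀ rin) (hγ : 0 < γ)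
    (hδ : 0 < δ) (ht : P.Tuned Δu γ δ) :
    (P.env c γ δ r₀).Bounds P.ubar P.v₀ (P.muStar γ δ) P.Rm P.Rp := by
  have hreg := h.regular hk hγ hδ
  obtain ⟨hμ0, hμ1, htune⟩ := ht
  set μ := P.muStar γ δ with hμ
  have hvp := h.v_pos
  have hvv : 0 < P.v - P.v₀ := sub_pos.2 h.v_gt
  -- Squaring the upper bound on `μ_*` gives exactly the positivity of the radicand of `σ`.
  have hσ2 : 0 < (P.v - P.v₀) ^ 2 - 2 * P.v * μ - μ ^ 2 := by
    have h1 := Real.lt_sqrt (by positivity) |>.1 (lt_sub_iff_add_lt.1 hμ1)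
    nlinarith
  have hμv : P.v₀ + μ < P.v := by
    by_contra! hcon
    nlinarith [mul_pos hvp hμ0]
  have hchi : ∀ R ∈ Icc P.Rm P.Rp, γ * δ ≤ μ * (c * |deriv P.f R|) := fun R hR => by
    have hm : 0 < P.cm * P.minSlope := mul_pos h.cm_pos h.minSlope_pos
    have h1 : γ * δ = μ * (P.cm * P.minSlope) := by
      rw [hμ, muStar, div_mul_cancel₀ _ hm.ne']
    rw [h1]
    exact mul_le_mul_of_nonneg_left (mul_le_mul hk.intensity_lower (h.minSlope_le hR)
      h.minSlope_pos.le (h.cm_pos.le.trans hk.intensity_lower)) hμ0.le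
  refine
    { toRegular := hreg
      ubar_pos := h.ubar_pos
      v₀_nonneg := h.v₀_nonneg
      μ_nonneg := hμ0.le
      speed_lt := hμv
      Rm_pos := h.Rm_pos
      centre_speed := fun t ht => h.centre_speed hk hγ hδ ht
      chi_le := hchi
      turn := ?_
      exists_target := h.exists_target hk.intensity_lower hk.intensity_upper }
  intro r θ t ht hR hS
  set E := P.env c γ δ r₀ with hE
  have hN : 0 < ‖E.sep r t‖ := h.Rm_pos.trans_le hR.1
  have hneg := h.f_deriv_neg _ hN
  have hc0 : 0 < c := hreg.c_pos
  -- On the surface `c |f'| |G| = |χ| ≤ γ δ`, and `μ_*` is defined so that `γ δ ≤ μ_* c |f'|` on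
  -- `[R₋, R₊]`.
  have hG : |E.rangeRate r θ t| ≤ μ := by
    have h1 : c * deriv P.f ‖E.sep r t‖ * E.rangeRate r θ t
        = -chi γ δ (E.meas r t - P.d₀) := eq_neg_of_add_eq_zero_left hS
    have h2 : (c * |deriv P.f ‖E.sep r t‖|) * |E.rangeRate r θ t|
        = |chi γ δ (E.meas r t - P.d₀)| := by
      rw [← abs_neg (chi γ δ _), ← h1, abs_mul, abs_mul, abs_of_pos hc0]
    have h3 := (abs_chi_le hγ.le hδ.le (E.meas r t - P.d₀)).trans (hchi _ hR)
    rw [← h2, mul_comm] at h3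
    exact le_of_mul_le_mul_right h3 (mul_pos hc0 (abs_pos.2 hneg.ne))
  have hw := h.centre_speed hk hγ hδ ht
  have ha := h.centre_accel hk hγ hδ ht
  rw [← hE] at hw ha
  set N := E.sep r t with hNdef
  set w := E.centreVel t with hwdef
  set e := heading (θ t) with hedef
  have hGe : E.rangeRate r θ t = (P.v * inner ℝ N e - inner ℝ N w) / ‖N‖ := by
    rw [Env.rangeRate, Env.relVel, inner_sub_right, inner_smul_right]; rfl
  have hve : E.tangVel r θ t = P.v * cross N e / ‖N‖ := rfl
  -- The velocities are resolved along and across the line of sight, in the form that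
  -- `turn_estimate` requires.
  have hde : E.drift r θ t = (E.tangVel r θ t - cross N w / ‖N‖) ^ 2 / ‖N‖
      - inner ℝ N (E.centreAcc t) / ‖N‖ := by
    have hcr : cross N (E.relVel θ t) = P.v * cross N e - cross N w := by
      have : E.relVel θ t = P.v • e - w := rfl
      rw [this]; simp [cross]; ring
    rw [Env.drift, ← hNdef, hcr, hve]
    field_simp
  rw [hde]
  refine turn_estimate (wn := inner ℝ N w / ‖N‖) h.v₀_nonneg h.v_gt h.a₀_nonneg h.Rm_pos hγ.le
    hμ0.le hμv (Real.sqrt_pos.2 hσ2) (Real.sq_sqrt hσ2.le) h.maneuverable htune ?_ ?_ hG hR.1 ?_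
    (by positivity) (h.le_bn hR)
  · have h1 := inner_sq_add_cross_sq N w
    have h2 : (inner ℝ N w / ‖N‖) ^ 2 + (cross N w / ‖N‖) ^ 2 = ‖w‖ ^ 2 := by
      field_simp; linarith
    rw [h2]
    exact pow_le_pow_left₀ (norm_nonneg _) hw 2
  · have h1 := inner_sq_add_cross_sq N e
    rw [hedef, norm_heading, ← hedef] at h1
    rw [hve, hGe]
    field_simp
    linear_combination P.v ^ 2 * h1
  · rw [abs_div, abs_norm, div_le_iff₀ hN, mul_comm]
    exact (abs_real_inner_le_norm _ _).trans (mul_le_mul_of_nonneg_left ha hN.le)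

lemma achieves {γ δ : ℝ} (hγ : 0 < γ) (hδ : 0 < δ) (ht : P.Tuned Δu γ δ) : P.Achieves γ δ := by
  intro c r₀ rin θin hk
  have hb := h.bounds hk hγ hδ ht
  have hRm : P.Rm + Env.turnRange P.v P.ubar P.v₀ ≤ ‖rin - r₀ 0‖ := by
    have : P.Rm ≤ P.Rinm - Env.turnRange P.v P.ubar P.v₀ := min_le_left _ _
    linarith [hk.dist_lower]
  have hRp : ‖rin - r₀ 0‖ + Env.turnRange P.v P.ubar P.v₀ ≤ P.Rp := by
    have : P.Rinp + Env.turnRange P.v P.ubar P.v₀ ≤ P.Rp := le_max_left _ _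
    linarith [hk.dist_upper]
  exact ⟨hb.exists_motion rin θin hRm hRp, fun r θ u hm hn =>
    hb.motion_reaches_isoline hRm hRp hm hn⟩

end Standing

end Data

end RadialTracking

end

theorem mainTheorem5 (P : RadialTracking.Data) (Δu : ℝ)
    (hubar : 0 < P.ubar) (hv₀ : 0 ≤ P.v₀) (ha₀ : 0 ≤ P.a₀)
    (hRin : 0 < P.Rinm) (hRin' : P.Rinm ≤ P.Rinp)
    (hcm : 0 < P.cm) (hcp : P.cm ≤ P.cp)
    (hf : ContDiffOn ℝ 2 P.f (Set.Ioi 0)) (hf' : ∀ z, 0 < z → deriv P.f z < 0)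
    (hdm : P.d₀ / P.cm ∈ P.f '' Set.Ioi 0) (hdp : P.d₀ / P.cp ∈ P.f '' Set.Ioi 0)
    (hv : P.v₀ < P.v)
    (hfar : (2 * P.v + 4 * Real.pi * P.v₀) / P.ubar < P.Rinm)
    (hΔu : 0 < Δu) (hman : P.Maneuverable Δu) :
    (∃ γ δ : ℝ, 0 < γ ∧ 0 < δ ∧ P.Tuned Δu γ δ) ∧
    (∃ γ δ : ℝ, 0 < γ ∧ 0 < δ ∧ P.Achieves γ δ) ∧
    ∀ γ δ : ℝ, 0 < γ → 0 < δ → P.Tuned Δu γ δ → P.Achieves γ δ := by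
  have h : P.Standing Δu :=
    ⟨hubar, hv₀, ha₀, hRin', hcm, hf, hf', hdm, hdp, hv, hfar, hΔu, hman⟩
  obtain ⟨γ, δ, hγ, hδ, ht⟩ := h.exists_tuned
  exact ⟨⟨γ, δ, hγ, hδ, ht⟩, ⟨γ, δ, hγ, hδ, h.achieves hγ hδ ht⟩,
    fun γ δ hγ hδ ht => h.achieves hγ hδ ht⟩
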